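/- Setting. Let $\mathcal T$ be a finite conforming mesh of non-degenerate closed triangles in $\mathbb R^2$, let $\Omega$ be the interior of their union, $\Gamma=\partial\Omega$, and let $n$ be the outward unit normal (defined off the corners). Let $\mathcal V_h^P$ be the space of continuous functions on $\overline\Omega$ that are polynomials of degree at most $P$ on each element. Let $f\in L^2(\Omega)$, $u_{RD},q_{RN}\in L^2(\Gamma)$, $\alpha\in\mathbb R$, $\gamma>0$. For a test function $v$ write $$\mathcal I_\Omega(u)=(\nabla u,\nabla v)_\Omega+\alpha(u,v)_\Omega,\qquad \mathcal N_\Gamma(g)=(g,\,v/\gamma-\nabla v\cdot n)_\Gamma .$$ For $\varepsilon>0$, the Nitsche–Robin method for $-\Delta u+\alpha u=f$ in $\Omega$, $u+\varepsilon\nabla u\cdot n=u_{RD}+\varepsilon q_{RN}$ on $\Gamma$, is to find $u^\varepsilon\in\mathcal V_h^P$ such that for all $v\in\mathcal V_h^P$ $$\mathcal I_\Omega(u^\varepsilon)-(f,v)_\Omega-(\nabla u^\varepsilon\cdot n,v)_\Gamma+\tfrac{\gamma}{\gamma+\varepsilon}\mathcal N_\Gamma(u^\varepsilon-u_{RD})+\tfrac{\varepsilon\gamma}{\gamma+\varepsilon}\mathcal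 N_\Gamma(\nabla u^\varepsilon\cdot n-q_{RN})=0. \tag{R}$$ For a sequence of modes $(u_m)$ put $f_0=f$, $f_m=0$ for $m\ge1$, and $u_{D,0}=u_{RD}$, $u_{D,1}=q_{RN}-\nabla u_0\cdot n$, $u_{D,m}=-\nabla u_{m-1}\cdot n$ for $m\ge 2$. The mode problem of order $m$ is: for all $v\in\mathcal V_h^P$, $$\mathcal I_\Omega(u_m)-(f_m,v)_\Omega-(\nabla u_m\cdot n,v)_\Gamma+\mathcal N_\Gamma(u_m-u_{D,m})=\mathcal E_m,\qquad \mathcal E_m=-\sum_{\ell=0}^{m-1}(-\gamma)^{-(m-\ell)}\mathcal N_\Gamma(u_\ell-u_{D,\ell}), \tag{D$_m$}$$ so that $\mathcal E_0=0$; its left-hand side is the classical Nitsche–Dirichlet form with data $f_m$, $u_{D,m}$. Proposition (asymptotic preserving property of the Nitsche–Robin method in the Dirichlet limit $\varepsilon\to0$). 1. (Cascade.) If $u^\varepsilon\in\mathcal V_h^P$ solves (R) for all small $\varepsilon>0$ and $u^\varepsilon=\sum_{m=0}^M\varepsilon^m u_m+o(\varepsilon^M)$ as $\varepsilon\to0^+$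 on $\overline\Omega$, with $u_0,\dots,u_M\in\mathcal V_h^P$, then (D$_m$) holds for every $m\le M$. 2. (Consistency.) Let $w_0,\dots,w_M\in C^2(\Omega)\cap C^1(\overline\Omega)$ solve the continuous asymptotic Dirichlet problems $-\Delta w_m+\alpha w_m=f_m$ in $\Omega$, $w_m=u_{D,m}$ on $\Gamma$ off the corners, with $u_{D,m}$ formed from the $w_\ell$, $\ell<m$. Then, for every $m\le M$ and $v\in\mathcal V_h^P$, (D$_m$) holds with $u_\ell=w_\ell$ for all $\ell\le m$, and its error term $\mathcal E_m$ vanishes. 3. (Coercivity and solvability.) For all $P$ and $\sigma$ there is $C_\gamma>0$, and for every $D$ there is $c>0$ depending only on $P,\sigma,D$, such that the following holds for every mesh with $h_T^2\le\sigma|T|$ for all elements $T$ (where $h_T$ is the diameter and $|T|$ the area of $T$) and $\operatorname{diam}\Omega\le D$, for every $\alpha\ge0$ and every $\gamma>0$ with $\gamma\le C_\gamma h_T$ for all elements $T$ that meet $\Gamma$. For all $v\in\mathcal V_h^P$ $$(\nabla v,\nabla v)_\Omega+\alpha(v,v)_\Omega-2(\nabla v\cdot n,v)_\Gamma+\gamma^{-1}(v,v)_\Gamma\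 \ge\ c\left(\|\nabla v\|_{L^2(\Omega)}^2+\|v\|_{L^2(\Omega)}^2+\gamma^{-1}\|v\|_{L^2(\Gamma)}^2\right).$$ Given $u_0,\dots,u_{m-1}\in\mathcal V_h^P$, the problem (D$_m$) has exactly one solution $u_m\in\mathcal V_h^P$. For all sufficiently small $\varepsilon>0$, (R) has exactly one solution $u^\varepsilon\in\mathcal V_h^P$, and there are modes $u_m\in\mathcal V_h^P$ such that the expansion in 1 holds for every $M$. -/

import Mathlib

open MeasureTheory Filter Topology Asymptotics

/-- The Euclidean plane. -/
abbrev Plane : Type := EuclideanSpace ℝ (Fin 2)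

/-- A finite conforming mesh of non-degenerate closed triangles: an element is given by its three
vertices, and two elements meet exactly in the convex hull of their common vertices (that is, in
nothing, a common vertex, a common edge, or they coincide). -/
structure TriMesh where
  elems : Finset (Finset Plane)
  card_eq_three : ∀ T ∈ elems, T.card = 3
  nondegenerate : ∀ T ∈ elems, AffineIndependent ℝ ((↑) : T → Plane)
  conforming : ∀ S ∈ elems, ∀ T ∈ elems,
    convexHull ℝ (S : Set Plane) ∩ convexHull ℝ (T : Set Plane)
      = convexHull ℝ ((S : Set Plane) ∩ (T : Set Plane))

noncomputable section

/-- The closed triangle with the given vertices. -/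
def element (T : Finset Plane) : Set Plane := convexHull ℝ (T : Set Plane)

/-- The polygonal open set `Ω` covered by the mesh. -/
def TriMesh.domain (𝓣 : TriMesh) : Set Plane := interior (⋃ T ∈ 𝓣.elems, element T)

/-- Shape regularity with constant `σ`: `h_T ^ 2 ≤ σ |T|` for every element `T`, with `h_T` its
diameter and `|T|` its area. -/
def TriMesh.ShapeRegular (𝓣 : TriMesh) (σ : ℝ) : Prop :=
  ∀ T ∈ 𝓣.elems, Metric.diam (element T) ^ 2 ≤ σ * volume.real (element T)

/-- The finite element space of continuous functions on the closure of `Ω` that are polynomials of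
degree at most `P` on each element. Functions on the closure of `Ω` are represented by functions on
the plane that vanish outside it. -/
def TriMesh.feSpace (𝓣 : TriMesh) (P : ℕ) : Submodule ℝ (Plane → ℝ) where
  carrier := {v | ContinuousOn v (closure 𝓣.domain) ∧
    (∀ T ∈ 𝓣.elems, ∃ p : MvPolynomial (Fin 2) ℝ, p.totalDegree ≤ P ∧
      ∀ x ∈ element T, v x = MvPolynomial.eval (fun i => x i) p) ∧
    ∀ x ∉ closure 𝓣.domain, v x = 0}
  add_mem' := by
    rintro u v ⟨hu, pu, zu⟩ ⟨hv, pv, zv⟩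
    refine ⟨hu.add hv, fun T hT => ?_, fun x hx => by simp [zu x hx, zv x hx]⟩
    obtain ⟨p, hp, hpu⟩ := pu T hT
    obtain ⟨q, hq, hqv⟩ := pv T hT
    exact ⟨p + q, (MvPolynomial.totalDegree_add p q).trans (max_le hp hq),
      fun x hx => by simp [hpu x hx, hqv x hx]⟩
  zero_mem' :=
    ⟨continuousOn_const, fun _ _ => ⟨0, by simp, fun _ _ => by simp⟩, fun _ _ => rfl⟩
  smul_mem' := by
    rintro a v ⟨hv, pv, zv⟩
    refine ⟨hv.const_smul a, fun T hT => ?_, fun x hx => by simp [zv x hx]⟩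
    obtain ⟨q, hq, hqv⟩ := pv T hT
    exact ⟨a • q, (MvPolynomial.totalDegree_smul_le a q).trans hq,
      fun x hx => by simp [hqv x hx, MvPolynomial.smul_eval]⟩

/-- `ν` is the outward unit normal to `Ω` at `x`, for a polygonal `Ω`: near `x` the set `Ω` is the
open half plane below `x` in direction `ν`. This fails for every `ν` at the corners of `Ω`. -/
def IsOutwardNormal (Ω : Set Plane) (x ν : Plane) : Prop :=
  ‖ν‖ = 1 ∧ ∃ r > 0, ∀ y ∈ Metric.ball x r, y ∈ Ω ↔ inner ℝ (y - x) ν < 0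

open Classical in
/-- The outward unit normal `n` (set to zero at the finitely many corners). -/
def outwardNormal (Ω : Set Plane) (x : Plane) : Plane :=
  if h : ∃ ν, IsOutwardNormal Ω x ν then h.choose else 0

/-- The normal derivative `∇u · n` on the boundary of `Ω`, with the gradient taken from inside. -/
def normalDeriv (Ω : Set Plane) (u : Plane → ℝ) (x : Plane) : ℝ :=
  inner ℝ (gradientWithin u (closure Ω) x) (outwardNormal Ω x)

/-- Arc length on the boundary `Γ` of `Ω`. -/
def bdryMeasure (Ω : Set Plane) : Measure Plane :=
  (Measure.hausdorffMeasure 1).restrict (frontier Ω)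

/-- `(g, k)_Ω` -/
def domPair (Ω : Set Plane) (g k : Plane → ℝ) : ℝ := ∫ x in Ω, g x * k x

/-- `(g, k)_Γ` -/
def bdryPair (Ω : Set Plane) (g k : Plane → ℝ) : ℝ := ∫ x, g x * k x ∂(bdryMeasure Ω)

/-- `(∇u, ∇v)_Ω`. The gradients of finite element functions exist off the edges of the mesh, hence
almost everywhere. -/
def gradPair (Ω : Set Plane) (u v : Plane → ℝ) : ℝ :=
  ∫ x in Ω, inner ℝ (gradient u x) (gradient v x)

/-- `I_Ω(u) = (∇u, ∇v)_Ω + α (u, v)_Ω` -/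
def formI (Ω : Set Plane) (α : ℝ) (u v : Plane → ℝ) : ℝ :=
  gradPair Ω u v + α * domPair Ω u v

/-- `N_Γ(g) = (g, v / γ - ∇v · n)_Γ` -/
def formN (Ω : Set Plane) (γ : ℝ) (g v : Plane → ℝ) : ℝ :=
  bdryPair Ω g (fun x => v x / γ - normalDeriv Ω v x)

/-- The bilinear form of the classical Nitsche method for the Dirichlet problem. -/
def nitscheForm (Ω : Set Plane) (α γ : ℝ) (u v : Plane → ℝ) : ℝ :=
  formI Ω α u v - bdryPair Ω (normalDeriv Ω u) v + formN Ω γ u v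

/-- The data of the Robin problem `-Δu + α u = f` in `Ω`, `u + ε ∇u · n = uRD + ε qRN` on the
boundary of `Ω`. -/
structure RobinData where
  α : ℝ
  f : Plane → ℝ
  uRD : Plane → ℝ
  qRN : Plane → ℝ

/-- The data are square integrable. -/
def RobinData.SquareIntegrable (d : RobinData) (Ω : Set Plane) : Prop :=
  MemLp d.f 2 (volume.restrict Ω) ∧ MemLp d.uRD 2 (bdryMeasure Ω) ∧ MemLp d.qRN 2 (bdryMeasure Ω)

/-- `u` solves the Nitsche-Robin variational problem with parameters `γ`, `ε` in the finite element
space of degree `P`. -/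
def SolvesRobin (𝓣 : TriMesh) (P : ℕ) (d : RobinData) (γ ε : ℝ) (u : Plane → ℝ) : Prop :=
  u ∈ 𝓣.feSpace P ∧ ∀ v ∈ 𝓣.feSpace P,
    formI 𝓣.domain d.α u v - domPair 𝓣.domain d.f v
      - bdryPair 𝓣.domain (normalDeriv 𝓣.domain u) v
      + γ / (γ + ε) * formN 𝓣.domain γ (fun x => u x - d.uRD x) v
      + ε * γ / (γ + ε) * formN 𝓣.domain γ (fun x => normalDeriv 𝓣.domain u x - d.qRN x) v = 0

/-- `U ε = u 0 + ε u 1 + ... + ε ^ M u M + o(ε ^ M)` as `ε → 0+`, at every point of the closure of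
`Ω`. (In the finite dimensional space of finite element functions, this is the same as an expansion
in any norm.) -/
def HasExpansion (Ω : Set Plane) (U : ℝ → Plane → ℝ) (u : ℕ → Plane → ℝ) (M : ℕ) : Prop :=
  ∀ x ∈ closure Ω,
    (fun ε : ℝ => U ε x - ∑ k ∈ Finset.range (M + 1), ε ^ k * u k x) =o[𝓝[>] 0] fun ε => ε ^ M

/-- The source `f_m` of order `m`: `f_0 = f`, and `f_m = 0` for `m ≥ 1`. -/
def RobinData.source (d : RobinData) : ℕ → Plane → ℝ
  | 0 => d.f
  | _ + 1 => 0

/-- The Dirichlet data `u_{D,m}` of order `m` for a sequence of modes `u`: `u_{D,0} = uRD`,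
`u_{D,1} = qRN - ∇u_0 · n`, and `u_{D,m} = -∇u_{m-1} · n` for `m ≥ 2`. -/
def RobinData.dirichlet (d : RobinData) (Ω : Set Plane) (u : ℕ → Plane → ℝ) : ℕ → Plane → ℝ
  | 0 => d.uRD
  | 1 => fun x => d.qRN x - normalDeriv Ω (u 0) x
  | m + 2 => fun x => -normalDeriv Ω (u (m + 1)) x

/-- `w` is a classical solution of the continuous Dirichlet problem of order `m`, given the modes
`u` of lower order: `-Δw + α w = f_m` in `Ω` and `w = u_{D,m}` on the boundary off the corners. -/
def IsExactMode (Ω : Set Plane) (d : RobinData) (u : ℕ → Plane → ℝ) (m : ℕ) (w : Plane → ℝ) :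
    Prop :=
  ContDiffOn ℝ 1 w (closure Ω) ∧ ContDiffOn ℝ 2 w Ω ∧
    (∀ x ∈ Ω, -Laplacian.laplacian w x + d.α * w x = d.source m x) ∧
    ∀ x ∈ frontier Ω, (∃ ν, IsOutwardNormal Ω x ν) → w x = d.dirichlet Ω u m x

/-- The error term `E_m = -∑_{ℓ < m} (-γ)^{-(m - ℓ)} N_Γ(u_ℓ - u_{D,ℓ})`, so `E_0 = 0`. -/
def errorTerm (Ω : Set Plane) (d : RobinData) (γ : ℝ) (u : ℕ → Plane → ℝ) (m : ℕ)
    (v : Plane → ℝ) : ℝ :=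
  -∑ l ∈ Finset.range m,
    (-γ) ^ (-((m : ℤ) - (l : ℤ))) * formN Ω γ (fun x => u l x - d.dirichlet Ω u l x) v

/-- `w` satisfies, for the test function `v`, the Nitsche-Dirichlet problem of order `m` with error
term, given the modes `u` of lower order. -/
def ModeEq (Ω : Set Plane) (d : RobinData) (γ : ℝ) (u : ℕ → Plane → ℝ) (m : ℕ)
    (w v : Plane → ℝ) : Prop :=
  formI Ω d.α w v - domPair Ω (d.source m) v - bdryPair Ω (normalDeriv Ω w) v
    + formN Ω γ (fun x => w x - d.dirichlet Ω u m x) v = errorTerm Ω d γ u m v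

end

/-! The key is that (R), multiplied by γ + ε, is affine in ε. With A(u) = I_Ω(u) - (∇u·n, ·)_Γ it
reads γ (A(u) + N_Γ(u)) + ε (A(u) + γ N_Γ(∇u·n)) = γ r + ε s, where r and s depend on the data only.

Cascade. Let a_k be the residual of u_k in (D_k) without its Nitsche term, and n_k = N_Γ(u_k -
u_{D,k}). Comparing powers of ε gives a_0 + n_0 = 0 and γ (a_{k+1} + n_{k+1}) = -a_k; unrolling this
recursion produces the error terms (`residual_eq_error`). A pointwise expansion suffices because
point evaluations separate a finite-dimensional space and hence span its dual
(`isLittleO_of_separating`).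

Consistency. For exact modes every n_k vanishes by the boundary condition, and a_k vanishes by
Green's formula (`TriMesh.green`).

Coercivity. On the diagonal, Young's inequality splits 2(∇v·n, v)_Γ into half of the penalty and
2γ‖∇v·n‖². The discrete trace inequality (`TriMesh.trace_inequality`) bounds the latter by half of
‖∇v‖² when γ is small against the boundary elements, and `TriMesh.poincare` recovers the L² norm.
Thus B = A + N_Γ is invertible on the discrete space, (D_m) is uniquely solvable, and (R) becomes (1
+ εK)u = b₀ + εb₁. For small ε this is invertible, and the partial sums of its Neumann series have
remainder O(ε^(M+1)) (`expansion_of_modes`).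

The analytic base is the divergence theorem on Ω (`TriMesh.divergence`), which yields both Green's
formula and the Poincaré inequality. On one triangle it is pulled back to the unit square by a map
that collapses one side to a vertex; in the sum over the mesh the inner edges cancel. The same map
gives the trace inequality, since it restricts polynomials to rays from a vertex to the opposite
edge. -/

noncomputable section

/-! ### Barycentric geometry of a triangle. -/

/-- The two-dimensional cross product. -/
def cross (u v : Plane) : ℝ := u 0 * v 1 - u 1 * v 0

/-- Twice the signed area of the triangle with vertices `p 0`, `p 1`, `p 2`. -/
def area2 (p : Fin 3 → Plane) : ℝ := cross (p 1 - p 0) (p 2 - p 0)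

/-- The barycentric coordinates with respect to a triangle. -/
def bary (p : Fin 3 → Plane) (i : Fin 3) (x : Plane) : ℝ :=
  cross (p (i + 1) - x) (p (i + 2) - x) / area2 p

/-- The direction of the edge opposite to the vertex `i`. -/
def edgeDir (p : Fin 3 → Plane) (i : Fin 3) : Plane := p (i + 2) - p (i + 1)

/-- The right normal of a vector, of the same length. -/
def rot (d : Plane) : Plane := !₂[d 1, -d 0]

/-- The unit normal to the edge opposite to the vertex `i`, outward if `p` is oriented. -/
def edgeNormal (p : Fin 3 → Plane) (i : Fin 3) : Plane := ‖edgeDir p i‖⁻¹ • rot (edgeDir p i)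

/-- The edge opposite to the vertex `i`. -/
def edge (p : Fin 3 → Plane) (i : Fin 3) : Set Plane := segment ℝ (p (i + 1)) (p (i + 2))

lemma plane_inner (x y : Plane) : inner ℝ x y = x 0 * y 0 + x 1 * y 1 := by
  simp [PiLp.inner_apply, Fin.sum_univ_two]; ring

lemma plane_norm_sq (x : Plane) : ‖x‖ ^ 2 = x 0 ^ 2 + x 1 ^ 2 := by
  simp [EuclideanSpace.norm_sq_eq, Fin.sum_univ_two]

lemma plane_ext {x y : Plane} (h0 : x 0 = y 0) (h1 : x 1 = y 1) : x = y := by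
  ext i; fin_cases i <;> assumption

@[simp] lemma rot_zero (d : Plane) : rot d 0 = d 1 := rfl
@[simp] lemma rot_one (d : Plane) : rot d 1 = -d 0 := rfl

lemma inner_rot (x d : Plane) : inner ℝ x (rot d) = cross x d := by
  simp [plane_inner, cross]; ring

lemma norm_rot (d : Plane) : ‖rot d‖ = ‖d‖ := by
  have h : ‖rot d‖ ^ 2 = ‖d‖ ^ 2 := by simp [plane_norm_sq]; ring
  exact (pow_left_inj₀ (norm_nonneg _) (norm_nonneg _) two_ne_zero).1 h

lemma cross_coord (u v w x : Plane) :
    cross (u - v) (w - x) = (u 0 - v 0) * (w 1 - x 1) - (u 1 - v 1) * (w 0 - x 0) := rfl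

lemma area2_eq (p : Fin 3 → Plane) (i : Fin 3) :
    area2 p = cross (p (i + 1) - p i) (p (i + 2) - p i) := by
  fin_cases i
  · rfl
  · change _ = cross (p 2 - p 1) (p 0 - p 1)
    simp only [area2, cross_coord]; ring
  · change _ = cross (p 0 - p 2) (p 1 - p 2)
    simp only [area2, cross_coord]; ring

lemma area2_eq_cross_edgeDir (p : Fin 3 → Plane) (i : Fin 3) :
    area2 p = cross (p (i + 1) - p i) (edgeDir p i) := by
  rw [area2_eq p i, edgeDir]; simp only [cross_coord]; ring

lemma edgeDir_ne_zero {p : Fin 3 → Plane} (hp : 0 < area2 p) (i : Fin 3) : edgeDir p i ≠ 0 := by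
  intro h
  rw [area2_eq_cross_edgeDir p i, h] at hp
  simp [cross] at hp

lemma norm_edgeNormal {p : Fin 3 → Plane} (hp : 0 < area2 p) (i : Fin 3) :
    ‖edgeNormal p i‖ = 1 := by
  rw [edgeNormal, norm_smul, norm_rot, norm_inv, norm_norm,
    inv_mul_cancel₀ (norm_ne_zero_iff.2 (edgeDir_ne_zero hp i))]

lemma bary_eq (p : Fin 3 → Plane) (i : Fin 3) (x : Plane) :
    bary p i x = inner ℝ (p (i + 1) - x) (rot (edgeDir p i)) / area2 p := by
  rw [inner_rot, bary, edgeDir]; congr 1; simp only [cross_coord]; ring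

/-- A barycentric coordinate is affine, with gradient minus the inverse height times the outward
normal. This converts sign conditions on coordinates into half planes. -/
lemma bary_sub {p : Fin 3 → Plane} (hp : 0 < area2 p) (i : Fin 3) (x y : Plane) :
    bary p i y - bary p i x = -(‖edgeDir p i‖ / area2 p) * inner ℝ (y - x) (edgeNormal p i) := by
  have hd := norm_ne_zero_iff.2 (edgeDir_ne_zero hp i)
  rw [bary_eq, bary_eq, edgeNormal, inner_smul_right]
  simp only [inner_sub_left]
  field_simp
  ring

lemma bary_combo {p : Fin 3 → Plane} (i : Fin 3) (x y : Plane) {a b : ℝ}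
    (hab : a + b = 1) : bary p i (a • x + b • y) = a * bary p i x + b * bary p i y := by
  simp only [bary_eq, inner_sub_left, inner_add_left, real_inner_smul_left]
  rw [eq_sub_of_add_eq hab]; ring

lemma continuous_bary (p : Fin 3 → Plane) (i : Fin 3) : Continuous (bary p i) := by
  simp only [funext (bary_eq p i)]
  fun_prop

lemma bary_sum {p : Fin 3 → Plane} (hp : 0 < area2 p) (i : Fin 3) (x : Plane) :
    bary p i x + bary p (i + 1) x + bary p (i + 2) x = 1 := by
  have h1 : i + 1 + 1 = i + 2 := by fin_cases i <;> rfl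
  have h2 : i + 1 + 2 = i := by fin_cases i <;> rfl
  have h3 : i + 2 + 1 = i := by fin_cases i <;> rfl
  have h4 : i + 2 + 2 = i + 1 := by fin_cases i <;> rfl
  simp only [bary, h1, h2, h3, h4]
  rw [← add_div, ← add_div, div_eq_one_iff_eq hp.ne', area2_eq p i]
  simp only [cross_coord]; ring

lemma bary_smul {p : Fin 3 → Plane} (hp : 0 < area2 p) (i : Fin 3) (x : Plane) :
    bary p i x • p i + bary p (i + 1) x • p (i + 1) + bary p (i + 2) x • p (i + 2) = x := by
  have h1 : i + 1 + 1 = i + 2 := by fin_cases i <;> rfl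
  have h2 : i + 1 + 2 = i := by fin_cases i <;> rfl
  have h3 : i + 2 + 1 = i := by fin_cases i <;> rfl
  have h4 : i + 2 + 2 = i + 1 := by fin_cases i <;> rfl
  simp only [bary, h1, h2, h3, h4]
  rw [area2_eq p i] at hp ⊢
  have hp' := hp.ne'
  refine plane_ext ?_ ?_ <;> simp only [PiLp.add_apply, PiLp.smul_apply, smul_eq_mul] <;>
    field_simp <;> simp only [cross_coord] <;> ring

lemma bary_self {p : Fin 3 → Plane} (hp : 0 < area2 p) (i : Fin 3) : bary p i (p i) = 1 := by
  rw [bary, ← area2_eq, div_self hp.ne']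

lemma bary_add_one (p : Fin 3 → Plane) (i : Fin 3) : bary p i (p (i + 1)) = 0 := by
  simp [bary, cross]

lemma bary_add_two (p : Fin 3 → Plane) (i : Fin 3) : bary p i (p (i + 2)) = 0 := by
  simp [bary, cross]

lemma fin3_cases (i j : Fin 3) : j = i ∨ j = i + 1 ∨ j = i + 2 := by
  fin_cases i <;> fin_cases j <;> simp

lemma bary_of_ne (p : Fin 3 → Plane) {i j : Fin 3} (h : j ≠ i) : bary p i (p j) = 0 := by
  rcases fin3_cases i j with rfl | rfl | rfl
  · exact absurd rfl h
  · exact bary_add_one p i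
  · exact bary_add_two p i

lemma convex_bary_nonneg (p : Fin 3 → Plane) (i : Fin 3) : Convex ℝ {x | 0 ≤ bary p i x} := by
  intro x hx y hy a b ha hb hab
  simp only [Set.mem_ofPred_eq] at *
  rw [bary_combo i x y hab]; positivity

lemma convex_bary_eq_zero (p : Fin 3 → Plane) (i : Fin 3) : Convex ℝ {x | bary p i x = 0} := by
  intro x hx y hy a b ha hb hab
  simp only [Set.mem_ofPred_eq] at *
  rw [bary_combo i x y hab, hx, hy]; simp

lemma mem_convexHull_iff_bary {p : Fin 3 → Plane} (hp : 0 < area2 p) {x : Plane} :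
    x ∈ convexHull ℝ (Set.range p) ↔ ∀ i, 0 ≤ bary p i x := by
  constructor
  · intro hx i
    refine convexHull_min ?_ (convex_bary_nonneg p i) hx
    rintro _ ⟨j, rfl⟩
    by_cases h : j = i
    · subst h; simp [bary_self hp]
    · simp [bary_of_ne p h]
  · intro h
    rw [← bary_smul hp 0 x]
    have hm : ∀ i, p i ∈ convexHull ℝ (Set.range p) := fun i => subset_convexHull ℝ _ ⟨i, rfl⟩
    have := (convex_convexHull ℝ (Set.range p)).sum_mem (t := Finset.univ)
      (w := fun i => bary p i x) (z := p) (fun i _ => h i)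
      (by simpa [Fin.sum_univ_three] using bary_sum hp 0 x) (fun i _ => hm i)
    simpa [Fin.sum_univ_three] using this

lemma mem_interior_iff_bary {p : Fin 3 → Plane} (hp : 0 < area2 p) {x : Plane} :
    x ∈ interior (convexHull ℝ (Set.range p)) ↔ ∀ i, 0 < bary p i x := by
  constructor
  · intro hx i
    by_contra! hle
    -- A small shift along the outward normal would stay in the triangle and make the `i`-th
    -- coordinate negative.
    have ht : Tendsto (fun t : ℝ => x + t • edgeNormal p i) (𝓝[>] 0) (𝓝 x) := by
      have : Continuous fun t : ℝ => x + t • edgeNormal p i := by fun_prop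
      simpa using (this.tendsto 0).mono_left nhdsWithin_le_nhds
    obtain ⟨t, ht1, ht2⟩ :=
      ((ht.eventually (mem_interior_iff_mem_nhds.1 hx)).and self_mem_nhdsWithin).exists
    have h1 := (mem_convexHull_iff_bary hp).1 ht1 i
    have h2 := bary_sub hp i x (x + t • edgeNormal p i)
    rw [add_sub_cancel_left, real_inner_smul_left, real_inner_self_eq_norm_sq,
      norm_edgeNormal hp] at h2
    have h3 : 0 < ‖edgeDir p i‖ / area2 p * (t * 1 ^ 2) := by
      have := norm_pos_iff.2 (edgeDir_ne_zero hp i)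
      have : (0 : ℝ) < t := ht2
      positivity
    linarith
  · intro h
    have ho : IsOpen {x | ∀ i, 0 < bary p i x} := by
      simp only [Set.ofPred_forall]
      exact isOpen_iInter_of_finite fun i => isOpen_lt continuous_const (continuous_bary p i)
    exact interior_maximal (fun y hy => (mem_convexHull_iff_bary hp).2 fun i => (hy i).le) ho h

lemma interior_convexHull_nonempty {p : Fin 3 → Plane} (hp : 0 < area2 p) :
    (interior (convexHull ℝ (Set.range p))).Nonempty := by
  have h : (2⁻¹ : ℝ) + 2⁻¹ = 1 := by norm_num
  -- Nested midpoints, with weights 1/2, 1/4, 1/4, so that `bary_combo` applies twice.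
  refine ⟨(2⁻¹ : ℝ) • p 0 + (2⁻¹ : ℝ) • ((2⁻¹ : ℝ) • p 1 + (2⁻¹ : ℝ) • p 2),
    (mem_interior_iff_bary hp).2 fun i => ?_⟩
  rw [bary_combo i _ _ h, bary_combo i _ _ h]
  have hb : ∀ j, 0 ≤ bary p i (p j) := fun j =>
    (mem_convexHull_iff_bary hp).1 (subset_convexHull ℝ _ ⟨j, rfl⟩) i
  have h0 := hb 0
  have h1 := hb 1
  have h2 := hb 2
  have hi := bary_self hp i
  fin_cases i <;> simp only [Fin.zero_eta, Fin.mk_one, Fin.reduceFinMk] at * <;> rw [hi] <;>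
    positivity

lemma mem_edge_iff_bary {p : Fin 3 → Plane} (hp : 0 < area2 p) {i : Fin 3} {x : Plane} :
    x ∈ edge p i ↔ bary p i x = 0 ∧ 0 ≤ bary p (i + 1) x ∧ 0 ≤ bary p (i + 2) x := by
  have h2 : i + 1 + 2 = i := by fin_cases i <;> rfl
  have h1 : i + 1 + 1 = i + 2 := by fin_cases i <;> rfl
  have h3 : i + 2 + 1 = i := by fin_cases i <;> rfl
  have h4 : i + 2 + 2 = i + 1 := by fin_cases i <;> rfl
  constructor
  · rintro ⟨a, b, ha, hb, hab, rfl⟩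
    rw [bary_combo _ _ _ hab, bary_combo _ _ _ hab, bary_combo _ _ _ hab, bary_add_one,
      bary_add_two, bary_self hp, bary_self hp]
    have e1 := bary_add_one p (i + 1)
    have e2 := bary_add_two p (i + 2)
    rw [h1] at e1
    rw [h4] at e2
    rw [e1, e2]
    simp [ha, hb]
  · rintro ⟨h0, ha, hb⟩
    refine ⟨_, _, ha, hb, ?_, ?_⟩
    · have := bary_sum hp i x; linarith
    · have := bary_smul hp i x
      rwa [h0, zero_smul, zero_add] at this

/-- A point of a triangle that is not a vertex lies in the interior or in the relative interior of
exactly one edge. -/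
lemma bary_trichotomy {p : Fin 3 → Plane} (hp : 0 < area2 p) {x : Plane}
    (hx : ∀ i, 0 ≤ bary p i x) (hv : ∀ i, x ≠ p i) :
    (∀ i, 0 < bary p i x) ∨
      ∃ i, bary p i x = 0 ∧ 0 < bary p (i + 1) x ∧ 0 < bary p (i + 2) x := by
  by_cases h : ∀ i, 0 < bary p i x
  · exact Or.inl h
  push Not at h
  obtain ⟨i, hi⟩ := h
  have hi0 : bary p i x = 0 := le_antisymm hi (hx i)
  have hs := bary_sum hp i x
  have hc := bary_smul hp i x
  refine Or.inr ⟨i, hi0, (hx _).lt_of_ne fun h => ?_, (hx _).lt_of_ne fun h => ?_⟩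
  · rw [hi0, ← h] at hs hc
    have : bary p (i + 2) x = 1 := by linarith
    rw [this] at hc
    exact hv (i + 2) (by simpa using hc.symm)
  · rw [hi0, ← h] at hs hc
    have : bary p (i + 1) x = 1 := by linarith
    rw [this] at hc
    exact hv (i + 1) (by simpa using hc.symm)

/-- Near a point of the relative interior of an edge, a triangle is a half plane. -/
lemma eventually_mem_convexHull_iff {p : Fin 3 → Plane} (hp : 0 < area2 p) {x : Plane} {i : Fin 3}
    (h0 : bary p i x = 0) (h1 : 0 < bary p (i + 1) x) (h2 : 0 < bary p (i + 2) x) :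
    ∀ᶠ y in 𝓝 x, (y ∈ convexHull ℝ (Set.range p) ↔ inner ℝ (y - x) (edgeNormal p i) ≤ 0) ∧
      (y ∈ interior (convexHull ℝ (Set.range p)) ↔ inner ℝ (y - x) (edgeNormal p i) < 0) := by
  have hd := norm_pos_iff.2 (edgeDir_ne_zero hp i)
  have hq : 0 < ‖edgeDir p i‖ / area2 p := by positivity
  filter_upwards [(continuous_bary p (i + 1)).continuousAt.eventually (lt_mem_nhds h1),
    (continuous_bary p (i + 2)).continuousAt.eventually (lt_mem_nhds h2)] with y hy1 hy2
  have hy0 : bary p i y = -(‖edgeDir p i‖ / area2 p) * inner ℝ (y - x) (edgeNormal p i) := by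
    rw [← bary_sub hp, h0, sub_zero]
  rw [mem_convexHull_iff_bary hp, mem_interior_iff_bary hp]
  have hall : ∀ q : ℝ → Prop, (∀ j, q (bary p j y)) ↔
      q (bary p i y) ∧ q (bary p (i + 1) y) ∧ q (bary p (i + 2) y) := by
    intro q
    refine ⟨fun h => ⟨h _, h _, h _⟩, fun h j => ?_⟩
    rcases fin3_cases i j with rfl | rfl | rfl
    exacts [h.1, h.2.1, h.2.2]
  rw [hall (fun t => 0 ≤ t), hall (fun t => 0 < t), hy0]
  constructor
  · constructor
    · rintro ⟨h, -⟩; by_contra! hc; nlinarith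
    · intro h; exact ⟨by nlinarith, hy1.le, hy2.le⟩
  · constructor
    · rintro ⟨h, -⟩; by_contra! hc; nlinarith
    · intro h; exact ⟨by nlinarith, hy1, hy2⟩

/-- Zero area would make the vertices collinear; a negative area is repaired by exchanging two
vertices. -/
lemma exists_orientation {T : Finset Plane} (hc : T.card = 3)
    (hT : AffineIndependent ℝ ((↑) : T → Plane)) :
    ∃ p : Fin 3 → Plane, 0 < area2 p ∧ (T : Set Plane) = Set.range p := by
  classical
  obtain ⟨a, b, c, hab, hac, hbc, rfl⟩ := Finset.card_eq_three.1 hc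
  have hne : area2 ![a, b, c] ≠ 0 := by
    intro h0
    have hcol : ¬ Collinear ℝ {a, b, c} := by
      rw [← affineIndependent_iff_not_collinear_set]
      let e : Fin 3 ↪ ({a, b, c} : Finset Plane) :=
        ⟨![⟨a, by simp⟩, ⟨b, by simp⟩, ⟨c, by simp⟩], by
          intro i j hij
          fin_cases i <;> fin_cases j <;> simp_all⟩
      have he : (![a, b, c] : Fin 3 → Plane) = Subtype.val ∘ e := by
        funext i; fin_cases i <;> rfl
      rw [he]
      exact hT.comp_embedding e
    apply hcol
    rw [collinear_iff_of_mem (p₀ := a) (by simp)]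
    refine ⟨b - a, ?_⟩
    have hb : b - a ≠ 0 := sub_ne_zero.2 hab.symm
    have hn : (b 0 - a 0) ^ 2 + (b 1 - a 1) ^ 2 ≠ 0 := by
      have := plane_norm_sq (b - a)
      simp only [PiLp.sub_apply] at this
      rw [← this]; exact pow_ne_zero 2 (norm_ne_zero_iff.2 hb)
    have h0' : (b 0 - a 0) * (c 1 - a 1) - (b 1 - a 1) * (c 0 - a 0) = 0 := h0
    intro q hq
    simp only [Set.mem_insert_iff, Set.mem_singleton_iff] at hq
    rcases hq with rfl | rfl | rfl
    · exact ⟨0, by simp⟩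
    · exact ⟨1, by simp⟩
    -- The coefficient of the orthogonal projection of `q - a` onto `b - a`; the vanishing cross
    -- product makes the projection exact.
    · refine ⟨((b 0 - a 0) * (q 0 - a 0) + (b 1 - a 1) * (q 1 - a 1)) /
        ((b 0 - a 0) ^ 2 + (b 1 - a 1) ^ 2), ?_⟩
      refine plane_ext ?_ ?_ <;>
        simp only [vadd_eq_add, PiLp.add_apply, PiLp.smul_apply, PiLp.sub_apply, smul_eq_mul] <;>
        field_simp <;> generalize a.ofLp 0 = a0 at * <;> generalize a.ofLp 1 = a1 at * <;>
        generalize b.ofLp 0 = b0 at * <;> generalize b.ofLp 1 = b1 at * <;>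
        generalize q.ofLp 0 = q0 at * <;> generalize q.ofLp 1 = q1 at *
      · linear_combination -(b1 - a1) * h0'
      · linear_combination (b0 - a0) * h0'
  rcases hne.lt_or_gt with h | h
  · refine ⟨![a, c, b], ?_, ?_⟩
    · have h' : area2 ![a, c, b] = - area2 ![a, b, c] := by
        change cross (c - a) (b - a) = -cross (b - a) (c - a)
        simp only [cross_coord]; ring
      linarith
    · ext x; simp [eq_comm]; tauto
  · refine ⟨![a, b, c], h, ?_⟩
    ext x; simp [eq_comm]; tauto
end

/-! ### The collapsing map of the square and the divergence theorem on a triangle. -/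

noncomputable section

/-- The coordinates of the plane, as a measurable equivalence. -/
def planeEquiv : ℝ × ℝ ≃ᵐ Plane :=
  MeasurableEquiv.finTwoArrow.symm.trans (MeasurableEquiv.toLp 2 (Fin 2 → ℝ))

lemma measurePreserving_planeEquiv : MeasurePreserving planeEquiv volume volume :=
  (EuclideanSpace.volume_preserving_symm_measurableEquiv_toLp (Fin 2)).symm.comp
    ((volume_preserving_finTwoArrow ℝ).symm)

/-- The map of the unit square onto a triangle that collapses one side to the vertex `i`. -/
def duffy (p : Fin 3 → Plane) (i : Fin 3) (z : ℝ × ℝ) : Plane :=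
  p i + z.1 • ((p (i + 1) - p i) + z.2 • edgeDir p i)

/-- The derivative of `duffy` at `z`. -/
def duffyDeriv (p : Fin 3 → Plane) (i : Fin 3) (z : ℝ × ℝ) : ℝ × ℝ →L[ℝ] Plane :=
  (ContinuousLinearMap.fst ℝ ℝ ℝ).smulRight ((p (i + 1) - p i) + z.2 • edgeDir p i) +
    (ContinuousLinearMap.snd ℝ ℝ ℝ).smulRight (z.1 • edgeDir p i)

lemma hasFDerivAt_duffy (p : Fin 3 → Plane) (i : Fin 3) (z : ℝ × ℝ) :
    HasFDerivAt (duffy p i) (duffyDeriv p i z) z := by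
  have h1 : HasFDerivAt (fun z : ℝ × ℝ => z.1) (ContinuousLinearMap.fst ℝ ℝ ℝ) z := hasFDerivAt_fst
  have h2 : HasFDerivAt (fun z : ℝ × ℝ => z.2) (ContinuousLinearMap.snd ℝ ℝ ℝ) z := hasFDerivAt_snd
  have h := ((h1.smul ((h2.smul_const (edgeDir p i)).const_add (p (i + 1) - p i))).const_add (p i))
  refine h.congr_fderiv ?_
  ext w <;> simp [duffyDeriv, smul_smul, mul_comm]

lemma continuous_duffy (p : Fin 3 → Plane) (i : Fin 3) : Continuous (duffy p i) := by
  unfold duffy; fun_prop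

lemma bary_duffy {p : Fin 3 → Plane} (hp : 0 < area2 p) (i : Fin 3) (z : ℝ × ℝ) :
    bary p i (duffy p i z) = 1 - z.1 ∧ bary p (i + 1) (duffy p i z) = z.1 * (1 - z.2) ∧
      bary p (i + 2) (duffy p i z) = z.1 * z.2 := by
  have h1 : i + 1 + 1 = i + 2 := by fin_cases i <;> rfl
  have h2 : i + 1 + 2 = i := by fin_cases i <;> rfl
  have h3 : i + 2 + 1 = i := by fin_cases i <;> rfl
  have h4 : i + 2 + 2 = i + 1 := by fin_cases i <;> rfl
  have hd : duffy p i z =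
      (1 - z.1) • p i + z.1 • ((1 - z.2) • p (i + 1) + z.2 • p (i + 2)) := by
    rw [duffy, edgeDir]; module
  have e1 := bary_add_one p (i + 1)
  have e2 := bary_add_two p (i + 2)
  have e3 := bary_add_two p (i + 1)
  have e4 := bary_add_one p (i + 2)
  rw [h1] at e1
  rw [h4] at e2
  rw [h2] at e3
  rw [h3] at e4
  simp only [hd, bary_combo _ _ _ (sub_add_cancel 1 z.1), bary_combo _ _ _ (sub_add_cancel 1 z.2),
    bary_self hp, bary_add_one, bary_add_two, e1, e2, e3, e4]
  exact ⟨by ring, by ring, by ring⟩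

lemma forall_fin3 {q : Fin 3 → Prop} (i : Fin 3) :
    (∀ j, q j) ↔ q i ∧ q (i + 1) ∧ q (i + 2) := by
  refine ⟨fun h => ⟨h _, h _, h _⟩, fun h j => ?_⟩
  rcases fin3_cases i j with rfl | rfl | rfl
  exacts [h.1, h.2.1, h.2.2]

lemma duffy_mem {p : Fin 3 → Plane} (hp : 0 < area2 p) (i : Fin 3) {z : ℝ × ℝ}
    (hz : z ∈ Set.Icc (0 : ℝ × ℝ) 1) : duffy p i z ∈ convexHull ℝ (Set.range p) := by
  obtain ⟨⟨h1, h2⟩, h3, h4⟩ := hz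
  simp only [Prod.fst_zero, Prod.snd_zero, Prod.fst_one, Prod.snd_one] at h1 h2 h3 h4
  obtain ⟨e1, e2, e3⟩ := bary_duffy hp i z
  rw [mem_convexHull_iff_bary hp, forall_fin3 i, e1, e2, e3]
  exact ⟨by linarith, mul_nonneg h1 (by linarith), mul_nonneg h1 h2⟩

lemma injOn_duffy {p : Fin 3 → Plane} (hp : 0 < area2 p) (i : Fin 3) :
    Set.InjOn (duffy p i) (Set.Ioo (0 : ℝ) 1 ×ˢ Set.Ioo (0 : ℝ) 1) := by
  intro z hz w hw h
  obtain ⟨e1, e2, e3⟩ := bary_duffy hp i z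
  obtain ⟨f1, f2, f3⟩ := bary_duffy hp i w
  rw [h] at e1 e3
  have h1 : z.1 = w.1 := by linarith
  refine Prod.ext h1 ?_
  have : w.1 * z.2 = w.1 * w.2 := by rw [← f3, ← h1, e3]
  exact mul_left_cancel₀ hw.1.1.ne' this

lemma image_duffy {p : Fin 3 → Plane} (hp : 0 < area2 p) (i : Fin 3) :
    duffy p i '' (Set.Ioo (0 : ℝ) 1 ×ˢ Set.Ioo (0 : ℝ) 1) =
      interior (convexHull ℝ (Set.range p)) := by
  ext x
  constructor
  · rintro ⟨z, ⟨⟨h1, h2⟩, h3, h4⟩, rfl⟩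
    obtain ⟨e1, e2, e3⟩ := bary_duffy hp i z
    rw [mem_interior_iff_bary hp, forall_fin3 i, e1, e2, e3]
    exact ⟨by linarith, mul_pos h1 (by linarith), mul_pos h1 h3⟩
  · intro hx
    rw [mem_interior_iff_bary hp] at hx
    have hs := bary_sum hp i x
    have h0 := hx i
    have h1 := hx (i + 1)
    have h2 := hx (i + 2)
    have hs1 : 0 < 1 - bary p i x := by linarith
    -- The inverse map read off from `bary_duffy`: the first parameter is one minus the coordinate
    -- of the collapsed vertex, the second the share of vertex `i + 2` in the rest.
    refine ⟨(1 - bary p i x, bary p (i + 2) x / (1 - bary p i x)),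
      ⟨⟨hs1, by simpa using h0⟩, div_pos h2 hs1, (div_lt_one hs1).2 (by linarith)⟩, ?_⟩
    have hc := bary_smul hp i x
    have : bary p (i + 1) x = 1 - bary p i x - bary p (i + 2) x := by linarith
    rw [this] at hc
    rw [duffy, edgeDir, smul_add, smul_smul, mul_div_cancel₀ _ hs1.ne']
    conv_rhs => rw [← hc]
    module

/-- The Jacobian determinant of `duffy` is `z.1 * area2 p`. It is positive on the open square, where
the map is injective, and the boundaries of square and triangle are null sets. The map `planeEquiv`
identifies source and target so that the determinant makes sense. -/
lemma duffy_changeOfVariables {p : Fin 3 → Plane} (hp : 0 < area2 p) (i : Fin 3) (g : Plane → ℝ) :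
    (∫ x in convexHull ℝ (Set.range p), g x =
      ∫ z in Set.Icc (0 : ℝ × ℝ) 1, z.1 * area2 p * g (duffy p i z)) ∧
    (IntegrableOn g (convexHull ℝ (Set.range p)) ↔
      IntegrableOn (fun z : ℝ × ℝ => z.1 * area2 p * g (duffy p i z)) (Set.Icc (0 : ℝ × ℝ) 1)) := by
  set B : Set (ℝ × ℝ) := Set.Ioo (0 : ℝ) 1 ×ˢ Set.Ioo (0 : ℝ) 1 with hB
  have hBm : MeasurableSet B := measurableSet_Ioo.prod measurableSet_Ioo
  have hIcc : (Set.Icc (0 : ℝ × ℝ) 1 : Set (ℝ × ℝ)) =ᵐ[volume] B := by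
    have : Set.Icc (0 : ℝ × ℝ) 1 = Set.Icc (0 : ℝ) 1 ×ˢ Set.Icc (0 : ℝ) 1 :=
      Set.Icc_prod_eq 0 1
    rw [this]
    exact Measure.set_prod_ae_eq Ioo_ae_eq_Icc.symm Ioo_ae_eq_Icc.symm
  have hT : (convexHull ℝ (Set.range p) : Set Plane) =ᵐ[volume]
      interior (convexHull ℝ (Set.range p)) :=
    (interior_ae_eq_of_null_frontier ((convex_convexHull ℝ _).addHaar_frontier volume)).symm
  set ψ : ℝ × ℝ → ℝ × ℝ := fun z => planeEquiv.symm (duffy p i z) with hψ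
  set ψ' : ℝ × ℝ → ℝ × ℝ →L[ℝ] ℝ × ℝ := fun z =>
    (Matrix.toLin (.finTwoProd ℝ) (.finTwoProd ℝ)
      !![(p (i + 1) - p i) 0 + z.2 * edgeDir p i 0, z.1 * edgeDir p i 0;
         (p (i + 1) - p i) 1 + z.2 * edgeDir p i 1, z.1 * edgeDir p i 1]).toContinuousLinearMap
    with hψ'
  have hderiv : ∀ z ∈ B, HasFDerivWithinAt ψ (ψ' z) B z := by
    intro z _
    have hz := hasFDerivAt_duffy p i z
    have h := ((EuclideanSpace.proj (𝕜 := ℝ) (0 : Fin 2)).hasFDerivAt.comp z hz).prodMk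
      ((EuclideanSpace.proj (𝕜 := ℝ) (1 : Fin 2)).hasFDerivAt.comp z hz)
    refine (h.congr_fderiv ?_).hasFDerivWithinAt
    simp only [hψ', Matrix.toLin_finTwoProd_toContinuousLinearMap]
    ext <;> simp [duffyDeriv]
  have hdet : ∀ z : ℝ × ℝ, (ψ' z).det = z.1 * area2 p := by
    intro z
    simp only [hψ', LinearMap.det_toContinuousLinearMap, LinearMap.det_toLin,
      Matrix.det_fin_two_of]
    rw [area2_eq_cross_edgeDir p i, cross]
    ring
  have hinj : Set.InjOn ψ B := planeEquiv.symm.injective.comp_injOn (injOn_duffy hp i)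
  have himg : ψ '' B = planeEquiv ⁻¹' interior (convexHull ℝ (Set.range p)) := by
    rw [hψ, ← Function.comp_def, Set.image_comp, hB, image_duffy hp i,
      ← MeasurableEquiv.image_symm]
  have habs : ∀ z ∈ B, |(ψ' z).det| • (fun w => g (planeEquiv w)) (ψ z)
      = z.1 * area2 p * g (duffy p i z) := by
    intro z hz
    rw [hdet, abs_of_pos (mul_pos hz.1.1 hp)]
    simp [hψ]
  constructor
  · rw [setIntegral_congr_set hT, setIntegral_congr_set hIcc,
      ← measurePreserving_planeEquiv.setIntegral_preimage_emb planeEquiv.measurableEmbedding,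
      ← himg, integral_image_eq_integral_abs_det_fderiv_smul volume hBm hderiv hinj]
    exact setIntegral_congr_fun hBm habs
  · rw [integrableOn_congr_set_ae hT, integrableOn_congr_set_ae hIcc,
      ← measurePreserving_planeEquiv.integrableOn_comp_preimage planeEquiv.measurableEmbedding,
      ← himg, Function.comp_def,
      integrableOn_image_iff_integrableOn_abs_det_fderiv_smul volume hBm hderiv hinj]
    exact integrableOn_congr_fun habs hBm

/-- The divergence of a vector field with derivative `L`. -/
def tr (L : Plane →L[ℝ] Plane) : ℝ :=
  L (EuclideanSpace.single 0 1) 0 + L (EuclideanSpace.single 1 1) 1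

lemma plane_eq_single (v : Plane) :
    v = v 0 • EuclideanSpace.single (0 : Fin 2) (1 : ℝ) +
      v 1 • EuclideanSpace.single (1 : Fin 2) (1 : ℝ) := by
  refine plane_ext ?_ ?_ <;> simp

/-- The derivative of the determinant is the trace: (Lw) × d + w × (Ld) = tr(L) (w × d). -/
lemma cross_map_sub (L : Plane →L[ℝ] Plane) (w d : Plane) :
    cross (L w) d - cross (L d) w = cross w d * tr L := by
  conv_lhs => rw [plane_eq_single w, plane_eq_single d]
  simp only [map_add, map_smul, cross, tr, PiLp.add_apply, PiLp.smul_apply, smul_eq_mul]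
  simp
  ring

lemma rot_add (u v : Plane) : rot (u + v) = rot u + rot v := by
  refine plane_ext ?_ ?_ <;> simp; ring
lemma triangle_divergence_aux {p : Fin 3 → Plane} (hp : 0 < area2 p) {F : Plane → Plane}
    {F' : Plane → Plane →L[ℝ] Plane} (hc : ContinuousOn F (convexHull ℝ (Set.range p)))
    (hd : ∀ x ∈ interior (convexHull ℝ (Set.range p)), HasFDerivAt F (F' x) x)
    (hi : IntegrableOn (fun x => tr (F' x)) (convexHull ℝ (Set.range p))) :
    ∫ x in convexHull ℝ (Set.range p), tr (F' x) =
      ∑ i, ∫ t in (0 : ℝ)..1, cross (F (p (i + 1) + t • edgeDir p i)) (edgeDir p i) := by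
  set u : Plane := p 1 - p 0 with hu
  set d : Plane := edgeDir p 0 with hd'
  set Φ := duffy p 0 with hΦ
  have hcΦ : ContinuousOn (fun z => F (Φ z)) (Set.Icc (0 : ℝ × ℝ) 1) :=
    hc.comp (continuous_duffy p 0).continuousOn fun z hz => duffy_mem hp 0 hz
  set A : ℝ × ℝ → ℝ × ℝ →L[ℝ] Plane := fun z => (F' (Φ z)).comp (duffyDeriv p 0 z) with hA
  have hdΦ : ∀ z ∈ Set.Ioo (0 : ℝ × ℝ).1 (1 : ℝ × ℝ).1 ×ˢ Set.Ioo (0 : ℝ × ℝ).2 (1 : ℝ × ℝ).2,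
      HasFDerivAt (fun z => F (Φ z)) (A z) z := by
    intro z hz
    refine HasFDerivAt.comp z (hd _ ?_) (hasFDerivAt_duffy p 0 z)
    rw [← image_duffy hp 0]
    exact ⟨z, hz, rfl⟩
  have hI : ∀ (z : ℝ × ℝ) (w : Plane), HasFDerivAt (fun z => F (Φ z)) (A z) z →
      HasFDerivAt (fun z => inner ℝ (F (Φ z)) w) ((innerSL ℝ w).comp (A z)) z := by
    intro z w hz
    have := (innerSL ℝ w).hasFDerivAt.comp z hz
    refine this.congr_of_eventuallyEq (Eventually.of_forall fun y => ?_)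
    simp [real_inner_comm]
  -- The pair `(f, g)` is the Piola transform of `F`, the Jacobian determinant times the inverse
  -- Jacobian matrix applied to `F`. Its divergence on the square is the Jacobian determinant times
  -- the divergence of `F`, and its fluxes through the sides are those of `F` through the edges.
  set f : ℝ × ℝ → ℝ := fun z => z.1 * inner ℝ (F (Φ z)) (rot d) with hf
  set g : ℝ × ℝ → ℝ := fun z => -(inner ℝ (F (Φ z)) (rot u) + z.2 * inner ℝ (F (Φ z)) (rot d))
    with hg
  set f' : ℝ × ℝ → ℝ × ℝ →L[ℝ] ℝ := fun z => z.1 • (innerSL ℝ (rot d)).comp (A z) +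
    inner ℝ (F (Φ z)) (rot d) • ContinuousLinearMap.fst ℝ ℝ ℝ with hf'
  set g' : ℝ × ℝ → ℝ × ℝ →L[ℝ] ℝ := fun z => -((innerSL ℝ (rot u)).comp (A z) +
    (z.2 • (innerSL ℝ (rot d)).comp (A z) +
      inner ℝ (F (Φ z)) (rot d) • ContinuousLinearMap.snd ℝ ℝ ℝ)) with hg'
  have harea : area2 p = cross u d := area2_eq_cross_edgeDir p 0
  have hdiv : ∀ z : ℝ × ℝ, f' z (1, 0) + g' z (0, 1) = z.1 * area2 p * tr (F' (Φ z)) := by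
    intro z
    have h := cross_map_sub (F' (Φ z)) (u + z.2 • d) d
    have e1 : A z (1, 0) = F' (Φ z) (u + z.2 • d) := by
      simp only [hA, ContinuousLinearMap.comp_apply]; congr 1; simp [duffyDeriv, hu, hd']
    have e2 : A z (0, 1) = z.1 • F' (Φ z) d := by
      simp only [hA, ContinuousLinearMap.comp_apply]; rw [← map_smul]; congr 1
      simp [duffyDeriv, hd']
    simp only [hf', hg', _root_.add_apply, _root_.neg_apply,
      _root_.smul_apply, ContinuousLinearMap.comp_apply, e1, e2, innerSL_apply_apply,
      ContinuousLinearMap.coe_fst', ContinuousLinearMap.coe_snd', smul_eq_mul,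
      real_inner_comm _ (rot d), real_inner_comm _ (rot u), inner_rot]
    have e3 : cross (u + z.2 • d) d = area2 p := by
      rw [harea]; simp [cross]; ring
    have e4 : ∀ y, cross y (u + z.2 • d) = cross y u + z.2 * cross y d := by
      intro y; simp [cross]; ring
    have e5 : ∀ (a : ℝ) (y w : Plane), cross (a • y) w = a * cross y w := by
      intro a y w; simp [cross]; ring
    rw [e3, e4] at h
    rw [e5, e5]
    linear_combination z.1 * h
  have hcI : ∀ w : Plane, ContinuousOn (fun z => inner ℝ (F (Φ z)) w) (Set.Icc (0 : ℝ × ℝ) 1) :=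
    fun w => hcΦ.inner continuousOn_const
  have main := integral_divergence_prod_Icc_of_hasFDerivAt_of_le f g f' g' 0 1 zero_le_one
    (continuousOn_fst.mul (hcI _)) ((hcI _).add (continuousOn_snd.mul (hcI _))).neg
    (fun z hz => hasFDerivAt_fst.mul (hI z _ (hdΦ z hz)))
    (fun z hz => ((hI z _ (hdΦ z hz)).add (hasFDerivAt_snd.mul (hI z _ (hdΦ z hz)))).neg)
    (by
      simp only [hdiv]
      exact (duffy_changeOfVariables hp 0 fun x => tr (F' x)).2.1 hi)
  simp only [hdiv] at main
  rw [(duffy_changeOfVariables hp 0 fun x => tr (F' x)).1, main, Fin.sum_univ_three]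
  simp only [Prod.fst_zero, Prod.snd_zero, Prod.fst_one, Prod.snd_one]
  have i0 : ∀ t : ℝ, f (1, t) = cross (F (p (0 + 1) + t • edgeDir p 0)) (edgeDir p 0) := by
    intro t
    simp only [hf, one_mul, inner_rot, hΦ, duffy, one_smul]
    rw [← add_assoc, add_sub_cancel]
  -- The side collapsed to the vertex carries no flux.
  have i0' : ∀ t : ℝ, f (0, t) = 0 := by intro t; simp [hf]
  have i2 : ∀ t : ℝ, -g (t, 0) = cross (F (p (2 + 1) + t • edgeDir p 2)) (edgeDir p 2) := by
    intro t
    change - -(inner ℝ (F (p 0 + t • ((p 1 - p 0) + (0 : ℝ) • edgeDir p 0))) (rot u) +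
      (0 : ℝ) * inner ℝ (F (Φ (t, 0))) (rot d)) = cross (F (p 0 + t • (p 1 - p 0))) (p 1 - p 0)
    simp [inner_rot, hu]
  -- This side of the square runs against the orientation of the triangle, hence `1 - t`.
  have i1 : ∀ t : ℝ, g (1 - t, 1) = cross (F (p (1 + 1) + t • edgeDir p 1)) (edgeDir p 1) := by
    intro t
    change -(inner ℝ (F (p 0 + (1 - t) • ((p 1 - p 0) + (1 : ℝ) • (p 2 - p 1)))) (rot u) +
      (1 : ℝ) * inner ℝ (F (p 0 + (1 - t) • ((p 1 - p 0) + (1 : ℝ) • (p 2 - p 1)))) (rot d)) =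
      cross (F (p 2 + t • (p 0 - p 2))) (p 0 - p 2)
    have : p 0 + (1 - t) • ((p 1 - p 0) + (1 : ℝ) • (p 2 - p 1)) = p 2 + t • (p 0 - p 2) := by
      module
    rw [this, one_mul, ← inner_add_right, ← rot_add, inner_rot]
    have : u + d = p 2 - p 0 := by
      change p 1 - p 0 + (p 2 - p 1) = _
      abel
    rw [this]; simp only [cross, PiLp.sub_apply]; ring
  simp only [← i0, ← i1, ← i2, i0']
  rw [intervalIntegral.integral_comp_sub_left (fun t => g (t, 1)) 1]
  simp
  ring

/-- Parametrisation by arc length is an isometry, so it carries Lebesgue measure to one-dimensional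
Hausdorff measure; rescaling to the unit interval gives the length factor. -/
lemma edge_integral {p : Fin 3 → Plane} (hp : 0 < area2 p) (i : Fin 3) (g : Plane → ℝ) :
    ∫ x in edge p i, g x ∂(Measure.hausdorffMeasure 1 : Measure Plane) =
      ‖edgeDir p i‖ * ∫ t in (0 : ℝ)..1, g (p (i + 1) + t • edgeDir p i) := by
  set d := edgeDir p i with hd
  have hL : 0 < ‖d‖ := norm_pos_iff.2 (edgeDir_ne_zero hp i)
  set ι : ℝ → Plane := fun s => p (i + 1) + s • (‖d‖⁻¹ • d) with hι
  have hiso : Isometry ι := by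
    refine Isometry.of_dist_eq fun s t => ?_
    simp only [hι, dist_add_left]
    rw [dist_eq_norm, ← sub_smul, norm_smul, norm_smul, norm_inv, norm_norm,
      inv_mul_cancel₀ hL.ne', mul_one, ← dist_eq_norm]
  have hseg : edge p i = ι '' Set.Icc 0 ‖d‖ := by
    rw [edge, segment_eq_image']
    ext x
    constructor
    · rintro ⟨t, ⟨h0, h1⟩, rfl⟩
      refine ⟨t * ‖d‖, ⟨by positivity, mul_le_of_le_one_left hL.le h1⟩, ?_⟩
      simp only [hι, smul_smul, mul_assoc, mul_inv_cancel₀ hL.ne', mul_one]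
      rfl
    · rintro ⟨s, ⟨h0, h1⟩, rfl⟩
      refine ⟨s / ‖d‖, ⟨by positivity, (div_le_one hL).2 h1⟩, ?_⟩
      simp only [hι, smul_smul, div_eq_mul_inv]
      rfl
  have hemb : MeasurableEmbedding ι := hiso.isClosedEmbedding.measurableEmbedding
  have hmap : Measure.map ι volume = (Measure.hausdorffMeasure 1).restrict (Set.range ι) := by
    rw [← hausdorffMeasure_real]
    exact hiso.map_hausdorffMeasure (Or.inl zero_le_one)
  have h1 : (Measure.hausdorffMeasure 1 : Measure Plane).restrict (edge p i) =
      (Measure.map ι volume).restrict (edge p i) := by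
    rw [hmap, Measure.restrict_restrict_of_subset]
    rw [hseg]; exact Set.image_subset_range _ _
  rw [h1, hemb.setIntegral_map, hseg, Set.preimage_image_eq _ hiso.injective,
    integral_Icc_eq_integral_Ioc, ← intervalIntegral.integral_of_le hL.le]
  have := intervalIntegral.mul_integral_comp_mul_right (a := 0) (b := 1)
    (f := fun s => g (ι s)) (c := ‖d‖)
  rw [zero_mul, one_mul] at this
  rw [← this]
  congr 1
  refine intervalIntegral.integral_congr fun t _ => ?_
  simp only [hι, smul_smul, mul_assoc, mul_inv_cancel₀ hL.ne', mul_one]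

lemma hausdorffMeasure_edge_lt_top (p : Fin 3 → Plane) (i : Fin 3) :
    (Measure.hausdorffMeasure 1 : Measure Plane) (edge p i) < ⊤ := by
  rw [edge, hausdorffMeasure_segment]; exact edist_lt_top _ _

/-- The divergence theorem on a triangle. -/
theorem triangle_divergence {p : Fin 3 → Plane} (hp : 0 < area2 p) {F : Plane → Plane}
    {F' : Plane → Plane →L[ℝ] Plane} (hc : ContinuousOn F (convexHull ℝ (Set.range p)))
    (hd : ∀ x ∈ interior (convexHull ℝ (Set.range p)), HasFDerivAt F (F' x) x)
    (hi : IntegrableOn (fun x => tr (F' x)) (convexHull ℝ (Set.range p))) :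
    ∫ x in convexHull ℝ (Set.range p), tr (F' x) =
      ∑ i, ∫ x in edge p i, inner ℝ (F x) (edgeNormal p i)
        ∂(Measure.hausdorffMeasure 1 : Measure Plane) := by
  rw [triangle_divergence_aux hp hc hd hi]
  refine Finset.sum_congr rfl fun i _ => ?_
  rw [edge_integral hp, ← intervalIntegral.integral_const_mul]
  refine intervalIntegral.integral_congr fun t _ => ?_
  have hL : ‖edgeDir p i‖ ≠ 0 := norm_ne_zero_iff.2 (edgeDir_ne_zero hp i)
  simp only [edgeNormal, inner_smul_right, inner_rot]
  rw [mul_inv_cancel_left₀ hL]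
end

/-! ### Local structure of the mesh, normals, and the divergence theorem on Ω. -/

noncomputable section

open Classical in
/-- A positively oriented listing of the vertices of an element. -/
def TriMesh.vert (𝓣 : TriMesh) (T : Finset Plane) : Fin 3 → Plane :=
  if h : T ∈ 𝓣.elems then
    (exists_orientation (𝓣.card_eq_three T h) (𝓣.nondegenerate T h)).choose else 0

/-- The vertices of a mesh. -/
def TriMesh.vertices (𝓣 : TriMesh) : Set Plane := ⋃ T ∈ 𝓣.elems, (T : Set Plane)

/-- `x` lies in the relative interior of the edge opposite to the vertex `i`. -/
def InEdge (p : Fin 3 → Plane) (i : Fin 3) (x : Plane) : Prop :=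
  bary p i x = 0 ∧ 0 < bary p (i + 1) x ∧ 0 < bary p (i + 2) x

variable {𝓣 : TriMesh} {S T : Finset Plane} {x : Plane}

lemma TriMesh.vert_spec (hT : T ∈ 𝓣.elems) :
    0 < area2 (𝓣.vert T) ∧ (T : Set Plane) = Set.range (𝓣.vert T) := by
  rw [TriMesh.vert, dif_pos hT]
  exact (exists_orientation (𝓣.card_eq_three T hT) (𝓣.nondegenerate T hT)).choose_spec

lemma TriMesh.area2_vert (hT : T ∈ 𝓣.elems) : 0 < area2 (𝓣.vert T) := (𝓣.vert_spec hT).1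

lemma TriMesh.element_eq (hT : T ∈ 𝓣.elems) :
    element T = convexHull ℝ (Set.range (𝓣.vert T)) := by
  rw [element, (𝓣.vert_spec hT).2]

lemma TriMesh.finite_vertices : 𝓣.vertices.Finite :=
  𝓣.elems.finite_toSet.biUnion fun T _ => T.finite_toSet

lemma TriMesh.vert_mem_vertices (hT : T ∈ 𝓣.elems) (i : Fin 3) : 𝓣.vert T i ∈ 𝓣.vertices :=
  Set.mem_biUnion hT ((𝓣.vert_spec hT).2 ▸ ⟨i, rfl⟩)

lemma isCompact_element (T : Finset Plane) : IsCompact (element T) :=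
  T.finite_toSet.isCompact_convexHull ℝ

lemma TriMesh.mem_element (hT : T ∈ 𝓣.elems) : x ∈ element T ↔ ∀ i, 0 ≤ bary (𝓣.vert T) i x := by
  rw [𝓣.element_eq hT, mem_convexHull_iff_bary (𝓣.area2_vert hT)]

lemma TriMesh.mem_interior_element (hT : T ∈ 𝓣.elems) :
    x ∈ interior (element T) ↔ ∀ i, 0 < bary (𝓣.vert T) i x := by
  rw [𝓣.element_eq hT, mem_interior_iff_bary (𝓣.area2_vert hT)]

lemma TriMesh.interior_element_nonempty (hT : T ∈ 𝓣.elems) : (interior (element T)).Nonempty := by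
  rw [𝓣.element_eq hT]; exact interior_convexHull_nonempty (𝓣.area2_vert hT)

lemma TriMesh.closure_interior_element (hT : T ∈ 𝓣.elems) :
    closure (interior (element T)) = element T := by
  rw [Convex.closure_interior_eq_closure_of_nonempty_interior (s := element T)
    (convex_convexHull ℝ _) (𝓣.interior_element_nonempty hT),
    (isCompact_element T).isClosed.closure_eq]

lemma TriMesh.isCompact_iUnion : IsCompact (⋃ T ∈ 𝓣.elems, element T) :=
  𝓣.elems.finite_toSet.isCompact_biUnion fun T _ => isCompact_element T

lemma TriMesh.interior_element_subset (hT : T ∈ 𝓣.elems) : interior (element T) ⊆ 𝓣.domain :=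
  interior_mono (Set.subset_biUnion_of_mem (u := element) hT)

lemma TriMesh.closure_domain : closure 𝓣.domain = ⋃ T ∈ 𝓣.elems, element T := by
  refine subset_antisymm (closure_minimal interior_subset 𝓣.isCompact_iUnion.isClosed) ?_
  refine Set.iUnion₂_subset fun T hT => ?_
  rw [← 𝓣.closure_interior_element hT]
  exact closure_mono (𝓣.interior_element_subset hT)

lemma TriMesh.element_subset_closure (hT : T ∈ 𝓣.elems) : element T ⊆ closure 𝓣.domain := by
  rw [𝓣.closure_domain]; exact Set.subset_biUnion_of_mem (u := element) hT

lemma TriMesh.isOpen_domain : IsOpen 𝓣.domain := isOpen_interior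

/-- If `S` lacked a vertex of `T`, the common vertices would lie on the line where the corresponding
barycentric coordinate of `T` vanishes. By conformity so would `x`, which contradicts that `x` is
interior to `T`. -/
lemma TriMesh.eq_of_mem_interior (hS : S ∈ 𝓣.elems) (hT : T ∈ 𝓣.elems)
    (hx : x ∈ interior (element T)) (hxS : x ∈ element S) : S = T := by
  have hsub : T ⊆ S := by
    intro a ha
    obtain ⟨i, rfl⟩ : a ∈ Set.range (𝓣.vert T) := (𝓣.vert_spec hT).2 ▸ ha
    by_contra haS
    have h := (𝓣.mem_interior_element hT).1 hx i
    have hmem : x ∈ convexHull ℝ ((S : Set Plane) ∩ (T : Set Plane)) := by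
      rw [← 𝓣.conforming S hS T hT]; exact ⟨hxS, interior_subset hx⟩
    have hz : x ∈ {y | bary (𝓣.vert T) i y = 0} := by
      refine convexHull_min ?_ (convex_bary_eq_zero _ i) hmem
      rintro b ⟨hbS, hbT⟩
      rw [(𝓣.vert_spec hT).2] at hbT
      obtain ⟨j, rfl⟩ := hbT
      refine bary_of_ne _ ?_
      rintro rfl
      exact haS hbS
    exact h.ne' hz
  exact (Finset.eq_of_subset_of_card_le hsub
    (by rw [𝓣.card_eq_three S hS, 𝓣.card_eq_three T hT])).symm

lemma eq_neg_of_inner_le {a b : Plane} (ha : ‖a‖ = 1) (hb : ‖b‖ = 1) (h : inner ℝ a b ≤ -1) :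
    a = -b := by
  rw [eq_neg_iff_add_eq_zero, ← norm_eq_zero]
  have := norm_add_sq_real a b
  rw [ha, hb] at this
  nlinarith [sq_nonneg ‖a + b‖]

/-- Two different normals would describe different half planes near `x`: a small step along `ν' - ν`
enters one and leaves the other. Uniqueness makes the choice in `outwardNormal` harmless. -/
lemma IsOutwardNormal.eq {Ω : Set Plane} {ν ν' : Plane} (h : IsOutwardNormal Ω x ν)
    (h' : IsOutwardNormal Ω x ν') : ν = ν' := by
  obtain ⟨hν, r, hr, H⟩ := h
  obtain ⟨hν', r', hr', H'⟩ := h'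
  rw [← neg_neg ν']
  refine eq_neg_of_inner_le hν (by rwa [norm_neg]) ?_
  rw [inner_neg_right]
  by_contra! hlt
  have ht : Tendsto (fun t : ℝ => x - t • (ν - ν')) (𝓝[>] 0) (𝓝 x) := by
    have : Continuous fun t : ℝ => x - t • (ν - ν') := by fun_prop
    simpa using (this.tendsto 0).mono_left nhdsWithin_le_nhds
  obtain ⟨t, ⟨h1, h2⟩, h3⟩ := (((ht.eventually (Metric.ball_mem_nhds x hr)).and
    (ht.eventually (Metric.ball_mem_nhds x hr'))).and self_mem_nhdsWithin).exists
  have h4 := (H _ h1).symm.trans (H' _ h2)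
  have e : ∀ w : Plane, inner ℝ (x - t • (ν - ν') - x) w = -t * (inner ℝ ν w - inner ℝ ν' w) := by
    intro w
    rw [sub_sub_cancel_left, inner_neg_left, real_inner_smul_left, inner_sub_left]; ring
  rw [e, e, real_inner_self_eq_norm_sq, real_inner_self_eq_norm_sq, hν, hν',
    real_inner_comm ν ν'] at h4
  have h3' : 0 < t := h3
  have := h4.1 (by nlinarith)
  nlinarith

lemma IsOutwardNormal.outwardNormal_eq {Ω : Set Plane} {ν : Plane} (h : IsOutwardNormal Ω x ν) :
    outwardNormal Ω x = ν := by
  have hex : ∃ ν, IsOutwardNormal Ω x ν := ⟨ν, h⟩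
  rw [outwardNormal, dif_pos hex]
  exact hex.choose_spec.eq h

lemma TriMesh.interior_or_inEdge (hT : T ∈ 𝓣.elems) (hx : x ∈ element T) (hv : x ∉ 𝓣.vertices) :
    x ∈ interior (element T) ∨ ∃ i, InEdge (𝓣.vert T) i x := by
  rw [𝓣.mem_interior_element hT]
  exact bary_trichotomy (𝓣.area2_vert hT) ((𝓣.mem_element hT).1 hx)
    fun i h => hv (h ▸ 𝓣.vert_mem_vertices hT i)

lemma TriMesh.InEdge.eventually {i : Fin 3} (hT : T ∈ 𝓣.elems) (hx : InEdge (𝓣.vert T) i x) :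
    ∀ᶠ y in 𝓝 x, (y ∈ element T ↔ inner ℝ (y - x) (edgeNormal (𝓣.vert T) i) ≤ 0) ∧
      (y ∈ interior (element T) ↔ inner ℝ (y - x) (edgeNormal (𝓣.vert T) i) < 0) := by
  rw [𝓣.element_eq hT]
  exact eventually_mem_convexHull_iff (𝓣.area2_vert hT) hx.1 hx.2.1 hx.2.2

lemma TriMesh.InEdge.mem_element {i : Fin 3} (hT : T ∈ 𝓣.elems) (hx : InEdge (𝓣.vert T) i x) :
    x ∈ element T :=
  (𝓣.mem_element hT).2 ((forall_fin3 i).2 ⟨hx.1.ge, hx.2.1.le, hx.2.2.le⟩)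

/-- At a common edge the outward normals of two elements are opposite. -/
lemma TriMesh.edgeNormal_eq_neg {i j : Fin 3} (hS : S ∈ 𝓣.elems) (hT : T ∈ 𝓣.elems) (hST : S ≠ T)
    (hxT : InEdge (𝓣.vert T) i x) (hxS : InEdge (𝓣.vert S) j x) :
    edgeNormal (𝓣.vert S) j = -edgeNormal (𝓣.vert T) i := by
  set a := edgeNormal (𝓣.vert S) j
  set b := edgeNormal (𝓣.vert T) i
  have ha : ‖a‖ = 1 := norm_edgeNormal (𝓣.area2_vert hS) j
  have hb : ‖b‖ = 1 := norm_edgeNormal (𝓣.area2_vert hT) i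
  refine eq_neg_of_inner_le ha hb ?_
  by_contra! hlt
  -- If the normals were not opposite, a small step along `-(a + b)` would enter the interiors of
  -- both elements.
  have ht : Tendsto (fun t : ℝ => x - t • (a + b)) (𝓝[>] 0) (𝓝 x) := by
    have : Continuous fun t : ℝ => x - t • (a + b) := by fun_prop
    simpa using (this.tendsto 0).mono_left nhdsWithin_le_nhds
  obtain ⟨t, ⟨h1, h2⟩, h3⟩ := (((ht.eventually (InEdge.eventually hS hxS)).and
    (ht.eventually (InEdge.eventually hT hxT))).and self_mem_nhdsWithin).exists
  have h3' : 0 < t := h3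
  have e : ∀ w : Plane, inner ℝ (x - t • (a + b) - x) w = -t * (inner ℝ a w + inner ℝ b w) := by
    intro w
    rw [sub_sub_cancel_left, inner_neg_left, real_inner_smul_left, inner_add_left]; ring
  refine hST (𝓣.eq_of_mem_interior hS hT (h2.2.2 ?_) (h1.1.2 ?_))
  · change inner ℝ _ b < 0
    rw [e, real_inner_self_eq_norm_sq, hb]; nlinarith
  · change inner ℝ _ a ≤ 0
    rw [e, real_inner_self_eq_norm_sq, ha, real_inner_comm]; nlinarith

/-- The other elements are finitely many closed sets that miss `x`, so they also miss a
neighbourhood of it. -/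
lemma TriMesh.eventually_mem_closure_iff (hT : T ∈ 𝓣.elems)
    (h : ∀ S ∈ 𝓣.elems, x ∈ element S → S = T) :
    ∀ᶠ y in 𝓝 x, y ∈ closure 𝓣.domain ↔ y ∈ element T := by
  have h1 : ∀ᶠ y in 𝓝 x, ∀ S ∈ 𝓣.elems, S ≠ T → y ∉ element S := by
    refine (Filter.eventually_all_finset 𝓣.elems).2 fun S hS => ?_
    by_cases hST : S = T
    · exact Eventually.of_forall fun y hy => absurd hST hy
    · have : x ∉ element S := fun hx => hST (h S hS hx)
      filter_upwards [(isCompact_element S).isClosed.isOpen_compl.mem_nhds this] with y hy _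
      exact hy
  filter_upwards [h1] with y hy
  refine ⟨fun hc => ?_, fun hc => 𝓣.element_subset_closure hT hc⟩
  rw [𝓣.closure_domain] at hc
  obtain ⟨S, hS, hyS⟩ := Set.mem_iUnion₂.1 hc
  by_cases hST : S = T
  · exact hST ▸ hyS
  · exact absurd hyS (hy S hS hST)

lemma TriMesh.domain_eq_interior_closure : 𝓣.domain = interior (closure 𝓣.domain) := by
  rw [𝓣.closure_domain]; rfl

lemma TriMesh.isOutwardNormal {i : Fin 3} (hT : T ∈ 𝓣.elems) (hx : InEdge (𝓣.vert T) i x)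
    (h : ∀ S ∈ 𝓣.elems, x ∈ element S → S = T) :
    IsOutwardNormal 𝓣.domain x (edgeNormal (𝓣.vert T) i) := by
  refine ⟨norm_edgeNormal (𝓣.area2_vert hT) i, Metric.eventually_nhds_iff_ball.1 ?_⟩
  -- Ω is the interior of its closure, so membership of `y` is local at `y`. The two sets must
  -- therefore agree near each nearby `y`, not just at it.
  filter_upwards [(𝓣.eventually_mem_closure_iff hT h).eventually_nhds,
    InEdge.eventually hT hx] with y h1 h2
  rw [← h2.2, 𝓣.domain_eq_interior_closure, mem_interior_iff_mem_nhds, mem_interior_iff_mem_nhds]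
  exact Filter.eventually_congr h1

/-- The two elements are complementary closed half planes near `x`, so together they cover a
neighbourhood. -/
lemma TriMesh.mem_domain_of_two {i j : Fin 3} (hS : S ∈ 𝓣.elems) (hT : T ∈ 𝓣.elems) (hST : S ≠ T)
    (hxT : InEdge (𝓣.vert T) i x) (hxS : InEdge (𝓣.vert S) j x) : x ∈ 𝓣.domain := by
  rw [𝓣.domain_eq_interior_closure, mem_interior_iff_mem_nhds]
  have hn := 𝓣.edgeNormal_eq_neg hS hT hST hxT hxS
  filter_upwards [InEdge.eventually hS hxS, InEdge.eventually hT hxT] with y h1 h2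
  by_cases hy : y ∈ element T
  · exact 𝓣.element_subset_closure hT hy
  · refine 𝓣.element_subset_closure hS (h1.1.2 ?_)
    rw [h2.1, not_le] at hy
    rw [hn, inner_neg_right]; linarith

lemma TriMesh.notMem_domain_of_frontier (hx : x ∈ frontier 𝓣.domain) : x ∉ 𝓣.domain :=
  fun h => hx.2 (𝓣.isOpen_domain.interior_eq.symm ▸ h)

/-- A boundary point off the vertices lies on exactly one edge of exactly one element. -/
theorem TriMesh.boundary_point (hx : x ∈ frontier 𝓣.domain) (hv : x ∉ 𝓣.vertices) :
    ∃ T ∈ 𝓣.elems, ∃ i, InEdge (𝓣.vert T) i x ∧ ∀ S ∈ 𝓣.elems, x ∈ element S → S = T := by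
  have hx' := 𝓣.notMem_domain_of_frontier hx
  have hc : x ∈ closure 𝓣.domain := frontier_subset_closure hx
  rw [𝓣.closure_domain] at hc
  obtain ⟨T, hT, hxT⟩ := Set.mem_iUnion₂.1 hc
  rcases 𝓣.interior_or_inEdge hT hxT hv with h | ⟨i, hi⟩
  · exact absurd (𝓣.interior_element_subset hT h) hx'
  refine ⟨T, hT, i, hi, fun S hS hxS => ?_⟩
  by_contra hST
  rcases 𝓣.interior_or_inEdge hS hxS hv with h | ⟨j, hj⟩
  · exact hx' (𝓣.interior_element_subset hS h)
  · exact hx' (𝓣.mem_domain_of_two hS hT hST hi hj)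

/-- The sum of the outward unit normals at `x` of the elements. -/
def TriMesh.normalSum (𝓣 : TriMesh) (x : Plane) : Plane :=
  ∑ T ∈ 𝓣.elems, ∑ i, (edge (𝓣.vert T) i).indicator (fun _ => edgeNormal (𝓣.vert T) i) x

lemma TriMesh.mem_edge (hT : T ∈ 𝓣.elems) {i : Fin 3} :
    x ∈ edge (𝓣.vert T) i ↔
      bary (𝓣.vert T) i x = 0 ∧ 0 ≤ bary (𝓣.vert T) (i + 1) x ∧ 0 ≤ bary (𝓣.vert T) (i + 2) x :=
  mem_edge_iff_bary (𝓣.area2_vert hT)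

lemma TriMesh.edge_subset_element (hT : T ∈ 𝓣.elems) (i : Fin 3) :
    edge (𝓣.vert T) i ⊆ element T := fun x hx => by
  rw [𝓣.mem_edge hT] at hx
  exact (𝓣.mem_element hT).2 ((forall_fin3 i).2 ⟨hx.1.ge, hx.2⟩)

lemma InEdge.mem_edge {i : Fin 3} (hT : T ∈ 𝓣.elems) (hx : InEdge (𝓣.vert T) i x) :
    x ∈ edge (𝓣.vert T) i := (𝓣.mem_edge hT).2 ⟨hx.1, hx.2.1.le, hx.2.2.le⟩

lemma InEdge.eq_of_mem_edge {i j : Fin 3} (hT : T ∈ 𝓣.elems) (hx : InEdge (𝓣.vert T) i x)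
    (hj : x ∈ edge (𝓣.vert T) j) : j = i := by
  have h := ((𝓣.mem_edge hT).1 hj).1
  rcases fin3_cases i j with rfl | rfl | rfl
  · rfl
  · exact absurd h hx.2.1.ne'
  · exact absurd h hx.2.2.ne'

lemma sum_indicator_edge {M : Type*} [AddCommMonoid M] {i : Fin 3} (hT : T ∈ 𝓣.elems)
    (hx : InEdge (𝓣.vert T) i x) (f : Fin 3 → Plane → M) :
    ∑ j, (edge (𝓣.vert T) j).indicator (f j) x = f i x := by
  rw [Finset.sum_eq_single i, Set.indicator_of_mem (hx.mem_edge hT)]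
  · intro j _ hj
    exact Set.indicator_of_notMem (fun h => hj (hx.eq_of_mem_edge hT h)) _
  · simp

lemma sum_indicator_edge_of_notMem {M : Type*} [AddCommMonoid M] (hT : T ∈ 𝓣.elems)
    (hx : x ∉ element T) (f : Fin 3 → Plane → M) :
    ∑ j, (edge (𝓣.vert T) j).indicator (f j) x = 0 :=
  Finset.sum_eq_zero fun j _ =>
    Set.indicator_of_notMem (fun h => hx (𝓣.edge_subset_element hT j h)) _

lemma sum_indicator_edge_of_interior {M : Type*} [AddCommMonoid M] (hT : T ∈ 𝓣.elems)
    (hx : x ∈ interior (element T)) (f : Fin 3 → Plane → M) :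
    ∑ j, (edge (𝓣.vert T) j).indicator (f j) x = 0 :=
  Finset.sum_eq_zero fun j _ => Set.indicator_of_notMem
    (fun h => ((𝓣.mem_interior_element hT).1 hx j).ne' ((𝓣.mem_edge hT).1 h).1) _

/-- Sums over all edges reduce to the boundary edge at a boundary point. -/
lemma TriMesh.sum_indicator_eq {M : Type*} [AddCommMonoid M] {i : Fin 3} (hT : T ∈ 𝓣.elems)
    (hx : InEdge (𝓣.vert T) i x) (h : ∀ S ∈ 𝓣.elems, x ∈ element S → S = T)
    (f : Finset Plane → Fin 3 → Plane → M) :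
    ∑ S ∈ 𝓣.elems, ∑ j, (edge (𝓣.vert S) j).indicator (f S j) x = f T i x := by
  rw [Finset.sum_eq_single T, sum_indicator_edge hT hx]
  · intro S hS hST
    exact sum_indicator_edge_of_notMem hS (fun hxS => hST (h S hS hxS)) _
  · exact fun hT' => absurd hT hT'

/-- The cancellation behind the divergence theorem: off the boundary and the vertices, an edge point
lies in exactly two elements, with opposite normals. -/
lemma TriMesh.normalSum_eq_zero (hx : x ∉ frontier 𝓣.domain) (hv : x ∉ 𝓣.vertices) :
    𝓣.normalSum x = 0 := by
  rw [normalSum]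
  by_cases hint : ∃ T ∈ 𝓣.elems, x ∈ interior (element T)
  · obtain ⟨T, hT, hxT⟩ := hint
    refine Finset.sum_eq_zero fun S hS => ?_
    by_cases hxS : x ∈ element S
    · exact sum_indicator_edge_of_interior hS (𝓣.eq_of_mem_interior hS hT hxT hxS ▸ hxT) _
    · exact sum_indicator_edge_of_notMem hS hxS _
  push Not at hint
  by_cases hex : ∃ T ∈ 𝓣.elems, x ∈ element T
  swap
  · push Not at hex
    exact Finset.sum_eq_zero fun S hS => sum_indicator_edge_of_notMem hS (hex S hS) _
  obtain ⟨T, hT, hxT⟩ := hex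
  obtain ⟨i, hi⟩ := (𝓣.interior_or_inEdge hT hxT hv).resolve_left (hint T hT)
  -- A point on an edge of only one element would have an outward normal, hence be a boundary point.
  have h2 : ∃ S ∈ 𝓣.elems, x ∈ element S ∧ S ≠ T := by
    by_contra! hno
    obtain ⟨-, r, hr, H⟩ := 𝓣.isOutwardNormal hT hi hno
    refine hx ⟨𝓣.element_subset_closure hT hxT, ?_⟩
    rw [𝓣.isOpen_domain.interior_eq, H x (Metric.mem_ball_self hr)]
    simp
  obtain ⟨S, hS, hxS, hST⟩ := h2
  obtain ⟨j, hj⟩ := (𝓣.interior_or_inEdge hS hxS hv).resolve_left (hint S hS)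
  rw [Finset.sum_eq_add S T hST, sum_indicator_edge hS hj, sum_indicator_edge hT hi,
    𝓣.edgeNormal_eq_neg hS hT hST hi hj, neg_add_cancel]
  · rintro R hR ⟨hRS, hRT⟩
    -- A third element is impossible: three unit vectors cannot be pairwise opposite.
    refine sum_indicator_edge_of_notMem hR (fun hxR => ?_) _
    obtain ⟨k, hk⟩ := (𝓣.interior_or_inEdge hR hxR hv).resolve_left (hint R hR)
    have e1 := 𝓣.edgeNormal_eq_neg hR hT hRT hi hk
    have e2 := 𝓣.edgeNormal_eq_neg hR hS hRS hj hk
    have e3 := 𝓣.edgeNormal_eq_neg hS hT hST hi hj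
    have e4 := norm_edgeNormal (𝓣.area2_vert hT) i
    rw [e3, neg_neg, e1] at e2
    have e5 : (2 : ℝ) • edgeNormal (𝓣.vert T) i = 0 := by
      rw [two_smul]; nth_rewrite 1 [← e2]; exact neg_add_cancel _
    rw [(smul_eq_zero.1 e5).resolve_left two_ne_zero] at e4
    simp at e4
  · exact fun h => absurd hS h
  · exact fun h => absurd hT h

lemma TriMesh.outwardNormal_eq {i : Fin 3} (hT : T ∈ 𝓣.elems) (hx : InEdge (𝓣.vert T) i x)
    (h : ∀ S ∈ 𝓣.elems, x ∈ element S → S = T) :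
    outwardNormal 𝓣.domain x = edgeNormal (𝓣.vert T) i :=
  (𝓣.isOutwardNormal hT hx h).outwardNormal_eq

lemma TriMesh.normalSum_eq (hv : x ∉ 𝓣.vertices) :
    𝓣.normalSum x = (frontier 𝓣.domain).indicator (outwardNormal 𝓣.domain) x := by
  by_cases hx : x ∈ frontier 𝓣.domain
  · obtain ⟨T, hT, i, hi, h⟩ := 𝓣.boundary_point hx hv
    rw [Set.indicator_of_mem hx, 𝓣.outwardNormal_eq hT hi h]
    exact 𝓣.sum_indicator_eq hT hi h fun S j _ => edgeNormal (𝓣.vert S) j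
  · rw [Set.indicator_of_notMem hx, 𝓣.normalSum_eq_zero hx hv]

lemma TriMesh.frontier_subset :
    frontier 𝓣.domain ⊆ ⋃ T ∈ 𝓣.elems, ⋃ i, edge (𝓣.vert T) i := by
  intro x hx
  have hc : x ∈ closure 𝓣.domain := frontier_subset_closure hx
  rw [𝓣.closure_domain] at hc
  obtain ⟨T, hT, hxT⟩ := Set.mem_iUnion₂.1 hc
  have hni : x ∉ interior (element T) := fun h =>
    𝓣.notMem_domain_of_frontier hx (𝓣.interior_element_subset hT h)
  rw [𝓣.mem_interior_element hT] at hni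
  push Not at hni
  obtain ⟨i, hi⟩ := hni
  rw [𝓣.mem_element hT] at hxT
  exact Set.mem_iUnion₂.2 ⟨T, hT, Set.mem_iUnion.2 ⟨i,
    (𝓣.mem_edge hT).2 ⟨le_antisymm hi (hxT i), hxT _, hxT _⟩⟩⟩

lemma TriMesh.hausdorff_frontier_lt_top :
    (Measure.hausdorffMeasure 1 : Measure Plane) (frontier 𝓣.domain) < ⊤ := by
  refine (measure_mono 𝓣.frontier_subset).trans_lt ?_
  refine (measure_biUnion_lt_top 𝓣.elems.finite_toSet fun T _ => ?_)
  exact (measure_iUnion_le _).trans_lt (by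
    rw [tsum_fintype]
    exact ENNReal.sum_lt_top.2 fun i _ => hausdorffMeasure_edge_lt_top _ i)

instance TriMesh.isFiniteMeasure_bdryMeasure : IsFiniteMeasure (bdryMeasure 𝓣.domain) :=
  ⟨by rw [bdryMeasure, Measure.restrict_apply_univ]; exact 𝓣.hausdorff_frontier_lt_top⟩

lemma TriMesh.volume_domain_lt_top : volume 𝓣.domain < ⊤ :=
  (measure_mono (interior_subset)).trans_lt 𝓣.isCompact_iUnion.measure_lt_top

instance TriMesh.isFiniteMeasure_domain : IsFiniteMeasure (volume.restrict 𝓣.domain) :=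
  ⟨by rw [Measure.restrict_apply_univ]; exact 𝓣.volume_domain_lt_top⟩

lemma TriMesh.hausdorff_vertices : (Measure.hausdorffMeasure 1 : Measure Plane) 𝓣.vertices = 0 := by
  have := Measure.nullSingletonClass_hausdorff Plane (d := 1) one_pos
  exact 𝓣.finite_vertices.measure_zero _

lemma TriMesh.ae_notMem_vertices :
    ∀ᵐ x ∂(Measure.hausdorffMeasure 1 : Measure Plane), x ∉ 𝓣.vertices :=
  measure_eq_zero_iff_ae_notMem.1 𝓣.hausdorff_vertices

/-- The finitely many vertices are null for arc length, so properties almost everywhere on Γ need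
checking only inside an edge of a single element, where normal and one-sided gradient are explicit.
-/
lemma TriMesh.ae_bdry_iff {q : Plane → Prop} (h : ∀ T ∈ 𝓣.elems, ∀ i, ∀ x ∈ frontier 𝓣.domain,
    InEdge (𝓣.vert T) i x → (∀ S ∈ 𝓣.elems, x ∈ element S → S = T) → q x) :
    ∀ᵐ x ∂bdryMeasure 𝓣.domain, q x := by
  rw [bdryMeasure, ae_restrict_iff' isClosed_frontier.measurableSet]
  filter_upwards [𝓣.ae_notMem_vertices] with x hv hx
  obtain ⟨T, hT, i, hi, hS⟩ := 𝓣.boundary_point hx hv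
  exact h T hT i x hx hi hS

lemma TriMesh.pairwise_disjoint_interior :
    Set.Pairwise (𝓣.elems : Set (Finset Plane)) (Function.onFun Disjoint fun T => interior (element T)) := by
  intro S hS T hT hST
  refine Set.disjoint_left.2 fun x hxS hxT => hST ?_
  exact 𝓣.eq_of_mem_interior hS hT hxT (interior_subset hxS)

lemma element_ae_eq_interior (T : Finset Plane) :
    (interior (element T) : Set Plane) =ᵐ[volume] element T :=
  interior_ae_eq_of_null_frontier ((convex_convexHull ℝ _).addHaar_frontier volume)

lemma TriMesh.domain_ae_eq :
    (𝓣.domain : Set Plane) =ᵐ[volume] ⋃ T ∈ 𝓣.elems, interior (element T) := by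
  have h1 : (⋃ T ∈ 𝓣.elems, interior (element T) : Set Plane) =ᵐ[volume]
      ⋃ T ∈ 𝓣.elems, element T := by
    refine Filter.EventuallyEq.countable_bUnion 𝓣.elems.countable_toSet fun T _ => ?_
    exact element_ae_eq_interior T
  refine EventuallyLE.antisymm ?_ (Eventually.of_forall fun x hx => ?_)
  · exact EventuallyLE.trans_eq (Eventually.of_forall fun x hx => interior_subset hx) h1.symm
  · obtain ⟨T, hT, hxT⟩ := Set.mem_iUnion₂.1 hx
    exact 𝓣.interior_element_subset hT hxT

lemma TriMesh.ae_domain_iff {q : Plane → Prop}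
    (h : ∀ T ∈ 𝓣.elems, ∀ x ∈ interior (element T), q x) : ∀ᵐ x ∂volume.restrict 𝓣.domain, q x := by
  rw [Measure.restrict_congr_set 𝓣.domain_ae_eq, ae_restrict_iff'
    (Finset.measurableSet_biUnion _ fun T _ => isOpen_interior.measurableSet)]
  refine Eventually.of_forall fun x hx => ?_
  obtain ⟨T, hT, hxT⟩ := Set.mem_iUnion₂.1 hx
  exact h T hT x hxT

lemma TriMesh.setIntegral_domain {g : Plane → ℝ} (hg : IntegrableOn g 𝓣.domain) :
    ∫ x in 𝓣.domain, g x = ∑ T ∈ 𝓣.elems, ∫ x in element T, g x := by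
  rw [setIntegral_congr_set 𝓣.domain_ae_eq, integral_biUnion_finset _
    (fun T _ => isOpen_interior.measurableSet) 𝓣.pairwise_disjoint_interior
    (fun T hT => hg.mono_set (𝓣.interior_element_subset hT))]
  exact Finset.sum_congr rfl fun T _ => setIntegral_congr_set (element_ae_eq_interior T)

lemma integrableOn_of_compact {μ : Measure Plane} {s : Set Plane} (hs : IsCompact s)
    (hμ : μ s < ⊤) {f : Plane → ℝ} (hf : ContinuousOn f s) : IntegrableOn f s μ := by
  obtain ⟨C, hC⟩ := hs.exists_bound_of_continuousOn hf
  have : IsFiniteMeasure (μ.restrict s) := ⟨by rwa [Measure.restrict_apply_univ]⟩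
  exact Integrable.of_bound (hf.aestronglyMeasurable hs.measurableSet) C
    ((ae_restrict_iff' hs.measurableSet).2 (Eventually.of_forall hC))

lemma isCompact_edge (p : Fin 3 → Plane) (i : Fin 3) : IsCompact (edge p i) :=
  by rw [edge, ← convexHull_pair]; exact (Set.toFinite _).isCompact_convexHull ℝ

/-- The divergence theorem on a polygonal domain, for a continuous vector field that is
differentiable in the interior of each element. -/
theorem TriMesh.divergence {F : Plane → Plane} {F' : Plane → Plane →L[ℝ] Plane}
    (hc : ContinuousOn F (closure 𝓣.domain))
    (hd : ∀ T ∈ 𝓣.elems, ∀ x ∈ interior (element T), HasFDerivAt F (F' x) x)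
    (hi : IntegrableOn (fun x => tr (F' x)) 𝓣.domain) :
    ∫ x in 𝓣.domain, tr (F' x) =
      ∫ x, inner ℝ (F x) (outwardNormal 𝓣.domain x) ∂bdryMeasure 𝓣.domain := by
  have hiT : ∀ T ∈ 𝓣.elems, IntegrableOn (fun x => tr (F' x)) (element T) := fun T hT =>
    (integrableOn_congr_set_ae (element_ae_eq_interior T)).1
      (hi.mono_set (𝓣.interior_element_subset hT))
  have hcT : ∀ T ∈ 𝓣.elems, ContinuousOn F (element T) := fun T hT =>
    hc.mono (𝓣.element_subset_closure hT)
  have hT : ∀ T ∈ 𝓣.elems, ∫ x in element T, tr (F' x) =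
      ∑ i, ∫ x, (edge (𝓣.vert T) i).indicator
        (fun x => inner ℝ (F x) (edgeNormal (𝓣.vert T) i)) x
        ∂(Measure.hausdorffMeasure 1 : Measure Plane) := by
    intro T hT
    have h1 := hcT T hT
    have h2 := hd T hT
    have h3 := hiT T hT
    rw [𝓣.element_eq hT] at h1 h2 h3 ⊢
    rw [triangle_divergence (𝓣.area2_vert hT) h1 h2 h3]
    exact Finset.sum_congr rfl fun i _ =>
      (integral_indicator (isCompact_edge _ i).measurableSet).symm
  have hint : ∀ T ∈ 𝓣.elems, ∀ i, Integrable ((edge (𝓣.vert T) i).indicator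
      (fun x => inner ℝ (F x) (edgeNormal (𝓣.vert T) i)))
      (Measure.hausdorffMeasure 1 : Measure Plane) := by
    intro T hT i
    rw [integrable_indicator_iff (isCompact_edge _ i).measurableSet]
    exact integrableOn_of_compact (isCompact_edge _ i) (hausdorffMeasure_edge_lt_top _ i)
      (((hcT T hT).mono (𝓣.edge_subset_element hT i)).inner continuousOn_const)
  rw [𝓣.setIntegral_domain hi, Finset.sum_congr rfl hT, bdryMeasure,
    ← integral_indicator isClosed_frontier.measurableSet]
  have e1 : ∀ T ∈ 𝓣.elems, ∑ i, ∫ x, (edge (𝓣.vert T) i).indicator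
        (fun x => inner ℝ (F x) (edgeNormal (𝓣.vert T) i)) x
        ∂(Measure.hausdorffMeasure 1 : Measure Plane) = ∫ x, ∑ i, (edge (𝓣.vert T) i).indicator
        (fun x => inner ℝ (F x) (edgeNormal (𝓣.vert T) i)) x
        ∂(Measure.hausdorffMeasure 1 : Measure Plane) := fun T hT =>
    (integral_finsetSum _ fun i _ => hint T hT i).symm
  -- All edge integrals are collected under one integral, so that inner edges cancel pointwise
  -- through `TriMesh.normalSum_eq`.
  rw [Finset.sum_congr rfl e1, ← integral_finsetSum _ fun T hT =>
    integrable_finsetSum _ fun i _ => hint T hT i]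
  refine integral_congr_ae ?_
  filter_upwards [𝓣.ae_notMem_vertices] with x hv
  have e2 : (frontier 𝓣.domain).indicator
      (fun x => inner ℝ (F x) (outwardNormal 𝓣.domain x)) x = inner ℝ (F x) (𝓣.normalSum x) := by
    rw [𝓣.normalSum_eq hv]
    by_cases hx : x ∈ frontier 𝓣.domain <;> simp [hx]
  rw [e2, TriMesh.normalSum, inner_sum]
  refine Finset.sum_congr rfl fun T _ => ?_
  rw [inner_sum]
  refine Finset.sum_congr rfl fun i _ => ?_
  by_cases hx : x ∈ edge (𝓣.vert T) i <;> simp [hx]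
end

/-! ### Polynomials: gradients and the discrete trace inequality. -/

noncomputable section

/-- The gradient of a polynomial function on the plane. -/
def polyGrad (p : MvPolynomial (Fin 2) ℝ) (x : Plane) : Plane :=
  !₂[MvPolynomial.eval (fun i => x i) (MvPolynomial.pderiv 0 p),
    MvPolynomial.eval (fun i => x i) (MvPolynomial.pderiv 1 p)]

lemma polyGrad_apply (p : MvPolynomial (Fin 2) ℝ) (x : Plane) (j : Fin 2) :
    polyGrad p x j = MvPolynomial.eval (fun i => x i) (MvPolynomial.pderiv j p) := by
  fin_cases j <;> rfl

lemma hasFDerivAt_iff_gradient {f : Plane → ℝ} {g x : Plane} :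
    HasGradientAt f g x ↔ HasFDerivAt f (innerSL ℝ g) x := Iff.rfl

lemma hasGradientAt_poly (p : MvPolynomial (Fin 2) ℝ) (x : Plane) :
    HasGradientAt (fun y : Plane => MvPolynomial.eval (fun i => y i) p) (polyGrad p x) x := by
  rw [hasFDerivAt_iff_gradient]
  induction p using MvPolynomial.induction_on with
  | C a =>
    simp only [MvPolynomial.eval_C]
    refine (hasFDerivAt_const a x).congr_fderiv ?_
    ext y
    simp [plane_inner, polyGrad_apply]
  | add p q hp hq =>
    simp only [map_add]
    refine (hp.add hq).congr_fderiv ?_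
    ext y
    simp [plane_inner, polyGrad_apply]; ring
  | mul_X p j hp =>
    simp only [map_mul, MvPolynomial.eval_X]
    refine (hp.mul (EuclideanSpace.proj (𝕜 := ℝ) j).hasFDerivAt).congr_fderiv ?_
    ext y
    fin_cases j <;>
    simp [plane_inner, polyGrad_apply, MvPolynomial.pderiv_X] <;> ring

lemma continuous_eval_plane (p : MvPolynomial (Fin 2) ℝ) :
    Continuous fun x : Plane => MvPolynomial.eval (fun i => x i) p :=
  (MvPolynomial.continuous_eval p).comp (continuous_pi fun i => by fun_prop)

lemma continuous_polyGrad (p : MvPolynomial (Fin 2) ℝ) : Continuous (polyGrad p) := by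
  refine (PiLp.continuous_toLp 2 _).comp (continuous_pi fun i => ?_)
  fin_cases i
  · exact continuous_eval_plane (MvPolynomial.pderiv 0 p)
  · exact continuous_eval_plane (MvPolynomial.pderiv 1 p)

lemma totalDegree_pderiv_le {σ : Type*} (i : σ) (p : MvPolynomial σ ℝ) :
    (MvPolynomial.pderiv i p).totalDegree ≤ p.totalDegree := by
  classical
  conv_lhs => rw [p.as_sum, map_sum]
  refine MvPolynomial.totalDegree_finsetSum_le fun s hs => ?_
  rw [MvPolynomial.pderiv_monomial]
  refine (MvPolynomial.totalDegree_monomial_le _ _).trans ?_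
  refine le_trans ?_ (MvPolynomial.le_totalDegree hs)
  refine Finsupp.degree_mono ?_
  exact tsub_le_self

/-- A linear functional is bounded with respect to a positive definite form in finite dimension. -/
lemma exists_sq_le_of_posDef {V : Type*} [AddCommGroup V] [Module ℝ V] [FiniteDimensional ℝ V]
    (B : LinearMap.BilinForm ℝ V) (hs : ∀ x y, B x y = B y x) (hp : ∀ x, 0 ≤ B x x)
    (hd : ∀ x, B x x = 0 → x = 0) (φ : V →ₗ[ℝ] ℝ) : ∃ C > 0, ∀ v, φ v ^ 2 ≤ C * B v v := by
  have hinj : Function.Injective B := by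
    refine (injective_iff_map_eq_zero B).2 fun x hx => hd x ?_
    rw [hx]; rfl
  -- Riesz representation gives `φ = B w`, and Cauchy–Schwarz the constant `B w w`; the added 1
  -- keeps it positive when `φ = 0`.
  obtain ⟨w, hw⟩ := (LinearMap.injective_iff_surjective_of_finrank_eq_finrank
    (Subspace.dual_finrank_eq (K := ℝ) (V := V)).symm).1 hinj φ
  refine ⟨B w w + 1, by linarith [hp w], fun v => ?_⟩
  have h := LinearMap.BilinForm.apply_mul_apply_le_of_forall_zero_le B hp w v
  rw [hs v w] at h
  rw [← hw]
  nlinarith [hp v]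

/-- The inverse inequality that bounds the value at `1` of a polynomial. -/
lemma exists_eval_one_sq_le (P : ℕ) : ∃ C > 0, ∀ r : Polynomial ℝ, r.natDegree ≤ P →
    r.eval 1 ^ 2 ≤ C * ∫ s in (0 : ℝ)..1, s * r.eval s ^ 2 := by
  have hint : ∀ r q : Polynomial ℝ,
      IntervalIntegrable (fun s => s * (r.eval s * q.eval s)) volume 0 1 := fun r q =>
    (continuous_id.mul (r.continuous.mul q.continuous)).intervalIntegrable _ _
  -- The weight `s` is the Jacobian factor of `duffy`. The form is definite because a polynomial
  -- with infinitely many roots is zero.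
  let B : LinearMap.BilinForm ℝ (Polynomial.degreeLE ℝ P) :=
    LinearMap.mk₂ ℝ (fun r q => ∫ s in (0 : ℝ)..1, s * (r.1.eval s * q.1.eval s))
      (fun r r' q => by
        rw [← intervalIntegral.integral_add (hint _ _) (hint _ _)]
        congr 1; ext s; simp; ring)
      (fun a r q => by
        rw [smul_eq_mul, ← intervalIntegral.integral_const_mul]
        congr 1; ext s; simp; ring)
      (fun r q q' => by
        rw [← intervalIntegral.integral_add (hint _ _) (hint _ _)]
        congr 1; ext s; simp; ring)
      (fun a r q => by
        rw [smul_eq_mul, ← intervalIntegral.integral_const_mul]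
        congr 1; ext s; simp; ring)
  have hB : ∀ r q, B r q = ∫ s in (0 : ℝ)..1, s * (r.1.eval s * q.1.eval s) := fun r q => rfl
  have hnn : ∀ (r : Polynomial.degreeLE ℝ P), ∀ s ∈ Set.Icc (0 : ℝ) 1,
      0 ≤ s * (r.1.eval s * r.1.eval s) := fun r s hs => mul_nonneg hs.1 (mul_self_nonneg _)
  have : FiniteDimensional ℝ (Polynomial.degreeLE ℝ P) := by
    classical
    exact Module.Finite.iff_fg.2 ⟨_, Polynomial.degreeLE_eq_span_X_pow.symm⟩
  obtain ⟨C, hC, h⟩ := exists_sq_le_of_posDef B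
    (fun r q => by simp only [hB, mul_comm (r.1.eval _)])
    (fun r => intervalIntegral.integral_nonneg zero_le_one (hnn r))
    (fun r hr => by
      by_contra hne
      have hr1 : r.1 ≠ 0 := fun h => hne (Subtype.ext h)
      obtain ⟨s, hs, hs'⟩ : ∃ s ∈ Set.Ioo (0 : ℝ) 1, r.1.eval s ≠ 0 := by
        by_contra! hall
        exact hr1 (Polynomial.eq_zero_of_infinite_isRoot _
          ((Set.Ioo_infinite zero_lt_one).mono fun s hs => hall s hs))
      refine (intervalIntegral.integral_pos zero_lt_one
        (continuous_id.mul (r.1.continuous.mul r.1.continuous)).continuousOn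
        (fun s hs => hnn r s ⟨hs.1.le, hs.2⟩) ⟨s, ⟨hs.1.le, hs.2.le⟩, ?_⟩).ne' hr
      exact mul_pos hs.1 (mul_self_pos.2 hs'))
    ((Polynomial.leval 1).comp (Polynomial.degreeLE ℝ P).subtype)
  refine ⟨C, hC, fun r hr => ?_⟩
  have := h ⟨r, Polynomial.mem_degreeLE.2 (Polynomial.natDegree_le_iff_degree_le.1 hr)⟩
  simpa [hB, sq] using this

/-- The discrete trace inequality on an edge of a triangle, for a polynomial. -/
lemma edge_integral_sq_le {P : ℕ} {C : ℝ} (hC : ∀ r : Polynomial ℝ, r.natDegree ≤ P →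
      r.eval 1 ^ 2 ≤ C * ∫ s in (0 : ℝ)..1, s * r.eval s ^ 2)
    {p : Fin 3 → Plane} (hp : 0 < area2 p) (i : Fin 3) {q : MvPolynomial (Fin 2) ℝ}
    (hq : q.totalDegree ≤ P) :
    ∫ x in edge p i, MvPolynomial.eval (fun j => x j) q ^ 2
        ∂(Measure.hausdorffMeasure 1 : Measure Plane) ≤
      ‖edgeDir p i‖ * (C / area2 p) *
        ∫ x in convexHull ℝ (Set.range p), MvPolynomial.eval (fun j => x j) q ^ 2 := by
  set g : Plane → ℝ := fun x => MvPolynomial.eval (fun j => x j) q with hg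
  have hgc : Continuous g := continuous_eval_plane q
  have hI : ∫ x in convexHull ℝ (Set.range p), g x ^ 2 =
      area2 p * ∫ t in (0 : ℝ)..1, ∫ s in (0 : ℝ)..1, s * g (duffy p i (s, t)) ^ 2 := by
    rw [(duffy_changeOfVariables hp i fun x => g x ^ 2).1]
    have hIcc : Set.Icc (0 : ℝ × ℝ) 1 = Set.Icc (0 : ℝ) 1 ×ˢ Set.Icc (0 : ℝ) 1 :=
      Set.Icc_prod_eq 0 1
    have hcont : Continuous fun z : ℝ × ℝ => z.1 * area2 p * g (duffy p i z) ^ 2 :=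
      (continuous_fst.mul continuous_const).mul ((hgc.comp (continuous_duffy p i)).pow 2)
    have hint : IntegrableOn (fun z : ℝ × ℝ => z.1 * area2 p * g (duffy p i z) ^ 2)
        (Set.Icc (0 : ℝ) 1 ×ˢ Set.Icc (0 : ℝ) 1) volume :=
      hcont.continuousOn.integrableOn_compact (isCompact_Icc.prod isCompact_Icc)
    rw [hIcc]
    rw [IntegrableOn, Measure.volume_eq_prod, ← Measure.prod_restrict] at hint
    rw [Measure.volume_eq_prod, ← Measure.prod_restrict, integral_prod_symm _ hint,
      ← intervalIntegral.integral_const_mul, integral_Icc_eq_integral_Ioc,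
      ← intervalIntegral.integral_of_le zero_le_one]
    congr 1
    ext t
    rw [integral_Icc_eq_integral_Ioc, ← intervalIntegral.integral_of_le zero_le_one,
      ← intervalIntegral.integral_const_mul]
    congr 1
    ext s
    ring
  rw [edge_integral hp, hI]
  have hpt : ∀ t : ℝ, g (p (i + 1) + t • edgeDir p i) ^ 2 ≤
      C * ∫ s in (0 : ℝ)..1, s * g (duffy p i (s, t)) ^ 2 := by
    intro t
    -- The restriction of `q` to the ray from the vertex `i` to the edge point with parameter `t`;
    -- it has degree at most `P`, and the edge point is at `s = 1`. Integration of the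
    -- one-dimensional bound over `t` then gives the claim.
    set r : Polynomial ℝ := MvPolynomial.aeval (fun j : Fin 2 => Polynomial.C (p i j) +
      Polynomial.X * Polynomial.C (((p (i + 1) - p i) + t • edgeDir p i) j)) q with hr
    have hdeg : r.natDegree ≤ P := by
      have := MvPolynomial.aeval_natDegree_le q hq (n := 1) (fun j : Fin 2 =>
        Polynomial.C (p i j) +
          Polynomial.X * Polynomial.C (((p (i + 1) - p i) + t • edgeDir p i) j)) fun j => by
            refine (Polynomial.natDegree_add_le _ _).trans (max_le (by simp) ?_)
            refine (Polynomial.natDegree_mul_le).trans ?_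
            rw [Polynomial.natDegree_C, add_zero]
            exact Polynomial.natDegree_X_le
      rwa [mul_one] at this
    have hev : ∀ s, r.eval s = g (duffy p i (s, t)) := by
      intro s
      have h := MvPolynomial.map_aeval (fun j : Fin 2 => Polynomial.C (p i j) +
        Polynomial.X * Polynomial.C (((p (i + 1) - p i) + t • edgeDir p i) j))
        (Polynomial.evalRingHom s) q
      rw [Polynomial.coe_evalRingHom] at h
      rw [hr, h, hg]
      simp only [MvPolynomial.eval, duffy]
      congr 1
      · congr 1
        · ext; simp
        · ext j; simp; ring
    have h1 : g (p (i + 1) + t • edgeDir p i) = r.eval 1 := by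
      rw [hev, duffy, one_smul, ← add_assoc, add_sub_cancel]
    have := hC r hdeg
    simp only [hev] at this
    rwa [h1, hev]
  have hc2 : Continuous fun t : ℝ => ∫ s in (0 : ℝ)..1, s * g (duffy p i (s, t)) ^ 2 := by
    refine intervalIntegral.continuous_parametric_intervalIntegral_of_continuous' ?_ 0 1
    exact continuous_snd.mul
      ((hgc.comp ((continuous_duffy p i).comp (continuous_snd.prodMk continuous_fst))).pow 2)
  have hmono : ∫ t in (0 : ℝ)..1, g (p (i + 1) + t • edgeDir p i) ^ 2 ≤
      ∫ t in (0 : ℝ)..1, C * ∫ s in (0 : ℝ)..1, s * g (duffy p i (s, t)) ^ 2 := by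
    refine intervalIntegral.integral_mono zero_le_one ?_ ?_ hpt
    · exact ((hgc.comp (by fun_prop)).pow 2).intervalIntegrable _ _
    · exact (continuous_const.mul hc2).intervalIntegrable _ _
  rw [intervalIntegral.integral_const_mul] at hmono
  calc _ ≤ ‖edgeDir p i‖ * (C * ∫ t in (0 : ℝ)..1, ∫ s in (0 : ℝ)..1,
        s * g (duffy p i (s, t)) ^ 2) := mul_le_mul_of_nonneg_left hmono (norm_nonneg _)
    _ = _ := by field_simp

lemma norm_polyGrad_sq (q : MvPolynomial (Fin 2) ℝ) (x : Plane) :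
    ‖polyGrad q x‖ ^ 2 = MvPolynomial.eval (fun j => x j) (MvPolynomial.pderiv 0 q) ^ 2 +
      MvPolynomial.eval (fun j => x j) (MvPolynomial.pderiv 1 q) ^ 2 := by
  rw [plane_norm_sq, polyGrad_apply, polyGrad_apply]

lemma edge_integral_polyGrad_le {P : ℕ} {C : ℝ} (hC : ∀ r : Polynomial ℝ, r.natDegree ≤ P →
      r.eval 1 ^ 2 ≤ C * ∫ s in (0 : ℝ)..1, s * r.eval s ^ 2)
    {p : Fin 3 → Plane} (hp : 0 < area2 p) (i : Fin 3) {q : MvPolynomial (Fin 2) ℝ}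
    (hq : q.totalDegree ≤ P) :
    ∫ x in edge p i, ‖polyGrad q x‖ ^ 2 ∂(Measure.hausdorffMeasure 1 : Measure Plane) ≤
      ‖edgeDir p i‖ * (C / area2 p) *
        ∫ x in convexHull ℝ (Set.range p), ‖polyGrad q x‖ ^ 2 := by
  have h : ∀ j : Fin 2, Continuous fun x : Plane =>
      MvPolynomial.eval (fun k => x k) (MvPolynomial.pderiv j q) ^ 2 := fun j =>
    (continuous_eval_plane _).pow 2
  have hE : ∀ j : Fin 2, IntegrableOn (fun x : Plane =>
      MvPolynomial.eval (fun k => x k) (MvPolynomial.pderiv j q) ^ 2) (edge p i)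
      (Measure.hausdorffMeasure 1 : Measure Plane) := fun j =>
    integrableOn_of_compact (isCompact_edge p i) (hausdorffMeasure_edge_lt_top p i)
      (h j).continuousOn
  have hT : ∀ j : Fin 2, IntegrableOn (fun x : Plane =>
      MvPolynomial.eval (fun k => x k) (MvPolynomial.pderiv j q) ^ 2)
      (convexHull ℝ (Set.range p)) := fun j =>
    (h j).continuousOn.integrableOn_compact ((Set.finite_range p).isCompact_convexHull ℝ)
  simp only [norm_polyGrad_sq]
  rw [integral_add (hE 0) (hE 1), integral_add (hT 0) (hT 1), mul_add]
  exact add_le_add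
    (edge_integral_sq_le hC hp i ((totalDegree_pderiv_le 0 q).trans hq))
    (edge_integral_sq_le hC hp i ((totalDegree_pderiv_le 1 q).trans hq))

/-- A factor two is given away by bounding `z.1` by 1; only an upper bound is needed to use shape
regularity. -/
lemma volume_le_area2 {p : Fin 3 → Plane} (hp : 0 < area2 p) :
    volume.real (convexHull ℝ (Set.range p)) ≤ area2 p := by
  have h := (duffy_changeOfVariables hp 0 fun _ => 1).1
  rw [setIntegral_const, smul_eq_mul, mul_one] at h
  rw [h]
  have hIcc : volume.real (Set.Icc (0 : ℝ × ℝ) 1) = 1 := by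
    have : Set.Icc (0 : ℝ × ℝ) 1 = Set.Icc (0 : ℝ) 1 ×ˢ Set.Icc (0 : ℝ) 1 :=
      Set.Icc_prod_eq 0 1
    rw [this, Measure.volume_eq_prod, measureReal_prod_prod]; simp
  calc ∫ z in Set.Icc (0 : ℝ × ℝ) 1, z.1 * area2 p * 1
      ≤ ∫ z in Set.Icc (0 : ℝ × ℝ) 1, area2 p := by
        refine setIntegral_mono_on ?_ ?_ measurableSet_Icc fun z hz => ?_
        · exact (by fun_prop : Continuous fun z : ℝ × ℝ => z.1 * area2 p * 1).continuousOn
            |>.integrableOn_compact isCompact_Icc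
        · exact continuousOn_const.integrableOn_compact isCompact_Icc
        · have : z.1 ≤ 1 := hz.2.1
          nlinarith
    _ = area2 p := by rw [setIntegral_const, hIcc, one_smul]
end

/-! ### Finite element functions, their gradients and traces in L². -/

noncomputable section

variable {𝓣 : TriMesh} {S T : Finset Plane} {x : Plane} {P : ℕ} {u v w : Plane → ℝ}
  {q : Finset Plane → MvPolynomial (Fin 2) ℝ}

/-- The polynomials `q T` represent `v` on the elements. -/
def TriMesh.Represents (𝓣 : TriMesh) (P : ℕ) (q : Finset Plane → MvPolynomial (Fin 2) ℝ)
    (v : Plane → ℝ) : Prop :=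
  ∀ T ∈ 𝓣.elems, (q T).totalDegree ≤ P ∧
    ∀ x ∈ element T, v x = MvPolynomial.eval (fun i => x i) (q T)

lemma TriMesh.exists_represents (hv : v ∈ 𝓣.feSpace P) : ∃ q, 𝓣.Represents P q v := by
  classical
  choose! q hq using hv.2.1
  exact ⟨q, hq⟩

/-- Each point lies in a triangle with nonempty interior contained in the closure. Hence gradients
from inside are unique and `gradientWithin` can be computed. -/
lemma TriMesh.uniqueDiffOn_closure : UniqueDiffOn ℝ (closure 𝓣.domain) := by
  intro x hx
  rw [𝓣.closure_domain] at hx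
  obtain ⟨T, hT, hxT⟩ := Set.mem_iUnion₂.1 hx
  exact (uniqueDiffOn_convex (convex_convexHull ℝ _) (𝓣.interior_element_nonempty hT) x hxT).mono
    (𝓣.element_subset_closure hT)

lemma HasGradientWithinAt.gradientWithin_eq {f : Plane → ℝ} {g : Plane} {s : Set Plane}
    (h : HasGradientWithinAt f g s x) (hs : UniqueDiffWithinAt ℝ s x) :
    gradientWithin f s x = g := by
  have h1 : fderivWithin ℝ f s x = InnerProductSpace.toDual ℝ Plane g :=
    HasFDerivWithinAt.fderivWithin h hs
  rw [gradientWithin, h1, LinearIsometryEquiv.symm_apply_apply]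

lemma TriMesh.Represents.hasGradientAt (hq : 𝓣.Represents P q v) (hT : T ∈ 𝓣.elems)
    (hx : x ∈ interior (element T)) : HasGradientAt v (polyGrad (q T) x) x := by
  refine (hasGradientAt_poly (q T) x).congr_of_eventuallyEq ?_
  filter_upwards [isOpen_interior.mem_nhds hx] with y hy
  exact (hq T hT).2 y (interior_subset hy)

lemma TriMesh.Represents.gradient_eq (hq : 𝓣.Represents P q v) (hT : T ∈ 𝓣.elems)
    (hx : x ∈ interior (element T)) : gradient v x = polyGrad (q T) x :=
  (hq.hasGradientAt hT hx).gradient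

lemma TriMesh.Represents.hasGradientWithinAt (hq : 𝓣.Represents P q v) (hT : T ∈ 𝓣.elems)
    (hx : x ∈ element T) (h : ∀ S ∈ 𝓣.elems, x ∈ element S → S = T) :
    HasGradientWithinAt v (polyGrad (q T) x) (closure 𝓣.domain) x := by
  have h1 : HasGradientWithinAt (fun y : Plane => MvPolynomial.eval (fun i => y i) (q T))
      (polyGrad (q T) x) (closure 𝓣.domain) x :=
    HasFDerivAt.hasFDerivWithinAt (hasGradientAt_poly (q T) x)
  refine h1.congr_of_eventuallyEq ?_ ((hq T hT).2 x hx)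
  filter_upwards [mem_nhdsWithin_of_mem_nhds (𝓣.eventually_mem_closure_iff hT h),
    self_mem_nhdsWithin] with y hy hyc
  exact (hq T hT).2 y (hy.1 hyc)

lemma TriMesh.Represents.normalDeriv_eq (hq : 𝓣.Represents P q v) (hT : T ∈ 𝓣.elems) {i : Fin 3}
    (hx : InEdge (𝓣.vert T) i x) (h : ∀ S ∈ 𝓣.elems, x ∈ element S → S = T) :
    normalDeriv 𝓣.domain v x = inner ℝ (polyGrad (q T) x) (edgeNormal (𝓣.vert T) i) := by
  have hxT := TriMesh.InEdge.mem_element hT hx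
  rw [normalDeriv, 𝓣.outwardNormal_eq hT hx h,
    (hq.hasGradientWithinAt hT hxT h).gradientWithin_eq
      (𝓣.uniqueDiffOn_closure x (𝓣.element_subset_closure hT hxT))]

lemma TriMesh.isCompact_closure : IsCompact (closure 𝓣.domain) := by
  rw [𝓣.closure_domain]; exact 𝓣.isCompact_iUnion

/-- A function that is continuous on the closure of the domain is square integrable there. -/
lemma TriMesh.memLp_domain {E : Type*} [NormedAddCommGroup E] [SecondCountableTopology E]
    {f : Plane → E} (hf : ContinuousOn f (closure 𝓣.domain)) :
    MemLp f 2 (volume.restrict 𝓣.domain) := by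
  obtain ⟨C, hC⟩ := 𝓣.isCompact_closure.exists_bound_of_continuousOn hf
  exact MemLp.of_bound
    ((hf.mono subset_closure).aestronglyMeasurable 𝓣.isOpen_domain.measurableSet) C
    ((ae_restrict_iff' 𝓣.isOpen_domain.measurableSet).2
      (Eventually.of_forall fun x hx => hC x (subset_closure hx)))

lemma TriMesh.memLp_bdry {f : Plane → ℝ} (hf : ContinuousOn f (closure 𝓣.domain)) :
    MemLp f 2 (bdryMeasure 𝓣.domain) := by
  obtain ⟨C, hC⟩ := 𝓣.isCompact_closure.exists_bound_of_continuousOn hf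
  have hm : MeasurableSet (frontier 𝓣.domain) := isClosed_frontier.measurableSet
  exact MemLp.of_bound ((hf.mono frontier_subset_closure).aestronglyMeasurable hm) C
    ((ae_restrict_iff' hm).2 (Eventually.of_forall fun x hx => hC x (frontier_subset_closure hx)))

lemma memLp_indicator_of_compact {E : Type*} [NormedAddCommGroup E] [SecondCountableTopology E]
    [MeasurableSpace E] [BorelSpace E] {μ : Measure Plane} [IsFiniteMeasure μ] {f : Plane → E}
    (hf : Continuous f) {s K : Set Plane} (hs : MeasurableSet s) (hK : IsCompact K) (hsK : s ⊆ K) :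
    MemLp (s.indicator f) 2 μ := by
  obtain ⟨C, hC⟩ := hK.exists_bound_of_continuousOn hf.continuousOn
  refine MemLp.of_bound ((hf.measurable.indicator hs).aestronglyMeasurable) (max C 0)
    (Eventually.of_forall fun x => ?_)
  by_cases hx : x ∈ s
  · rw [Set.indicator_of_mem hx]; exact (hC x (hsK hx)).trans (le_max_left _ _)
  · rw [Set.indicator_of_notMem hx, norm_zero]; exact le_max_right _ _

/-- Almost everywhere the gradient equals a finite sum of bounded pieces supported on disjoint open
triangles, which supplies both measurability and integrability. -/
lemma TriMesh.Represents.memLp_gradient (hq : 𝓣.Represents P q v) :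
    MemLp (gradient v) 2 (volume.restrict 𝓣.domain) := by
  have h : MemLp (fun x => ∑ T ∈ 𝓣.elems, (interior (element T)).indicator (polyGrad (q T)) x) 2
      (volume.restrict 𝓣.domain) :=
    memLp_finsetSum _ fun T _ => memLp_indicator_of_compact (continuous_polyGrad _)
      isOpen_interior.measurableSet (isCompact_element T) interior_subset
  refine h.ae_eq (𝓣.ae_domain_iff fun T hT x hx => ?_)
  rw [hq.gradient_eq hT hx, Finset.sum_eq_single T, Set.indicator_of_mem hx]
  · intro S hS hST
    exact Set.indicator_of_notMem
      (fun hxS => hST (𝓣.eq_of_mem_interior hS hT hx (interior_subset hxS))) _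
  · exact fun h => absurd hT h

lemma TriMesh.Represents.memLp_normalDeriv (hq : 𝓣.Represents P q v) :
    MemLp (normalDeriv 𝓣.domain v) 2 (bdryMeasure 𝓣.domain) := by
  have h : MemLp (fun x => ∑ T ∈ 𝓣.elems, ∑ i, (edge (𝓣.vert T) i).indicator
      (fun x => inner ℝ (polyGrad (q T) x) (edgeNormal (𝓣.vert T) i)) x) 2
      (bdryMeasure 𝓣.domain) :=
    memLp_finsetSum _ fun T _ => memLp_finsetSum _ fun i _ =>
      memLp_indicator_of_compact ((continuous_polyGrad _).inner continuous_const)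
        (isCompact_edge _ i).measurableSet (isCompact_edge _ i) subset_rfl
  refine h.ae_eq (𝓣.ae_bdry_iff fun T hT i x _ hi hS => ?_)
  rw [hq.normalDeriv_eq hT hi hS]
  exact 𝓣.sum_indicator_eq hT hi hS fun S j x =>
    inner ℝ (polyGrad (q S) x) (edgeNormal (𝓣.vert S) j)

lemma TriMesh.memLp_of_mem (hv : v ∈ 𝓣.feSpace P) : MemLp v 2 (volume.restrict 𝓣.domain) :=
  𝓣.memLp_domain hv.1
lemma TriMesh.memLp_gradient (hv : v ∈ 𝓣.feSpace P) :
    MemLp (gradient v) 2 (volume.restrict 𝓣.domain) :=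
  (𝓣.exists_represents hv).choose_spec.memLp_gradient
lemma TriMesh.memLp_trace (hv : v ∈ 𝓣.feSpace P) : MemLp v 2 (bdryMeasure 𝓣.domain) :=
  𝓣.memLp_bdry hv.1
lemma TriMesh.memLp_normalDeriv (hv : v ∈ 𝓣.feSpace P) :
    MemLp (normalDeriv 𝓣.domain v) 2 (bdryMeasure 𝓣.domain) :=
  (𝓣.exists_represents hv).choose_spec.memLp_normalDeriv

lemma TriMesh.ae_hasGradientAt (hv : v ∈ 𝓣.feSpace P) :
    ∀ᵐ x ∂volume.restrict 𝓣.domain, HasGradientAt v (gradient v x) x := by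
  obtain ⟨q, hq⟩ := 𝓣.exists_represents hv
  refine 𝓣.ae_domain_iff fun T hT x hx => ?_
  rw [hq.gradient_eq hT hx]; exact hq.hasGradientAt hT hx

lemma TriMesh.ae_hasGradientWithinAt (hv : v ∈ 𝓣.feSpace P) :
    ∀ᵐ x ∂bdryMeasure 𝓣.domain,
      HasGradientWithinAt v (gradientWithin v (closure 𝓣.domain) x) (closure 𝓣.domain) x := by
  obtain ⟨q, hq⟩ := 𝓣.exists_represents hv
  refine 𝓣.ae_bdry_iff fun T hT i x _ hi hS => ?_
  exact (hq.hasGradientWithinAt hT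
    (TriMesh.InEdge.mem_element hT hi) hS).differentiableWithinAt.hasGradientWithinAt

lemma TriMesh.ae_mem_frontier : ∀ᵐ x ∂bdryMeasure 𝓣.domain, x ∈ frontier 𝓣.domain :=
  ae_restrict_mem isClosed_frontier.measurableSet

/-- Linearity holds only almost everywhere: where a function is not differentiable, as may happen on
mesh edges, `gradient` takes the default value zero. -/
lemma TriMesh.gradient_add (hu : u ∈ 𝓣.feSpace P) (hv : v ∈ 𝓣.feSpace P) :
    gradient (u + v) =ᵐ[volume.restrict 𝓣.domain] gradient u + gradient v := by
  filter_upwards [𝓣.ae_hasGradientAt hu, 𝓣.ae_hasGradientAt hv] with x h1 h2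
  refine HasGradientAt.gradient ?_
  rw [hasFDerivAt_iff_gradient] at *
  simpa using h1.add h2

lemma TriMesh.gradient_smul (a : ℝ) (hv : v ∈ 𝓣.feSpace P) :
    gradient (a • v) =ᵐ[volume.restrict 𝓣.domain] a • gradient v := by
  filter_upwards [𝓣.ae_hasGradientAt hv] with x h1
  refine HasGradientAt.gradient ?_
  rw [hasFDerivAt_iff_gradient] at *
  simpa using h1.const_smul a

lemma TriMesh.normalDeriv_add (hu : u ∈ 𝓣.feSpace P) (hv : v ∈ 𝓣.feSpace P) :
    normalDeriv 𝓣.domain (u + v) =ᵐ[bdryMeasure 𝓣.domain]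
      normalDeriv 𝓣.domain u + normalDeriv 𝓣.domain v := by
  filter_upwards [𝓣.ae_hasGradientWithinAt hu, 𝓣.ae_hasGradientWithinAt hv, 𝓣.ae_mem_frontier]
    with x h1 h2 hx
  have h : HasGradientWithinAt (u + v) (gradientWithin u (closure 𝓣.domain) x +
      gradientWithin v (closure 𝓣.domain) x) (closure 𝓣.domain) x := by
    have := HasFDerivWithinAt.add h1 h2
    rwa [← map_add] at this
  simp only [normalDeriv, Pi.add_apply]
  rw [h.gradientWithin_eq (𝓣.uniqueDiffOn_closure x (frontier_subset_closure hx)), inner_add_left]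

lemma TriMesh.normalDeriv_smul (a : ℝ) (hv : v ∈ 𝓣.feSpace P) :
    normalDeriv 𝓣.domain (a • v) =ᵐ[bdryMeasure 𝓣.domain] a • normalDeriv 𝓣.domain v := by
  filter_upwards [𝓣.ae_hasGradientWithinAt hv, 𝓣.ae_mem_frontier] with x h1 hx
  have h : HasGradientWithinAt (a • v) (a • gradientWithin v (closure 𝓣.domain) x)
      (closure 𝓣.domain) x := by
    have := HasFDerivWithinAt.const_smul h1 a
    have e : a • InnerProductSpace.toDual ℝ Plane (gradientWithin v (closure 𝓣.domain) x) =
        InnerProductSpace.toDual ℝ Plane (a • gradientWithin v (closure 𝓣.domain) x) := by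
      simp
    rwa [e] at this
  simp only [normalDeriv, Pi.smul_apply]
  rw [h.gradientWithin_eq (𝓣.uniqueDiffOn_closure x (frontier_subset_closure hx)),
    real_inner_smul_left, smul_eq_mul]

open Classical in
/-- The function with the given values of polynomials on the elements, one element being selected
for every point. -/
def TriMesh.glue (𝓣 : TriMesh) (P : ℕ) :
    (𝓣.elems → MvPolynomial.restrictTotalDegree (Fin 2) ℝ P) →ₗ[ℝ] Plane → ℝ where
  toFun q x := if h : ∃ T : 𝓣.elems, x ∈ element T then
    MvPolynomial.eval (fun i => x i) (q h.choose).1 else 0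
  map_add' q r := by
    ext x
    by_cases h : ∃ T : 𝓣.elems, x ∈ element T
    · simp only [Pi.add_apply, dif_pos h, Submodule.coe_add, map_add]
    · simp only [Pi.add_apply, dif_neg h, add_zero]
  map_smul' a q := by
    ext x
    by_cases h : ∃ T : 𝓣.elems, x ∈ element T
    · simp only [Pi.smul_apply, dif_pos h, Submodule.coe_smul, MvPolynomial.smul_eval, smul_eq_mul,
        RingHom.id_apply]
    · simp only [Pi.smul_apply, dif_neg h, smul_zero]

/-- The map `glue` is linear on tuples of polynomials because the element selected for a point does
not depend on the tuple. Its range is finite dimensional and contains the finite element space;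
vanishing outside the closure of Ω is essential here. -/
instance TriMesh.finiteDimensional_feSpace : FiniteDimensional ℝ (𝓣.feSpace P) := by
  have hle : 𝓣.feSpace P ≤ LinearMap.range (𝓣.glue P) := by
    intro v hv
    obtain ⟨q, hq⟩ := 𝓣.exists_represents hv
    refine ⟨fun T => ⟨q T, (MvPolynomial.mem_restrictTotalDegree _ _ _).2 (hq T T.2).1⟩, ?_⟩
    ext x
    by_cases h : ∃ T : 𝓣.elems, x ∈ element T
    · simp only [TriMesh.glue, LinearMap.coe_mk, AddHom.coe_mk, dif_pos h]
      exact ((hq _ h.choose.2).2 x h.choose_spec).symm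
    · simp only [TriMesh.glue, LinearMap.coe_mk, AddHom.coe_mk, dif_neg h]
      refine (hv.2.2 x fun hx => h ?_).symm
      rw [𝓣.closure_domain] at hx
      obtain ⟨T, hT, hxT⟩ := Set.mem_iUnion₂.1 hx
      exact ⟨⟨T, hT⟩, hxT⟩
  exact Submodule.finiteDimensional_of_le hle

/-- The interpretation of the finite element functions in `L²(Ω)`. -/
def TriMesh.toL2 (𝓣 : TriMesh) (P : ℕ) : 𝓣.feSpace P →ₗ[ℝ] Lp ℝ 2 (volume.restrict 𝓣.domain) where
  toFun v := (𝓣.memLp_of_mem v.2).toLp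
  map_add' _ _ := rfl
  map_smul' _ _ := rfl

/-- The gradient of the finite element functions in `L²(Ω)`. -/
def TriMesh.gradL2 (𝓣 : TriMesh) (P : ℕ) :
    𝓣.feSpace P →ₗ[ℝ] Lp Plane 2 (volume.restrict 𝓣.domain) where
  toFun v := (𝓣.memLp_gradient v.2).toLp
  map_add' u v := by
    rw [← MemLp.toLp_add]
    exact MemLp.toLp_congr _ _ (𝓣.gradient_add u.2 v.2)
  map_smul' a v := by
    rw [RingHom.id_apply, ← MemLp.toLp_const_smul]
    exact MemLp.toLp_congr _ _ (𝓣.gradient_smul a v.2)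

/-- The trace of the finite element functions in `L²(Γ)`. -/
def TriMesh.traceL2 (𝓣 : TriMesh) (P : ℕ) : 𝓣.feSpace P →ₗ[ℝ] Lp ℝ 2 (bdryMeasure 𝓣.domain) where
  toFun v := (𝓣.memLp_trace v.2).toLp
  map_add' _ _ := rfl
  map_smul' _ _ := rfl

/-- The normal derivative of the finite element functions in `L²(Γ)`. -/
def TriMesh.normalL2 (𝓣 : TriMesh) (P : ℕ) : 𝓣.feSpace P →ₗ[ℝ] Lp ℝ 2 (bdryMeasure 𝓣.domain) where
  toFun v := (𝓣.memLp_normalDeriv v.2).toLp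
  map_add' u v := by
    rw [← MemLp.toLp_add]
    exact MemLp.toLp_congr _ _ (𝓣.normalDeriv_add u.2 v.2)
  map_smul' a v := by
    rw [RingHom.id_apply, ← MemLp.toLp_const_smul]
    exact MemLp.toLp_congr _ _ (𝓣.normalDeriv_smul a v.2)

lemma inner_toLp {E : Type*} [NormedAddCommGroup E] [InnerProductSpace ℝ E] {μ : Measure Plane}
    {f g : Plane → E} (hf : MemLp f 2 μ) (hg : MemLp g 2 μ) :
    inner ℝ (hf.toLp f) (hg.toLp g) = ∫ x, inner ℝ (f x) (g x) ∂μ := by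
  rw [L2.inner_def]
  refine integral_congr_ae ?_
  filter_upwards [hf.coeFn_toLp, hg.coeFn_toLp] with x h1 h2
  rw [h1, h2]

lemma domPair_eq {Ω : Set Plane} {f g : Plane → ℝ} (hf : MemLp f 2 (volume.restrict Ω))
    (hg : MemLp g 2 (volume.restrict Ω)) :
    domPair Ω f g = inner ℝ (hf.toLp f) (hg.toLp g) := by
  rw [inner_toLp]; simp only [domPair]
  simp [mul_comm]

lemma bdryPair_eq {Ω : Set Plane} {f g : Plane → ℝ} (hf : MemLp f 2 (bdryMeasure Ω))
    (hg : MemLp g 2 (bdryMeasure Ω)) :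
    bdryPair Ω f g = inner ℝ (hf.toLp f) (hg.toLp g) := by
  rw [inner_toLp]; simp only [bdryPair]
  simp [mul_comm]

lemma gradPair_eq (u v : 𝓣.feSpace P) :
    gradPair 𝓣.domain u v = inner ℝ (𝓣.gradL2 P u) (𝓣.gradL2 P v) :=
  (inner_toLp (𝓣.memLp_gradient u.2) (𝓣.memLp_gradient v.2)).symm
end

/-! ### The Poincaré inequality, the trace inequality and coercivity. -/

noncomputable section

variable {𝓣 : TriMesh} {S T : Finset Plane} {x : Plane} {P : ℕ} {u v w : Plane → ℝ}
  {q : Finset Plane → MvPolynomial (Fin 2) ℝ}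

lemma integrable_inner_of_memLp {E : Type*} [NormedAddCommGroup E] [InnerProductSpace ℝ E]
    {μ : Measure Plane} {f g : Plane → E} (hf : MemLp f 2 μ) (hg : MemLp g 2 μ) :
    Integrable (fun x => inner ℝ (f x) (g x)) μ := by
  refine (L2.integrable_inner (𝕜 := ℝ) (hf.toLp f) (hg.toLp g)).congr ?_
  filter_upwards [hf.coeFn_toLp, hg.coeFn_toLp] with x h1 h2
  rw [h1, h2]

lemma integrable_mul_of_memLp {μ : Measure Plane} {f g : Plane → ℝ} (hf : MemLp f 2 μ)
    (hg : MemLp g 2 μ) : Integrable (fun x => f x * g x) μ := hf.integrable_mul hg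

lemma tr_add (L M : Plane →L[ℝ] Plane) : tr (L + M) = tr L + tr M := by simp [tr]; ring
lemma tr_smul (a : ℝ) (L : Plane →L[ℝ] Plane) : tr (a • L) = a * tr L := by simp [tr]; ring
lemma tr_id : tr (ContinuousLinearMap.id ℝ Plane) = 2 := by simp [tr]; norm_num
lemma tr_smulRight (l : Plane →L[ℝ] ℝ) (z : Plane) : tr (l.smulRight z) = l z := by
  conv_rhs => rw [plane_eq_single z, map_add, map_smul, map_smul]
  simp [tr, mul_comm]

lemma gradPair_self_nonneg (Ω : Set Plane) (v : Plane → ℝ) : 0 ≤ gradPair Ω v v :=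
  integral_nonneg fun _ => real_inner_self_nonneg
lemma domPair_self_nonneg (Ω : Set Plane) (v : Plane → ℝ) : 0 ≤ domPair Ω v v :=
  integral_nonneg fun _ => mul_self_nonneg _
lemma bdryPair_self_nonneg (Ω : Set Plane) (v : Plane → ℝ) : 0 ≤ bdryPair Ω v v :=
  integral_nonneg fun _ => mul_self_nonneg _

lemma norm_outwardNormal_le (Ω : Set Plane) (x : Plane) : ‖outwardNormal Ω x‖ ≤ 1 := by
  by_cases h : ∃ ν, IsOutwardNormal Ω x ν
  · obtain ⟨ν, hν⟩ := h
    rw [hν.outwardNormal_eq, hν.1]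
  · rw [outwardNormal, dif_neg h, norm_zero]; exact zero_le_one

lemma TriMesh.exists_center {D : ℝ} (hD : Metric.diam 𝓣.domain ≤ D) :
    ∃ x₀ : Plane, ∀ x ∈ closure 𝓣.domain, ‖x - x₀‖ ≤ D := by
  rcases (closure 𝓣.domain).eq_empty_or_nonempty with h | ⟨x₀, h₀⟩
  · exact ⟨0, fun x hx => by simp [h] at hx⟩
  · refine ⟨x₀, fun x hx => ?_⟩
    rw [← dist_eq_norm]
    refine (Metric.dist_le_diam_of_mem 𝓣.isCompact_closure.isBounded hx h₀).trans ?_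
    rwa [Metric.diam_closure]

/-- The Poincaré-Friedrichs inequality for finite element functions. -/
theorem TriMesh.poincare {D : ℝ} (hD : Metric.diam 𝓣.domain ≤ D) (hv : v ∈ 𝓣.feSpace P) :
    domPair 𝓣.domain v v ≤ D ^ 2 * gradPair 𝓣.domain v v + D * bdryPair 𝓣.domain v v := by
  obtain ⟨x₀, hx₀⟩ := 𝓣.exists_center hD
  obtain ⟨q, hq⟩ := 𝓣.exists_represents hv
  have hD0 : 0 ≤ D := Metric.diam_nonneg.trans hD
  -- In two dimensions this field has divergence 2v² + 2v ∇v·(x - x₀), which is at least v² -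
  -- D²|∇v|², while its flux is at most D v² on Γ.
  set F : Plane → Plane := fun x => (v x) ^ 2 • (x - x₀) with hF
  set F' : Plane → Plane →L[ℝ] Plane := fun x => (v x) ^ 2 • ContinuousLinearMap.id ℝ Plane +
    ((2 * v x) • innerSL ℝ (gradient v x)).smulRight (x - x₀) with hF'
  have htr : ∀ x, tr (F' x) = 2 * (v x * v x) + inner ℝ (gradient v x) ((2 * v x) • (x - x₀)) := by
    intro x
    rw [hF', tr_add, tr_smul, tr_id, tr_smulRight]
    simp; ring
  have hcv : ContinuousOn (fun x => (2 * v x) • (x - x₀)) (closure 𝓣.domain) :=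
    (continuousOn_const.mul hv.1).smul (continuousOn_id.sub continuousOn_const)
  have hvv := integrable_mul_of_memLp (𝓣.memLp_of_mem hv) (𝓣.memLp_of_mem hv)
  have hgg := integrable_inner_of_memLp (𝓣.memLp_gradient hv) (𝓣.memLp_gradient hv)
  have hI : IntegrableOn (fun x => tr (F' x)) 𝓣.domain := by
    simp only [htr]
    exact (hvv.const_mul 2).add
      (integrable_inner_of_memLp (𝓣.memLp_gradient hv) (𝓣.memLp_domain hcv))
  have hdiv := 𝓣.divergence (F := F) (F' := F')
    ((hv.1.pow 2).smul (continuousOn_id.sub continuousOn_const)) (fun T hT x hx => by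
      have h1 : HasFDerivAt v (innerSL ℝ (gradient v x)) x := by
        rw [hq.gradient_eq hT hx]; exact hq.hasGradientAt hT hx
      have h2 := (h1.pow 2).smul ((hasFDerivAt_id x).sub_const x₀)
      refine h2.congr_fderiv ?_
      ext1 y
      simp [hF']) hI
  have hle1 : domPair 𝓣.domain v v - D ^ 2 * gradPair 𝓣.domain v v ≤
      ∫ x in 𝓣.domain, tr (F' x) := by
    rw [domPair, gradPair, ← integral_const_mul, ← integral_sub hvv (hgg.const_mul _)]
    refine setIntegral_mono_on (hvv.sub (hgg.const_mul _)) hI 𝓣.isOpen_domain.measurableSet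
      fun x hx => ?_
    rw [htr, real_inner_self_eq_norm_sq, real_inner_smul_right]
    have h1 := abs_real_inner_le_norm (gradient v x) (x - x₀)
    have h2 := hx₀ x (subset_closure hx)
    have h3 : |inner ℝ (gradient v x) (x - x₀)| ≤ ‖gradient v x‖ * D :=
      h1.trans (mul_le_mul_of_nonneg_left h2 (norm_nonneg _))
    have h4 : inner ℝ (gradient v x) (x - x₀) ^ 2 ≤ (‖gradient v x‖ * D) ^ 2 :=
      sq_le_sq' (abs_le.1 h3).1 (abs_le.1 h3).2
    nlinarith [sq_nonneg (v x + inner ℝ (gradient v x) (x - x₀))]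
  have hle2 : ∫ x, inner ℝ (F x) (outwardNormal 𝓣.domain x) ∂bdryMeasure 𝓣.domain ≤
      D * bdryPair 𝓣.domain v v := by
    rw [bdryPair, ← integral_const_mul]
    refine (Real.le_norm_self _).trans (norm_integral_le_of_norm_le
      ((integrable_mul_of_memLp (𝓣.memLp_trace hv) (𝓣.memLp_trace hv)).const_mul D) ?_)
    filter_upwards [𝓣.ae_mem_frontier] with x hx
    refine (norm_inner_le_norm _ _).trans ?_
    have h2 := hx₀ x (frontier_subset_closure hx)
    have h3 := norm_outwardNormal_le 𝓣.domain x
    calc ‖F x‖ * ‖outwardNormal 𝓣.domain x‖ ≤ ‖F x‖ * 1 :=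
          mul_le_mul_of_nonneg_left h3 (norm_nonneg _)
      _ = v x ^ 2 * ‖x - x₀‖ := by rw [mul_one, hF, norm_smul, Real.norm_of_nonneg (sq_nonneg _)]
      _ ≤ v x ^ 2 * D := mul_le_mul_of_nonneg_left h2 (sq_nonneg _)
      _ = D * (v x * v x) := by ring
  linarith

lemma TriMesh.Represents.gradPair_self (hq : 𝓣.Represents P q v) :
    gradPair 𝓣.domain v v = ∑ T ∈ 𝓣.elems, ∫ x in element T, ‖polyGrad (q T) x‖ ^ 2 := by
  rw [gradPair, 𝓣.setIntegral_domain (integrable_inner_of_memLp hq.memLp_gradient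
    hq.memLp_gradient)]
  refine Finset.sum_congr rfl fun T hT => ?_
  rw [← setIntegral_congr_set (element_ae_eq_interior T),
    ← setIntegral_congr_set (element_ae_eq_interior T)]
  refine setIntegral_congr_fun isOpen_interior.measurableSet fun x hx => ?_
  simp only [hq.gradient_eq hT hx, real_inner_self_eq_norm_sq]

lemma norm_edgeDir_le_diam (hT : T ∈ 𝓣.elems) (i : Fin 3) :
    ‖edgeDir (𝓣.vert T) i‖ ≤ Metric.diam (element T) := by
  rw [edgeDir, ← dist_eq_norm]
  have h : ∀ j, 𝓣.vert T j ∈ element T := fun j => by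
    rw [𝓣.element_eq hT]; exact subset_convexHull ℝ _ ⟨j, rfl⟩
  exact Metric.dist_le_diam_of_mem (isCompact_element T).isBounded (h _) (h _)

/-- The discrete trace inequality for the normal derivative. -/
theorem TriMesh.trace_inequality {C Cγ γ σ : ℝ}
    (hC0 : 0 ≤ C) (hC : ∀ r : Polynomial ℝ, r.natDegree ≤ P →
      r.eval 1 ^ 2 ≤ C * ∫ s in (0 : ℝ)..1, s * r.eval s ^ 2)
    (hσ0 : 0 ≤ σ) (hσ : 𝓣.ShapeRegular σ) (hCγ : 0 ≤ Cγ)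
    (hγ : ∀ T ∈ 𝓣.elems, (element T ∩ frontier 𝓣.domain).Nonempty →
      γ ≤ Cγ * Metric.diam (element T)) (hγ0 : 0 ≤ γ) (hv : v ∈ 𝓣.feSpace P) :
    γ * bdryPair 𝓣.domain (normalDeriv 𝓣.domain v) (normalDeriv 𝓣.domain v) ≤
      3 * Cγ * C * σ * gradPair 𝓣.domain v v := by
  classical
  obtain ⟨q, hq⟩ := 𝓣.exists_represents hv
  -- Only elements that meet Γ contribute, and only for these is γ controlled by the diameter.
  set E := 𝓣.elems.filter fun T => (element T ∩ frontier 𝓣.domain).Nonempty with hE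
  set f : Finset Plane → Fin 3 → Plane → ℝ := fun T i =>
    (edge (𝓣.vert T) i).indicator fun x => ‖polyGrad (q T) x‖ ^ 2 with hf
  have hf0 : ∀ T i x, 0 ≤ f T i x := fun T i x => Set.indicator_nonneg (fun _ _ => sq_nonneg _) x
  have hfi : ∀ T i, Integrable (f T i) (Measure.hausdorffMeasure 1 : Measure Plane) := by
    intro T i
    rw [integrable_indicator_iff (isCompact_edge _ i).measurableSet]
    exact integrableOn_of_compact (isCompact_edge _ i) (hausdorffMeasure_edge_lt_top _ i)
      ((continuous_polyGrad _).norm.pow 2).continuousOn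
  have hsi : Integrable (fun x => ∑ T ∈ E, ∑ i, f T i x)
      (Measure.hausdorffMeasure 1 : Measure Plane) :=
    integrable_finsetSum _ fun T _ => integrable_finsetSum _ fun i _ => hfi T i
  have h1 : bdryPair 𝓣.domain (normalDeriv 𝓣.domain v) (normalDeriv 𝓣.domain v) ≤
      ∑ T ∈ E, ∑ i, ∫ x, f T i x ∂(Measure.hausdorffMeasure 1 : Measure Plane) := by
    have e : ∑ T ∈ E, ∑ i, ∫ x, f T i x ∂(Measure.hausdorffMeasure 1 : Measure Plane) =
        ∫ x, ∑ T ∈ E, ∑ i, f T i x ∂(Measure.hausdorffMeasure 1 : Measure Plane) := by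
      rw [integral_finsetSum _ fun T _ => integrable_finsetSum _ fun i _ => hfi T i]
      exact Finset.sum_congr rfl fun T _ => (integral_finsetSum _ fun i _ => hfi T i).symm
    rw [e]
    refine le_trans ?_ (setIntegral_le_integral (s := frontier 𝓣.domain) hsi
      (Eventually.of_forall fun x =>
        Finset.sum_nonneg fun T _ => Finset.sum_nonneg fun i _ => hf0 T i x))
    refine integral_mono_ae (integrable_mul_of_memLp (𝓣.memLp_normalDeriv hv)
      (𝓣.memLp_normalDeriv hv)) hsi.restrict (𝓣.ae_bdry_iff fun T hT i x hx hi hS => ?_)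
    have hTE : T ∈ E := Finset.mem_filter.2 ⟨hT, x, TriMesh.InEdge.mem_element hT hi, hx⟩
    have e1 : f T i x = ‖polyGrad (q T) x‖ ^ 2 := Set.indicator_of_mem (hi.mem_edge hT) _
    have e2 : f T i x ≤ ∑ T ∈ E, ∑ i, f T i x :=
      (Finset.single_le_sum (f := fun i => f T i x) (fun i _ => hf0 T i x)
        (Finset.mem_univ i)).trans
        (Finset.single_le_sum (f := fun T => ∑ i, f T i x)
          (fun T _ => Finset.sum_nonneg fun i _ => hf0 T i x) hTE)
    refine le_trans ?_ e2
    rw [e1]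
    change normalDeriv 𝓣.domain v x * normalDeriv 𝓣.domain v x ≤ _
    rw [hq.normalDeriv_eq hT hi hS]
    have e3 := abs_real_inner_le_norm (polyGrad (q T) x) (edgeNormal (𝓣.vert T) i)
    rw [norm_edgeNormal (𝓣.area2_vert hT), mul_one] at e3
    rw [← sq]
    exact sq_le_sq' (abs_le.1 e3).1 (abs_le.1 e3).2
  have h2 : ∀ T ∈ E, ∀ i, γ * ∫ x, f T i x ∂(Measure.hausdorffMeasure 1 : Measure Plane) ≤
      Cγ * C * σ * ∫ x in element T, ‖polyGrad (q T) x‖ ^ 2 := by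
    intro T hTE i
    obtain ⟨hT, hTΓ⟩ := Finset.mem_filter.1 hTE
    have ha := 𝓣.area2_vert hT
    have e1 := edge_integral_polyGrad_le hC ha i (hq T hT).1
    rw [← 𝓣.element_eq hT, ← integral_indicator (isCompact_edge _ i).measurableSet] at e1
    have e2 := norm_edgeDir_le_diam hT i
    have e3 := hσ T hT
    have e4 := volume_le_area2 ha
    rw [← 𝓣.element_eq hT] at e4
    have e5 := hγ T hT hTΓ
    set h := Metric.diam (element T) with hh
    have hh0 : 0 ≤ h := Metric.diam_nonneg
    set G := ∫ x in element T, ‖polyGrad (q T) x‖ ^ 2 with hG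
    have hG0 : 0 ≤ G := integral_nonneg fun _ => sq_nonneg _
    have e6 : h ^ 2 ≤ σ * area2 (𝓣.vert T) := e3.trans (mul_le_mul_of_nonneg_left e4 hσ0)
    calc γ * ∫ x, f T i x ∂(Measure.hausdorffMeasure 1 : Measure Plane)
        ≤ (Cγ * h) * (‖edgeDir (𝓣.vert T) i‖ * (C / area2 (𝓣.vert T)) * G) := by
          refine mul_le_mul e5 e1 (integral_nonneg fun x => hf0 T i x) (by positivity)
      _ ≤ (Cγ * h) * (h * (C / area2 (𝓣.vert T)) * G) := by gcongr
      -- One factor `h` comes from the bound on γ, the other from the edge length; shape regularity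
      -- absorbs the product. The final factor 3 counts the edges.
      _ = Cγ * C * G * (h ^ 2 / area2 (𝓣.vert T)) := by ring
      _ ≤ Cγ * C * G * σ := by
          refine mul_le_mul_of_nonneg_left ?_ (by positivity)
          rwa [div_le_iff₀ ha]
      _ = Cγ * C * σ * G := by ring
  calc _ ≤ γ * ∑ T ∈ E, ∑ i, ∫ x, f T i x ∂(Measure.hausdorffMeasure 1 : Measure Plane) :=
        mul_le_mul_of_nonneg_left h1 hγ0
    _ = ∑ T ∈ E, ∑ i, γ * ∫ x, f T i x ∂(Measure.hausdorffMeasure 1 : Measure Plane) := by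
        simp only [Finset.mul_sum]
    _ ≤ ∑ T ∈ E, ∑ i : Fin 3, Cγ * C * σ * ∫ x in element T, ‖polyGrad (q T) x‖ ^ 2 :=
        Finset.sum_le_sum fun T hT => Finset.sum_le_sum fun i _ => h2 T hT i
    _ ≤ ∑ T ∈ 𝓣.elems, ∑ i : Fin 3, Cγ * C * σ * ∫ x in element T, ‖polyGrad (q T) x‖ ^ 2 :=
        Finset.sum_le_sum_of_subset_of_nonneg (Finset.filter_subset _ _) fun T _ _ =>
          Finset.sum_nonneg fun i _ => mul_nonneg (by positivity)
            (integral_nonneg fun _ => sq_nonneg _)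
    _ = _ := by
        rw [hq.gradPair_self, Finset.mul_sum]
        refine Finset.sum_congr rfl fun T _ => ?_
        simp; ring

/-- On the diagonal the consistency term and the gradient part of `formN` coincide, hence the factor
2. -/
lemma nitscheForm_self {α γ : ℝ} (hv : v ∈ 𝓣.feSpace P) :
    nitscheForm 𝓣.domain α γ v v = gradPair 𝓣.domain v v + α * domPair 𝓣.domain v v
      - 2 * bdryPair 𝓣.domain (normalDeriv 𝓣.domain v) v + γ⁻¹ * bdryPair 𝓣.domain v v := by
  have h1 := integrable_mul_of_memLp (𝓣.memLp_trace hv) (𝓣.memLp_trace hv)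
  have h2 := integrable_mul_of_memLp (𝓣.memLp_normalDeriv hv) (𝓣.memLp_trace hv)
  have e : formN 𝓣.domain γ v v = γ⁻¹ * bdryPair 𝓣.domain v v
      - bdryPair 𝓣.domain (normalDeriv 𝓣.domain v) v := by
    rw [formN, bdryPair, bdryPair, bdryPair, ← integral_const_mul,
      ← integral_sub (h1.const_mul _) h2]
    congr 1; ext x; ring
  rw [nitscheForm, e, formI]; ring

/-- Young's inequality 2ab ≤ 2γa² + b²/(2γ), weighted so that half of the penalty term survives. -/
lemma two_bdryPair_le {γ : ℝ} (hγ : 0 < γ) (hv : v ∈ 𝓣.feSpace P) :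
    2 * bdryPair 𝓣.domain (normalDeriv 𝓣.domain v) v ≤
      2 * (γ * bdryPair 𝓣.domain (normalDeriv 𝓣.domain v) (normalDeriv 𝓣.domain v))
        + γ⁻¹ / 2 * bdryPair 𝓣.domain v v := by
  have h1 := integrable_mul_of_memLp (𝓣.memLp_trace hv) (𝓣.memLp_trace hv)
  have h2 := integrable_mul_of_memLp (𝓣.memLp_normalDeriv hv) (𝓣.memLp_trace hv)
  have h3 := integrable_mul_of_memLp (𝓣.memLp_normalDeriv hv) (𝓣.memLp_normalDeriv hv)
  simp only [bdryPair]
  rw [← integral_const_mul, ← integral_const_mul, ← integral_const_mul, ← integral_const_mul,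
    ← integral_add ((h3.const_mul _).const_mul _) (h1.const_mul _)]
  refine integral_mono (h2.const_mul _) (((h3.const_mul _).const_mul _).add (h1.const_mul _))
    fun x => ?_
  change 2 * (_ * _) ≤ 2 * (γ * (_ * _)) + γ⁻¹ / 2 * (_ * _)
  set a := normalDeriv 𝓣.domain v x
  set b := v x
  have h4 : 2 * (γ * (a * a)) + γ⁻¹ / 2 * (b * b) - 2 * (a * b) = γ⁻¹ / 2 * (2 * γ * a - b) ^ 2 := by
    field_simp; ring
  have : 0 ≤ γ⁻¹ / 2 * (2 * γ * a - b) ^ 2 := by positivity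
  linarith

/-- Coercivity of the Nitsche form, uniformly in the mesh size. -/
theorem exists_coercive (P : ℕ) (σ : ℝ) : ∃ Cγ > 0, ∀ D : ℝ, ∃ c > 0, ∀ 𝓣 : TriMesh,
    𝓣.ShapeRegular σ → Metric.diam 𝓣.domain ≤ D → ∀ α γ : ℝ, 0 ≤ α → 0 < γ →
    (∀ T ∈ 𝓣.elems, (element T ∩ frontier 𝓣.domain).Nonempty →
      γ ≤ Cγ * Metric.diam (element T)) →
    ∀ v ∈ 𝓣.feSpace P,
      c * (gradPair 𝓣.domain v v + domPair 𝓣.domain v v + γ⁻¹ * bdryPair 𝓣.domain v v)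
        ≤ nitscheForm 𝓣.domain α γ v v := by
  obtain ⟨C, hC0, hC⟩ := exists_eval_one_sq_le P
  -- Enlarging `σ` makes the constants positive without a sign condition on it.
  set σ' := max σ 1 with hσ'
  have hσ0 : 0 < σ' := lt_max_of_lt_right one_pos
  -- Chosen so that the trace constant `3 * Cγ * C * σ'` is 1/4; Young's inequality doubles it, and
  -- half of the gradient term survives.
  refine ⟨1 / (12 * C * σ'), by positivity, fun D => ?_⟩
  set Cγ := 1 / (12 * C * σ') with hCγ
  have hCγ0 : 0 < Cγ := by positivity
  -- The 2 reflects the surviving halves of gradient and penalty; the bracket bounds the full norm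
  -- by their sum after the Poincaré inequality.
  refine ⟨1 / (2 * (1 + D ^ 2 + Cγ * D ^ 2)), by positivity, ?_⟩
  intro 𝓣 hσ hD α γ hα hγ hγT v hv
  have hD0 : 0 ≤ D := Metric.diam_nonneg.trans hD
  have hσ1 : 𝓣.ShapeRegular σ' := fun T hT =>
    (hσ T hT).trans (mul_le_mul_of_nonneg_right (le_max_left _ _) measureReal_nonneg)
  have h1 := 𝓣.trace_inequality hC0.le hC hσ0.le hσ1 hCγ0.le hγT hγ.le hv
  have h2 := two_bdryPair_le hγ hv
  have h3 := 𝓣.poincare hD hv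
  have h4 := gradPair_self_nonneg 𝓣.domain v
  have h5 := bdryPair_self_nonneg 𝓣.domain v
  have h6 := domPair_self_nonneg 𝓣.domain v
  have e1 : 3 * Cγ * C * σ' = 1 / 4 := by rw [hCγ]; field_simp; norm_num
  rw [e1] at h1
  -- If Γ is nonempty, some element meets it, so γ is at most Cγ D. This turns the boundary term of
  -- the Poincaré inequality into a penalty term.
  have h7 : bdryPair 𝓣.domain v v ≤ Cγ * D * (γ⁻¹ * bdryPair 𝓣.domain v v) := by
    rcases (frontier 𝓣.domain).eq_empty_or_nonempty with h | ⟨x, hx⟩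
    · simp [bdryPair, bdryMeasure, h]
    · have hc : x ∈ closure 𝓣.domain := frontier_subset_closure hx
      rw [𝓣.closure_domain] at hc
      obtain ⟨T, hT, hxT⟩ := Set.mem_iUnion₂.1 hc
      have e2 : Metric.diam (element T) ≤ D := by
        refine le_trans ?_ hD
        rw [← Metric.diam_closure (s := 𝓣.domain)]
        exact Metric.diam_mono (𝓣.element_subset_closure hT) 𝓣.isCompact_closure.isBounded
      have e3 : γ ≤ Cγ * D := (hγT T hT ⟨x, hxT, hx⟩).trans (mul_le_mul_of_nonneg_left e2 hCγ0.le)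
      have e4 : 1 ≤ Cγ * D * γ⁻¹ := by rw [← div_eq_mul_inv, one_le_div hγ]; exact e3
      nlinarith
  rw [nitscheForm_self hv]
  set B := γ⁻¹ * bdryPair 𝓣.domain v v with hB
  have hB0 : 0 ≤ B := by positivity
  have h8 : γ⁻¹ / 2 * bdryPair 𝓣.domain v v = B / 2 := by rw [hB]; ring
  rw [h8] at h2
  have h9 : domPair 𝓣.domain v v ≤ D ^ 2 * gradPair 𝓣.domain v v + Cγ * D ^ 2 * B := by
    nlinarith [mul_le_mul_of_nonneg_left h7 hD0]
  have h10 := mul_nonneg hα h6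
  rw [div_mul_eq_mul_div, one_mul, div_le_iff₀ (by positivity)]
  have hK : 0 ≤ D ^ 2 + Cγ * D ^ 2 := by positivity
  have h11 : gradPair 𝓣.domain v v / 2 + B / 2 ≤
      gradPair 𝓣.domain v v + α * domPair 𝓣.domain v v
        - 2 * bdryPair 𝓣.domain (normalDeriv 𝓣.domain v) v + B := by linarith
  refine le_trans ?_ (mul_le_mul_of_nonneg_right h11 (by positivity))
  nlinarith [mul_nonneg (sq_nonneg D) hB0, mul_nonneg (mul_nonneg hCγ0.le (sq_nonneg D)) h4]
end

/-! ### Green's formula for classical solutions. -/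

noncomputable section

variable {𝓣 : TriMesh} {T : Finset Plane} {x : Plane} {P : ℕ} {u v w : Plane → ℝ}

lemma gradient_eq_sum (w : Plane → ℝ) (y : Plane) :
    gradient w y = fderiv ℝ w y (EuclideanSpace.single 0 1) • EuclideanSpace.single (0 : Fin 2) (1 : ℝ)
      + fderiv ℝ w y (EuclideanSpace.single 1 1) • EuclideanSpace.single (1 : Fin 2) (1 : ℝ) := by
  have h : ∀ i : Fin 2, gradient w y i = fderiv ℝ w y (EuclideanSpace.single i 1) := by
    intro i
    rw [← InnerProductSpace.toDual_symm_apply]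
    change _ = inner ℝ (gradient w y) _
    rw [plane_inner]
    fin_cases i <;> simp
  conv_lhs => rw [plane_eq_single (gradient w y)]
  rw [h, h]

/-- The derivative of the gradient. -/
def hessian (w : Plane → ℝ) (x : Plane) : Plane →L[ℝ] Plane :=
  ((fderiv ℝ (fderiv ℝ w) x).flip (EuclideanSpace.single 0 1)).smulRight
      (EuclideanSpace.single (0 : Fin 2) (1 : ℝ))
    + ((fderiv ℝ (fderiv ℝ w) x).flip (EuclideanSpace.single 1 1)).smulRight
      (EuclideanSpace.single (1 : Fin 2) (1 : ℝ))

lemma hasFDerivAt_gradient (h : ContDiffAt ℝ 2 w x) :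
    HasFDerivAt (gradient w) (hessian w x) x := by
  have h1 : HasFDerivAt (fderiv ℝ w) (fderiv ℝ (fderiv ℝ w) x) x :=
    ((h.fderiv_right (m := 1) (by norm_num)).differentiableAt one_ne_zero).hasFDerivAt
  have h2 : ∀ e : Plane, HasFDerivAt (fun y => fderiv ℝ w y e)
      ((fderiv ℝ (fderiv ℝ w) x).flip e) x := fun e => by
    simpa using h1.clm_apply (hasFDerivAt_const e x)
  rw [funext (gradient_eq_sum w)]
  exact ((h2 _).smul_const _).add ((h2 _).smul_const _)

lemma tr_hessian (w : Plane → ℝ) (x : Plane) : tr (hessian w x) = Laplacian.laplacian w x := by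
  rw [InnerProductSpace.laplacian_eq_iteratedFDeriv_orthonormalBasis w
    (EuclideanSpace.basisFun (Fin 2) ℝ), hessian, tr_add, tr_smulRight, tr_smulRight]
  simp [Fin.sum_univ_two, iteratedFDeriv_two_apply]

/-- Green's formula for a classical solution, tested with a finite element function. -/
theorem TriMesh.green {α : ℝ} {f : Plane → ℝ} (hw1 : ContDiffOn ℝ 1 w (closure 𝓣.domain))
    (hw2 : ContDiffOn ℝ 2 w 𝓣.domain) (hf : MemLp f 2 (volume.restrict 𝓣.domain))
    (heq : ∀ x ∈ 𝓣.domain, -Laplacian.laplacian w x + α * w x = f x) (hv : v ∈ 𝓣.feSpace P) :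
    formI 𝓣.domain α w v - domPair 𝓣.domain f v
      - bdryPair 𝓣.domain (normalDeriv 𝓣.domain w) v = 0 := by
  obtain ⟨q, hq⟩ := 𝓣.exists_represents hv
  -- The gradient taken from inside is continuous up to Γ and agrees with the ordinary gradient in
  -- Ω.
  set G : Plane → Plane := gradientWithin w (closure 𝓣.domain) with hG
  have hGc : ContinuousOn G (closure 𝓣.domain) :=
    (InnerProductSpace.toDual ℝ Plane).symm.continuous.comp_continuousOn
      (hw1.continuousOn_fderivWithin 𝓣.uniqueDiffOn_closure le_rfl)
  have hGe : ∀ x ∈ 𝓣.domain, G x = gradient w x := by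
    intro x hx
    rw [hG, gradientWithin, gradient, fderivWithin_of_mem_nhds
      (mem_of_superset (𝓣.isOpen_domain.mem_nhds hx) subset_closure)]
  have hGd : ∀ x ∈ 𝓣.domain, HasFDerivAt G (hessian w x) x := by
    intro x hx
    refine (hasFDerivAt_gradient (hw2.contDiffAt (𝓣.isOpen_domain.mem_nhds hx))).congr_of_eventuallyEq ?_
    filter_upwards [𝓣.isOpen_domain.mem_nhds hx] with y hy using hGe y hy
  have hw : MemLp w 2 (volume.restrict 𝓣.domain) := 𝓣.memLp_domain hw1.continuousOn
  have hgw : MemLp (gradient w) 2 (volume.restrict 𝓣.domain) :=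
    (𝓣.memLp_domain hGc).ae_eq ((ae_restrict_iff' 𝓣.isOpen_domain.measurableSet).2
      (Eventually.of_forall hGe))
  set F : Plane → Plane := fun x => v x • G x with hF
  set F' : Plane → Plane →L[ℝ] Plane := fun x => v x • hessian w x +
    (innerSL ℝ (gradient v x)).smulRight (G x) with hF'
  have htr : ∀ x ∈ 𝓣.domain, tr (F' x) =
      inner ℝ (gradient w x) (gradient v x) + (α * (w x * v x) - f x * v x) := by
    intro x hx
    rw [hF', tr_add, tr_smul, tr_smulRight, tr_hessian, hGe x hx, innerSL_apply_apply,
      real_inner_comm, ← heq x hx]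
    ring
  have i1 := integrable_inner_of_memLp hgw (𝓣.memLp_gradient hv)
  have i2 := integrable_mul_of_memLp hw (𝓣.memLp_of_mem hv)
  have i3 := integrable_mul_of_memLp hf (𝓣.memLp_of_mem hv)
  -- Second derivatives of `w` may be unbounded near Γ. The divergence is integrable because the
  -- equation replaces the Laplacian by α w - f.
  have hI : IntegrableOn (fun x => tr (F' x)) 𝓣.domain :=
    (integrableOn_congr_fun htr 𝓣.isOpen_domain.measurableSet).2
      (i1.add ((i2.const_mul α).sub i3))
  have hdiv := 𝓣.divergence (F := F) (F' := F') (hv.1.smul hGc) (fun T hT x hx => by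
      have h1 : HasFDerivAt v (innerSL ℝ (gradient v x)) x := by
        rw [hq.gradient_eq hT hx]; exact hq.hasGradientAt hT hx
      exact h1.smul (hGd x (𝓣.interior_element_subset hT hx))) hI
  rw [setIntegral_congr_fun 𝓣.isOpen_domain.measurableSet htr,
    integral_add (f := fun x => inner ℝ (gradient w x) (gradient v x))
      (g := fun x => α * (w x * v x) - f x * v x) i1 ((i2.const_mul α).sub i3), integral_sub (i2.const_mul α) i3,
    integral_const_mul] at hdiv
  have hb : ∫ x, inner ℝ (F x) (outwardNormal 𝓣.domain x) ∂bdryMeasure 𝓣.domain =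
      bdryPair 𝓣.domain (normalDeriv 𝓣.domain w) v := by
    rw [bdryPair]
    congr 1; ext x
    rw [hF, real_inner_smul_left, normalDeriv]; ring
  rw [hb] at hdiv
  rw [formI, gradPair, domPair, domPair, ← hdiv]
  ring
end

/-! ### Asymptotic expansions in a finite-dimensional space. -/

noncomputable section

/-- A polynomial of degree at most `M` that is `o(ε ^ M)` at `0+` vanishes. -/
lemma coeff_eq_zero_of_isLittleO (c : ℕ → ℝ) (M : ℕ)
    (h : (fun ε : ℝ => ∑ k ∈ Finset.range (M + 1), ε ^ k * c k) =o[𝓝[>] 0] fun ε => ε ^ M) :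
    ∀ k ≤ M, c k = 0 := by
  have top : ∀ m : ℕ, ((fun ε : ℝ => ε ^ m * c m) =o[𝓝[>] 0] fun ε => ε ^ m) → c m = 0 := by
    intro m hm
    by_contra hne
    have h1 : (fun ε : ℝ => ε ^ m) =o[𝓝[>] 0] fun ε : ℝ => ε ^ m := by
      have := hm.const_mul_left (c m)⁻¹
      refine this.congr_left fun ε => ?_
      field_simp
    obtain ⟨ε, h2, h3⟩ := ((h1.bound (c := 1 / 2) (by norm_num)).and self_mem_nhdsWithin).exists
    have h4 : 0 < ‖ε ^ m‖ := norm_pos_iff.2 (pow_ne_zero _ (ne_of_gt h3))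
    linarith
  induction M with
  | zero =>
    intro k hk
    obtain rfl := Nat.le_zero.1 hk
    exact top 0 (by simpa using h)
  | succ M ih =>
    have hO : (fun ε : ℝ => ε ^ (M + 1)) =o[𝓝[>] 0] fun ε : ℝ => ε ^ M :=
      (isLittleO_pow_pow (𝕜 := ℝ) (Nat.lt_succ_self M)).mono nhdsWithin_le_nhds
    have h0 : ∀ k ≤ M, c k = 0 := by
      -- The top term is itself `o(ε ^ M)`, so it may be dropped to apply the induction hypothesis;
      -- once the lower coefficients vanish, the top one is isolated.
      refine ih ?_
      have := (h.trans hO).sub (hO.const_mul_left (c (M + 1)))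
      refine this.congr_left fun ε => ?_
      rw [Finset.sum_range_succ _ (M + 1)]; ring
    intro k hk
    rcases Nat.le_succ_iff.1 hk with hk | rfl
    · exact h0 k hk
    · refine top _ (h.congr_left fun ε => ?_)
      rw [Finset.sum_range_succ, Finset.sum_eq_zero, zero_add]
      intro k hk
      rw [h0 k (Nat.lt_succ_iff.1 (Finset.mem_range.1 hk)), mul_zero]

/-- The recursion between the residuals of the modes gives the error terms. -/
lemma residual_eq_error {γ : ℝ} (hγ : γ ≠ 0) (a n : ℕ → ℝ) (M : ℕ) (h0 : a 0 + n 0 = 0)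
    (h : ∀ k < M, γ * (a (k + 1) + n (k + 1)) = -a k) :
    ∀ m ≤ M, a m + n m =
      -∑ l ∈ Finset.range m, (-γ) ^ (-((m : ℤ) - (l : ℤ))) * n l := by
  intro m
  induction m with
  | zero => intro _; simpa using h0
  | succ m ih =>
    intro hm
    have h1 := ih (by omega)
    have h2 := h m (by omega)
    -- With `a m = (a m + n m) - n m`, division by `-γ` shifts the exponents in the old sum and
    -- creates the new term `l = m`.
    have h3 : ∀ l : ℕ, (-γ) ^ (-(((m + 1 : ℕ) : ℤ) - (l : ℤ))) =
        (-γ)⁻¹ * (-γ) ^ (-((m : ℤ) - (l : ℤ))) := by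
      intro l
      rw [← zpow_neg_one, ← zpow_add₀ (neg_ne_zero.2 hγ)]
      congr 1; push_cast; ring
    rw [Finset.sum_range_succ]
    simp only [h3, mul_assoc]
    rw [← Finset.mul_sum]
    have h4 : ∑ l ∈ Finset.range m, (-γ) ^ (-((m : ℤ) - (l : ℤ))) * n l = -(a m + n m) := by
      rw [h1, neg_neg]
    rw [h4]
    have h5 : a (m + 1) + n (m + 1) = -a m / γ := by
      rw [← h2, mul_div_cancel_left₀ _ hγ]
    rw [h5]
    simp
    field_simp
    ring

/-- Functionals that are spanned by a separating family inherit pointwise asymptotics. -/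
lemma isLittleO_of_separating {V : Type*} [AddCommGroup V] [Module ℝ V] [FiniteDimensional ℝ V]
    {S : Set (Module.Dual ℝ V)} (hS : ∀ v : V, v ≠ 0 → ∃ l ∈ S, l v ≠ 0) {r : ℝ → V}
    {F : Filter ℝ} {g : ℝ → ℝ} (h : ∀ l ∈ S, (fun ε => l (r ε)) =o[F] g) (l : Module.Dual ℝ V) :
    (fun ε => l (r ε)) =o[F] g := by
  have hl : l ∈ Submodule.span ℝ S := by
    rw [Submodule.span_eq_top_of_ne_zero hS]; trivial
  induction hl using Submodule.span_induction with
  | mem l hl => exact h l hl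
  | zero => simp
  | add l l' _ _ h1 h2 => simpa using h1.add h2
  | smul a l _ h1 => simpa using h1.const_mul_left a

section expansion
variable {V : Type*} [AddCommGroup V] [Module ℝ V]

/-- The modes of the solution of `(1 + ε K) U = b₀ + ε b₁`. -/
def modes (K : V →ₗ[ℝ] V) (b₀ b₁ : V) : ℕ → V
  | 0 => b₀
  | 1 => b₁ - K b₀
  | m + 2 => -K (modes K b₀ b₁ (m + 1))

/-- Inserted into the equation, the truncated series telescopes, leaving a single defect of order `M
+ 1`. -/
lemma modes_sum (K : V →ₗ[ℝ] V) (b₀ b₁ : V) (ε : ℝ) (M : ℕ) :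
    ∑ k ∈ Finset.range (M + 1), ε ^ k • modes K b₀ b₁ k
      + ε • K (∑ k ∈ Finset.range (M + 1), ε ^ k • modes K b₀ b₁ k)
      = b₀ + ε • b₁ - ε ^ (M + 1) • modes K b₀ b₁ (M + 1) := by
  induction M with
  | zero => simp [modes, smul_sub]; abel
  | succ M ih =>
    rw [Finset.sum_range_succ, map_add, smul_add, add_add_add_comm, ih, map_smul]
    simp only [modes, smul_neg, smul_smul]
    rw [← pow_succ']
    abel

/-- The space is not assumed to carry a norm, so one is transported from coordinates in a basis;
linear maps and functionals are bounded for it. -/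
lemma exists_bound_of_finiteDimensional [FiniteDimensional ℝ V] (K : V →ₗ[ℝ] V) :
    ∃ (N : V → ℝ) (κ : ℝ), 0 ≤ κ ∧ (∀ x, 0 ≤ N x) ∧ (∀ x, N x = 0 → x = 0) ∧
      (∀ x y, N (x - y) ≤ N x + N y) ∧ (∀ (a : ℝ) x, N (a • x) = |a| * N x) ∧
      (∀ x, N (K x) ≤ κ * N x) ∧ ∀ l : Module.Dual ℝ V, ∃ c, ∀ x, |l x| ≤ c * N x := by
  let e := (Module.finBasis ℝ V).equivFun
  let K' := LinearMap.toContinuousLinearMap (e.toLinearMap ∘ₗ K ∘ₗ e.symm.toLinearMap)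
  refine ⟨fun x => ‖e x‖, ‖K'‖, norm_nonneg _, fun x => norm_nonneg _,
    fun x hx => by simpa using hx, fun x y => ?_, fun a x => ?_, fun x => ?_, fun l => ?_⟩
  · simpa using norm_sub_le (e x) (e y)
  · simpa using norm_smul a (e x)
  · have := K'.le_opNorm (e x)
    simpa [K'] using this
  · let l' := LinearMap.toContinuousLinearMap (l ∘ₗ e.symm.toLinearMap)
    refine ⟨‖l'‖, fun x => ?_⟩
    have := l'.le_opNorm (e x)
    simpa [l'] using this

/-- A kernel vector satisfies `N z ≤ ε * κ * N z`, so it vanishes once `ε * κ < 1`; finite dimension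
then gives surjectivity. -/
lemma eventually_bijective_one_add_smul [FiniteDimensional ℝ V] (K : V →ₗ[ℝ] V) :
    ∀ᶠ ε in 𝓝[>] (0 : ℝ), Function.Bijective fun z : V => z + ε • K z := by
  obtain ⟨N, κ, hκ, h0, h1, h2, h3, h4, -⟩ := exists_bound_of_finiteDimensional K
  have hsmall : ∀ᶠ ε in 𝓝[>] (0 : ℝ), ε < 1 / (κ + 1) :=
    mem_nhdsWithin_of_mem_nhds (gt_mem_nhds (by positivity))
  filter_upwards [hsmall, self_mem_nhdsWithin] with ε hε hpos
  have hpos' : 0 < ε := hpos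
  rw [lt_div_iff₀ (by positivity)] at hε
  let L : V →ₗ[ℝ] V := LinearMap.id + ε • K
  have hinj : Function.Injective L := by
    refine (injective_iff_map_eq_zero L).2 fun z hz => h1 z ?_
    have hz' : z = (-ε) • K z := by
      rw [neg_smul]; exact eq_neg_of_add_eq_zero_left hz
    have h5 : N z = ε * N (K z) := by
      conv_lhs => rw [hz', h3, abs_neg, abs_of_pos hpos']
    nlinarith [h4 z, h0 z, mul_le_mul_of_nonneg_left (h4 z) hpos'.le]
  exact ⟨hinj, LinearMap.injective_iff_surjective.1 hinj⟩

/-- By `modes_sum` the remainder `z` solves `z + ε • K z = ε ^ (M + 1) • y` with `y` the next mode.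
For small ε the term with `K` is absorbed at the cost of a factor 2, so the remainder is `O(ε ^ (M +
1))`. -/
lemma expansion_of_modes [FiniteDimensional ℝ V] (K : V →ₗ[ℝ] V) (b₀ b₁ : V) {U : ℝ → V}
    (hU : ∀ᶠ ε in 𝓝[>] (0 : ℝ), U ε + ε • K (U ε) = b₀ + ε • b₁) (l : Module.Dual ℝ V) (M : ℕ) :
    (fun ε : ℝ => l (U ε - ∑ k ∈ Finset.range (M + 1), ε ^ k • modes K b₀ b₁ k))
      =o[𝓝[>] 0] fun ε => ε ^ M := by
  obtain ⟨N, κ, hκ, h0, h1, h2, h3, h4, h5⟩ := exists_bound_of_finiteDimensional K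
  obtain ⟨c, hc⟩ := h5 l
  have hsmall : ∀ᶠ ε in 𝓝[>] (0 : ℝ), ε < 1 / (2 * (κ + 1)) :=
    mem_nhdsWithin_of_mem_nhds (gt_mem_nhds (by positivity))
  have hO : (fun ε : ℝ => ε ^ (M + 1)) =o[𝓝[>] 0] fun ε : ℝ => ε ^ M :=
    (isLittleO_pow_pow (𝕜 := ℝ) (Nat.lt_succ_self M)).mono nhdsWithin_le_nhds
  refine IsBigO.trans_isLittleO ?_ hO
  refine IsBigO.of_bound (|c| * (2 * N (modes K b₀ b₁ (M + 1)))) ?_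
  filter_upwards [hU, hsmall, self_mem_nhdsWithin] with ε hε hs hpos
  have hpos' : 0 < ε := hpos
  rw [lt_div_iff₀ (by positivity)] at hs
  set z := U ε - ∑ k ∈ Finset.range (M + 1), ε ^ k • modes K b₀ b₁ k with hz
  set y := modes K b₀ b₁ (M + 1) with hy
  have hzy : z = ε ^ (M + 1) • y - ε • K z := by
    have h6 := modes_sum K b₀ b₁ ε M
    rw [← hε, ← hy] at h6
    rw [eq_sub_iff_add_eq, hz, map_sub, smul_sub, sub_add_sub_comm, h6, sub_sub_cancel]
  have h7 : N z ≤ ε ^ (M + 1) * N y + ε * N (K z) := by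
    calc N z = N (ε ^ (M + 1) • y - ε • K z) := by rw [← hzy]
      _ ≤ _ := by
        refine (h2 _ _).trans ?_
        rw [h3, h3, abs_of_pos hpos', abs_of_pos (pow_pos hpos' _)]
  have h8 : N z ≤ 2 * N y * ε ^ (M + 1) := by
    nlinarith [h4 z, h0 z, mul_le_mul_of_nonneg_left (h4 z) hpos'.le]
  rw [Real.norm_eq_abs, Real.norm_eq_abs, abs_of_pos (pow_pos hpos' _)]
  calc |l z| ≤ c * N z := hc z
    _ ≤ |c| * N z := mul_le_mul_of_nonneg_right (le_abs_self c) (h0 z)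
    _ ≤ |c| * (2 * N y * ε ^ (M + 1)) := mul_le_mul_of_nonneg_left h8 (abs_nonneg c)
    _ = _ := by ring
end expansion
end

/-! ### The forms as functionals, and the three claims. -/

noncomputable section

variable {𝓣 : TriMesh} {P : ℕ} {α γ : ℝ} {d : RobinData}

/-- The test function `v / γ - ∇v · n` of the Nitsche terms in `L²(Γ)`. -/
def TriMesh.testL2 (𝓣 : TriMesh) (P : ℕ) (γ : ℝ) :
    𝓣.feSpace P →ₗ[ℝ] Lp ℝ 2 (bdryMeasure 𝓣.domain) :=
  γ⁻¹ • 𝓣.traceL2 P - 𝓣.normalL2 P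

/-- `N_Γ` as a linear map from `L²(Γ)` to the functionals of the test function. -/
def TriMesh.formNL (𝓣 : TriMesh) (P : ℕ) (γ : ℝ) :
    Lp ℝ 2 (bdryMeasure 𝓣.domain) →ₗ[ℝ] Module.Dual ℝ (𝓣.feSpace P) :=
  (innerₗ (Lp ℝ 2 (bdryMeasure 𝓣.domain))).compl₂ (𝓣.testL2 P γ)

/-- `I_Ω(u) - (∇u · n, v)_Γ` as a bilinear form. -/
def TriMesh.formA (𝓣 : TriMesh) (P : ℕ) (α : ℝ) :
    𝓣.feSpace P →ₗ[ℝ] Module.Dual ℝ (𝓣.feSpace P) :=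
  (innerₗ (Lp Plane 2 (volume.restrict 𝓣.domain))).compl₁₂ (𝓣.gradL2 P) (𝓣.gradL2 P)
    + α • (innerₗ (Lp ℝ 2 (volume.restrict 𝓣.domain))).compl₁₂ (𝓣.toL2 P) (𝓣.toL2 P)
    - (innerₗ (Lp ℝ 2 (bdryMeasure 𝓣.domain))).compl₁₂ (𝓣.normalL2 P) (𝓣.traceL2 P)

/-- `(f, v)_Ω` as a functional of the test function. -/
def TriMesh.load (𝓣 : TriMesh) (P : ℕ) {f : Plane → ℝ} (hf : MemLp f 2 (volume.restrict 𝓣.domain)) :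
    Module.Dual ℝ (𝓣.feSpace P) :=
  (innerₗ (Lp ℝ 2 (volume.restrict 𝓣.domain)) (hf.toLp f)).comp (𝓣.toL2 P)

lemma TriMesh.load_apply {f : Plane → ℝ} (hf : MemLp f 2 (volume.restrict 𝓣.domain))
    (v : 𝓣.feSpace P) : 𝓣.load P hf v = domPair 𝓣.domain f v :=
  (domPair_eq hf (𝓣.memLp_of_mem v.2)).symm

lemma TriMesh.formNL_apply {g : Plane → ℝ} (hg : MemLp g 2 (bdryMeasure 𝓣.domain))
    (v : 𝓣.feSpace P) : 𝓣.formNL P γ (hg.toLp g) v = formN 𝓣.domain γ g v := by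
  have hm : MemLp (γ⁻¹ • (v : Plane → ℝ) - normalDeriv 𝓣.domain v) 2 (bdryMeasure 𝓣.domain) :=
    ((𝓣.memLp_trace v.2).const_smul γ⁻¹).sub (𝓣.memLp_normalDeriv v.2)
  have e : (fun x => (v : Plane → ℝ) x / γ - normalDeriv 𝓣.domain v x) =
      γ⁻¹ • (v : Plane → ℝ) - normalDeriv 𝓣.domain v := by
    ext x; simp [div_eq_inv_mul]
  rw [formN, e, bdryPair_eq hg hm]
  rfl

lemma TriMesh.formA_apply (u v : 𝓣.feSpace P) : 𝓣.formA P α u v =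
    formI 𝓣.domain α u v - bdryPair 𝓣.domain (normalDeriv 𝓣.domain u) v := by
  rw [formI, gradPair_eq, domPair_eq (𝓣.memLp_of_mem u.2) (𝓣.memLp_of_mem v.2),
    bdryPair_eq (𝓣.memLp_normalDeriv u.2) (𝓣.memLp_trace v.2)]
  rfl

lemma TriMesh.formN_sub {g k : Plane → ℝ} (hg : MemLp g 2 (bdryMeasure 𝓣.domain))
    (hk : MemLp k 2 (bdryMeasure 𝓣.domain)) (v : 𝓣.feSpace P) :
    formN 𝓣.domain γ (fun x => g x - k x) v = formN 𝓣.domain γ g v - formN 𝓣.domain γ k v := by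
  rw [← 𝓣.formNL_apply hg, ← 𝓣.formNL_apply hk, ← LinearMap.sub_apply, ← map_sub,
    ← MemLp.toLp_sub, 𝓣.formNL_apply (hg.sub hk)]
  rfl

lemma TriMesh.formN_neg {g : Plane → ℝ} (hg : MemLp g 2 (bdryMeasure 𝓣.domain))
    (v : 𝓣.feSpace P) :
    formN 𝓣.domain γ (fun x => -g x) v = -formN 𝓣.domain γ g v := by
  rw [← 𝓣.formNL_apply hg, ← LinearMap.neg_apply, ← map_neg, ← MemLp.toLp_neg,
    𝓣.formNL_apply hg.neg]
  rfl

/-- `N_Γ(u)` as a bilinear form. -/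
def TriMesh.formNT (𝓣 : TriMesh) (P : ℕ) (γ : ℝ) :
    𝓣.feSpace P →ₗ[ℝ] Module.Dual ℝ (𝓣.feSpace P) := 𝓣.formNL P γ ∘ₗ 𝓣.traceL2 P

/-- `N_Γ(∇u · n)` as a bilinear form. -/
def TriMesh.formND (𝓣 : TriMesh) (P : ℕ) (γ : ℝ) :
    𝓣.feSpace P →ₗ[ℝ] Module.Dual ℝ (𝓣.feSpace P) := 𝓣.formNL P γ ∘ₗ 𝓣.normalL2 P

lemma TriMesh.formNT_apply (u v : 𝓣.feSpace P) :
    𝓣.formNT P γ u v = formN 𝓣.domain γ u v := 𝓣.formNL_apply (𝓣.memLp_trace u.2) v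

lemma TriMesh.formND_apply (u v : 𝓣.feSpace P) :
    𝓣.formND P γ u v = formN 𝓣.domain γ (normalDeriv 𝓣.domain u) v :=
  𝓣.formNL_apply (𝓣.memLp_normalDeriv u.2) v

lemma RobinData.memLp_source {Ω : Set Plane} (hd : d.SquareIntegrable Ω) (m : ℕ) :
    MemLp (d.source m) 2 (volume.restrict Ω) := by
  cases m with
  | zero => exact hd.1
  | succ m => exact MemLp.zero

lemma RobinData.memLp_dirichlet (hd : d.SquareIntegrable 𝓣.domain) {u : ℕ → Plane → ℝ} {m : ℕ}
    (hu : ∀ l < m, u l ∈ 𝓣.feSpace P) : MemLp (d.dirichlet 𝓣.domain u m) 2 (bdryMeasure 𝓣.domain) :=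
  match m with
  | 0 => hd.2.1
  | 1 => hd.2.2.sub (𝓣.memLp_normalDeriv (hu 0 one_pos))
  | m + 2 => (𝓣.memLp_normalDeriv (hu (m + 1) (by omega))).neg

lemma TriMesh.eq_zero_of_domPair {v : Plane → ℝ} (hv : v ∈ 𝓣.feSpace P)
    (h : domPair 𝓣.domain v v = 0) : v = 0 := by
  have h1 := (integral_eq_zero_iff_of_nonneg (fun x => mul_self_nonneg (v x))
    (integrable_mul_of_memLp (𝓣.memLp_of_mem hv) (𝓣.memLp_of_mem hv))).1 h
  have h2 : v =ᵐ[volume.restrict 𝓣.domain] 0 := by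
    filter_upwards [h1] with x hx using mul_self_eq_zero.1 hx
  have h3 : Set.EqOn v 0 𝓣.domain := Measure.eqOn_open_of_ae_eq h2 𝓣.isOpen_domain
    (hv.1.mono subset_closure) continuousOn_const
  have h4 : Set.EqOn v 0 (closure 𝓣.domain) :=
    h3.of_subset_closure hv.1 continuousOn_const subset_closure subset_rfl
  ext x
  by_cases hx : x ∈ closure 𝓣.domain
  · exact h4 hx
  · exact hv.2.2 x hx

/-- The modes of an expansion of discrete solutions solve the cascade. -/
theorem modeEq_of_expansion (hγ : 0 < γ) (hd : d.SquareIntegrable 𝓣.domain)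
    {U : ℝ → Plane → ℝ} {u : ℕ → Plane → ℝ} {M : ℕ}
    (hU : ∀ᶠ ε in 𝓝[>] (0 : ℝ), SolvesRobin 𝓣 P d γ ε (U ε)) (hu : ∀ m ≤ M, u m ∈ 𝓣.feSpace P)
    (hexp : HasExpansion 𝓣.domain U u M) {m : ℕ} (hm : m ≤ M) {v : Plane → ℝ}
    (hv : v ∈ 𝓣.feSpace P) : ModeEq 𝓣.domain d γ u m (u m) v := by
  classical
  set V := 𝓣.feSpace P with hV
  -- The default value 0 is harmless: `U ε` lies in the space for all small positive ε.
  set U' : ℝ → V := fun ε => if h : U ε ∈ V then ⟨U ε, h⟩ else 0 with hU'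
  set u' : ℕ → V := fun k => if h : u k ∈ V then ⟨u k, h⟩ else 0 with hu'
  have hUe : ∀ ε, U ε ∈ V → (U' ε : Plane → ℝ) = U ε := fun ε h => by simp [hU', h]
  have hue : ∀ k ≤ M, (u' k : Plane → ℝ) = u k := fun k h => by simp [hu', hu k h]
  set v' : V := ⟨v, hv⟩ with hv'
  -- Evaluations at points of the closure separate finite element functions, since these vanish
  -- elsewhere. Hence the pointwise expansion passes to every linear functional.
  have hsep : ∀ z : V, z ≠ 0 → ∃ l ∈ {l : Module.Dual ℝ V | ∃ x ∈ closure 𝓣.domain,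
      l = (LinearMap.proj x).comp V.subtype}, l z ≠ 0 := by
    intro z hz
    by_contra! hall
    refine hz (Subtype.ext (funext fun x => ?_))
    by_cases hx : x ∈ closure 𝓣.domain
    · exact hall _ ⟨x, hx, rfl⟩
    · exact z.2.2.2 x hx
  have hlit := isLittleO_of_separating hsep
    (r := fun ε => U' ε - ∑ k ∈ Finset.range (M + 1), ε ^ k • u' k) (F := 𝓝[>] (0 : ℝ))
    (g := fun ε => ε ^ M) (by
      rintro _ ⟨x, hx, rfl⟩
      refine (hexp x hx).congr' ?_ EventuallyEq.rfl
      filter_upwards [hU] with ε hε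
      simp only [LinearMap.comp_apply, map_sub, map_sum, map_smul, LinearMap.proj_apply,
        Submodule.subtype_apply, hUe ε hε.1, smul_eq_mul]
      congr 1
      refine Finset.sum_congr rfl fun k hk => ?_
      rw [hue k (Nat.lt_succ_iff.1 (Finset.mem_range.1 hk))])
  set ℓA : Module.Dual ℝ V := (𝓣.formA P d.α).flip v' with hℓA
  set ℓ₁ : Module.Dual ℝ V := (𝓣.formNT P γ).flip v' with hℓ₁
  set ℓ₂ : Module.Dual ℝ V := (𝓣.formND P γ).flip v' with hℓ₂
  set L₀ : Module.Dual ℝ V := γ • (ℓA + ℓ₁) with hL₀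
  set L₁ : Module.Dual ℝ V := ℓA + γ • ℓ₂ with hL₁
  set F := domPair 𝓣.domain d.f v with hF
  set g₀ := formN 𝓣.domain γ d.uRD v with hg₀
  set g₁ := formN 𝓣.domain γ d.qRN v with hg₁
  set r : ℕ → ℝ := fun k => match k with
    | 0 => γ * (F + g₀)
    | 1 => F + γ * g₁
    | _ + 2 => 0 with hr
  -- The coefficient of `ε ^ k` after the expansion is inserted into (R) multiplied by `γ + ε`, that
  -- is, into `L₀ U + ε L₁ U = r 0 + ε r 1`.
  set c : ℕ → ℝ := fun k => match k with
    | 0 => L₀ (u' 0) - r 0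
    | k + 1 => L₀ (u' (k + 1)) + L₁ (u' k) - r (k + 1) with hc
  have hsum : ∀ (ε : ℝ) (N : ℕ), L₀ (∑ k ∈ Finset.range (N + 1), ε ^ k • u' k)
      + ε * L₁ (∑ k ∈ Finset.range (N + 1), ε ^ k • u' k) - (r 0 + ε * r 1) =
      ∑ k ∈ Finset.range (N + 1), ε ^ k * c k + ε ^ (N + 1) * (L₁ (u' N) - r (N + 1)) := by
    intro ε N
    induction N with
    | zero => simp [hc]; ring
    | succ N ih =>
      rw [Finset.sum_range_succ, Finset.sum_range_succ _ (N + 1), map_add, map_add, map_smul,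
        map_smul, smul_eq_mul, smul_eq_mul]
      have e1 : c (N + 1) = L₀ (u' (N + 1)) + L₁ (u' N) - r (N + 1) := rfl
      have e2 : r (N + 1 + 1) = 0 := rfl
      rw [e1, e2]
      linear_combination ih
  have hrob : ∀ᶠ ε in 𝓝[>] (0 : ℝ), L₀ (U' ε) + ε * L₁ (U' ε) = r 0 + ε * r 1 := by
    filter_upwards [hU, self_mem_nhdsWithin] with ε hε hpos
    have hpos' : 0 < ε := hpos
    have h := hε.2 v hv
    have e := hUe ε hε.1
    have t1 : formN 𝓣.domain γ (fun x => U ε x - d.uRD x) v = ℓ₁ (U' ε) - g₀ := by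
      have := 𝓣.formN_sub (γ := γ) (𝓣.memLp_trace (U' ε).2) hd.2.1 v'
      rw [e] at this
      rw [this, hℓ₁, LinearMap.flip_apply, 𝓣.formNT_apply, e]
    have t2 : formN 𝓣.domain γ (fun x => normalDeriv 𝓣.domain (U ε) x - d.qRN x) v
        = ℓ₂ (U' ε) - g₁ := by
      have := 𝓣.formN_sub (γ := γ) (𝓣.memLp_normalDeriv (U' ε).2) hd.2.2 v'
      rw [e] at this
      rw [this, hℓ₂, LinearMap.flip_apply, 𝓣.formND_apply, e]
    have t3 : formI 𝓣.domain d.α (U ε) v - bdryPair 𝓣.domain (normalDeriv 𝓣.domain (U ε)) v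
        = ℓA (U' ε) := by
      rw [hℓA, LinearMap.flip_apply, 𝓣.formA_apply, e]
    rw [t1, t2] at h
    have hne : γ + ε ≠ 0 := by positivity
    have h' : (γ + ε) * (ℓA (U' ε) - F) + γ * (ℓ₁ (U' ε) - g₀) + ε * γ * (ℓ₂ (U' ε) - g₁) = 0 := by
      rw [← t3]
      have := congrArg (fun t => (γ + ε) * t) h
      simp only [mul_zero] at this
      rw [← this]
      field_simp
      ring
    change γ * (ℓA (U' ε) + ℓ₁ (U' ε)) + ε * (ℓA (U' ε) + γ * ℓ₂ (U' ε)) =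
      γ * (F + g₀) + ε * (F + γ * g₁)
    linear_combination h'
  have hc0 : ∀ k ≤ M, c k = 0 := by
    refine coeff_eq_zero_of_isLittleO c M ?_
    have hb : (fun ε : ℝ => ε) =O[𝓝[>] 0] fun _ => (1 : ℝ) :=
      (continuous_id.tendsto (0 : ℝ)).isBigO_one ℝ |>.mono nhdsWithin_le_nhds
    have hO : (fun ε : ℝ => ε ^ (M + 1)) =o[𝓝[>] 0] fun ε : ℝ => ε ^ M :=
      (isLittleO_pow_pow (𝕜 := ℝ) (Nat.lt_succ_self M)).mono nhdsWithin_le_nhds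
    have h1 := hlit L₀
    have h2 := hb.mul_isLittleO (hlit L₁)
    simp only [one_mul] at h2
    have h3 := hO.const_mul_left (L₁ (u' M) - r (M + 1))
    refine ((h1.add h2).add h3).neg_left.congr' ?_ EventuallyEq.rfl
    filter_upwards [hrob] with ε hε
    have := hsum ε M
    rw [map_sub, map_sub]
    linear_combination this - hε
  set a : ℕ → ℝ := fun k => formI 𝓣.domain d.α (u k) v - domPair 𝓣.domain (d.source k) v
    - bdryPair 𝓣.domain (normalDeriv 𝓣.domain (u k)) v with ha
  set n : ℕ → ℝ := fun k => formN 𝓣.domain γ (fun x => u k x - d.dirichlet 𝓣.domain u k x) v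
    with hn
  have ha' : ∀ k ≤ M, a k = ℓA (u' k) - domPair 𝓣.domain (d.source k) v := by
    intro k hk
    rw [hℓA, LinearMap.flip_apply, 𝓣.formA_apply, hue k hk, ha]
    ring
  have hn' : ∀ k ≤ M, n k = ℓ₁ (u' k) - formN 𝓣.domain γ (d.dirichlet 𝓣.domain u k) v := by
    intro k hk
    have := 𝓣.formN_sub (γ := γ) (𝓣.memLp_trace (hu k hk))
      (d.memLp_dirichlet hd (u := u) (m := k) fun l hl => hu l (hl.le.trans hk)) v'
    rw [hℓ₁, LinearMap.flip_apply, 𝓣.formNT_apply, hue k hk]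
    exact this
  have hs : ∀ k, domPair 𝓣.domain (d.source (k + 1)) v = 0 := by
    intro k; simp [RobinData.source, domPair]
  have hN₂ : ∀ k ≤ M, formN 𝓣.domain γ (normalDeriv 𝓣.domain (u k)) v = ℓ₂ (u' k) := by
    intro k hk
    rw [hℓ₂, LinearMap.flip_apply, 𝓣.formND_apply, hue k hk]
  have key0 : a 0 + n 0 = 0 := by
    have h := hc0 0 (Nat.zero_le _)
    rw [ha' 0 (Nat.zero_le _), hn' 0 (Nat.zero_le _)]
    have h' : γ * ((ℓA (u' 0) - F) + (ℓ₁ (u' 0) - g₀)) = 0 := by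
      have : γ * (ℓA (u' 0) + ℓ₁ (u' 0)) - γ * (F + g₀) = 0 := h
      linear_combination this
    exact (mul_eq_zero.1 h').resolve_left hγ.ne'
  -- The term `γ * ℓ₂ (u' k)`, with `qRN` when `k = 0`, is exactly the Dirichlet datum of order `k +
  -- 1` inside `n (k + 1)`; what remains of `L₁` is `a k`.
  have key : ∀ k < M, γ * (a (k + 1) + n (k + 1)) = -a k := by
    intro k hk
    have h : γ * (ℓA (u' (k + 1)) + ℓ₁ (u' (k + 1))) + (ℓA (u' k) + γ * ℓ₂ (u' k)) - r (k + 1) = 0 :=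
      hc0 (k + 1) hk
    rw [ha' (k + 1) hk, hn' (k + 1) hk, ha' k hk.le, hs]
    cases k with
    | zero =>
      have e1 : formN 𝓣.domain γ (d.dirichlet 𝓣.domain u (0 + 1)) v = g₁ - ℓ₂ (u' 0) := by
        rw [← hN₂ 0 hk.le]
        exact 𝓣.formN_sub hd.2.2 (𝓣.memLp_normalDeriv (hu 0 hk.le)) v'
      have e2 : r (0 + 1) = F + γ * g₁ := rfl
      have e3 : domPair 𝓣.domain (d.source 0) v = F := rfl
      rw [e1, e3]
      rw [e2] at h
      linear_combination h
    | succ k =>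
      have e1 : formN 𝓣.domain γ (d.dirichlet 𝓣.domain u (k + 1 + 1)) v = -ℓ₂ (u' (k + 1)) := by
        rw [← hN₂ (k + 1) hk.le]
        exact 𝓣.formN_neg (𝓣.memLp_normalDeriv (hu (k + 1) hk.le)) v'
      have e2 : r (k + 1 + 1) = 0 := rfl
      rw [e1, hs]
      rw [e2] at h
      linear_combination h
  have hfin := residual_eq_error hγ.ne' a n M key0 key m hm
  exact hfin

/-- The exact modes satisfy the discrete mode problems, with vanishing error term. -/
theorem modeEq_of_isExactMode (hd : d.SquareIntegrable 𝓣.domain) {w : ℕ → Plane → ℝ} {M : ℕ}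
    (hw : ∀ m ≤ M, IsExactMode 𝓣.domain d w m (w m)) {m : ℕ} (hm : m ≤ M) {v : Plane → ℝ}
    (hv : v ∈ 𝓣.feSpace P) :
    ModeEq 𝓣.domain d γ w m (w m) v ∧ errorTerm 𝓣.domain d γ w m v = 0 := by
  -- The boundary condition holds off the corners, hence almost everywhere on Γ, so every Nitsche
  -- residual vanishes and only Green's formula is left.
  have hn : ∀ l ≤ M, formN 𝓣.domain γ (fun x => w l x - d.dirichlet 𝓣.domain w l x) v = 0 := by
    intro l hl
    refine integral_eq_zero_of_ae (𝓣.ae_bdry_iff fun T hT i x hx hi hS => ?_)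
    have := (hw l hl).2.2.2 x hx ⟨_, 𝓣.isOutwardNormal hT hi hS⟩
    simp [this]
  have herr : errorTerm 𝓣.domain d γ w m v = 0 := by
    rw [errorTerm, Finset.sum_eq_zero, neg_zero]
    intro l hl
    rw [hn l ((Finset.mem_range.1 hl).le.trans hm), mul_zero]
  refine ⟨?_, herr⟩
  obtain ⟨h1, h2, h3, -⟩ := hw m hm
  rw [ModeEq, herr, hn m hm, add_zero]
  exact 𝓣.green h1 h2 (d.memLp_source hd m) h3 hv

/-- Solvability of the mode problems and of the Robin problem, and the expansion of the solutions
of the latter, if the Nitsche form is definite. -/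
theorem solvability_of_definite (hγ : 0 < γ) (hd : d.SquareIntegrable 𝓣.domain)
    (hdef : ∀ v ∈ 𝓣.feSpace P, nitscheForm 𝓣.domain d.α γ v v = 0 → v = 0) :
    (∀ (u : ℕ → Plane → ℝ) (m : ℕ), (∀ l < m, u l ∈ 𝓣.feSpace P) →
      ∃! w, w ∈ 𝓣.feSpace P ∧ ∀ v ∈ 𝓣.feSpace P, ModeEq 𝓣.domain d γ u m w v) ∧
    (∀ᶠ ε in 𝓝[>] (0 : ℝ), ∃! z, SolvesRobin 𝓣 P d γ ε z) ∧
    ∃ u : ℕ → Plane → ℝ, (∀ m, u m ∈ 𝓣.feSpace P) ∧ ∀ U : ℝ → Plane → ℝ,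
      (∀ᶠ ε in 𝓝[>] (0 : ℝ), SolvesRobin 𝓣 P d γ ε (U ε)) → ∀ M, HasExpansion 𝓣.domain U u M := by
  classical
  set V := 𝓣.feSpace P with hV
  set A := 𝓣.formA P d.α with hA
  set N₁ := 𝓣.formNT P γ with hN₁
  set N₂ := 𝓣.formND P γ with hN₂
  set F := 𝓣.load P hd.1 with hF
  set g₀ := 𝓣.formNL P γ (hd.2.1.toLp d.uRD) with hg₀
  set g₁ := 𝓣.formNL P γ (hd.2.2.toLp d.qRN) with hg₁
  have hB0 : Function.Injective (A + N₁) := by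
    refine (injective_iff_map_eq_zero _).2 fun z hz => Subtype.ext (hdef z z.2 ?_)
    have h := LinearMap.congr_fun hz z
    rw [LinearMap.add_apply, LinearMap.add_apply, hA, hN₁, 𝓣.formA_apply, 𝓣.formNT_apply] at h
    exact h
  -- The space and its dual have the same finite dimension, so definiteness yields existence as well
  -- as uniqueness.
  have hBs : Function.Surjective (A + N₁) :=
    (LinearMap.injective_iff_surjective_of_finrank_eq_finrank
      (Subspace.dual_finrank_eq (K := ℝ) (V := V)).symm).1 hB0
  set B : V ≃ₗ[ℝ] Module.Dual ℝ V := LinearEquiv.ofBijective (A + N₁) ⟨hB0, hBs⟩ with hB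
  have hBapp : ∀ z v : V, B z v = A z v + N₁ z v := fun z v => rfl
  refine ⟨fun u m hu => ?_, ?_⟩
  · have hdir := d.memLp_dirichlet hd (u := u) hu
    set G : ℕ → Lp ℝ 2 (bdryMeasure 𝓣.domain) := fun l =>
      if h : MemLp (fun x => u l x - d.dirichlet 𝓣.domain u l x) 2 (bdryMeasure 𝓣.domain) then
        h.toLp else 0 with hG
    have hGl : ∀ l < m, ∀ v : V, 𝓣.formNL P γ (G l) v =
        formN 𝓣.domain γ (fun x => u l x - d.dirichlet 𝓣.domain u l x) v := by
      intro l hl v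
      have h : MemLp (fun x => u l x - d.dirichlet 𝓣.domain u l x) 2 (bdryMeasure 𝓣.domain) :=
        (𝓣.memLp_trace (hu l hl)).sub
          (d.memLp_dirichlet hd (u := u) fun k hk => hu k (hk.trans hl))
      simp only [hG]
      rw [dif_pos h, 𝓣.formNL_apply h]
    set R : Module.Dual ℝ V := 𝓣.load P (d.memLp_source hd m) + 𝓣.formNL P γ (hdir.toLp _)
      - ∑ l ∈ Finset.range m, (-γ) ^ (-((m : ℤ) - (l : ℤ))) • 𝓣.formNL P γ (G l) with hR
    have hiff : ∀ z v : V, ModeEq 𝓣.domain d γ u m z v ↔ B z v = R v := by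
      intro z v
      have e1 : errorTerm 𝓣.domain d γ u m v =
          -(∑ l ∈ Finset.range m, (-γ) ^ (-((m : ℤ) - (l : ℤ))) • 𝓣.formNL P γ (G l)) v := by
        rw [errorTerm, LinearMap.sum_apply]
        congr 1
        refine Finset.sum_congr rfl fun l hl => ?_
        rw [LinearMap.smul_apply, hGl l (Finset.mem_range.1 hl), smul_eq_mul]
      rw [ModeEq, e1, 𝓣.formN_sub (𝓣.memLp_trace z.2) hdir, hBapp, hR, LinearMap.sub_apply,
        LinearMap.add_apply, 𝓣.load_apply, 𝓣.formNL_apply, hA, hN₁, 𝓣.formA_apply,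
        𝓣.formNT_apply]
      constructor <;> intro h <;> linear_combination h
    refine ⟨B.symm R, ⟨(B.symm R).2, fun v hv => ?_⟩, ?_⟩
    · refine (hiff _ ⟨v, hv⟩).2 ?_
      rw [B.apply_symm_apply]
    · rintro y ⟨hy, hyv⟩
      have : B ⟨y, hy⟩ = R := LinearMap.ext fun v => (hiff ⟨y, hy⟩ v).1 (hyv v v.2)
      rw [← this, B.symm_apply_apply]
  -- Multiplication of (R) by `(γ + ε) / γ` and application of the inverse of `B` give `(1 + ε K) z
  -- = b₀ + ε b₁`.
  · set K : V →ₗ[ℝ] V := B.symm.toLinearMap ∘ₗ (γ⁻¹ • A + N₂) with hK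
    set b₀ := B.symm (F + g₀) with hb₀
    set b₁ := B.symm (γ⁻¹ • F + g₁) with hb₁
    have hrob : ∀ ε > 0, ∀ z : V,
        SolvesRobin 𝓣 P d γ ε z ↔ z + ε • K z = b₀ + ε • b₁ := by
      intro ε hε z
      have hne : γ + ε ≠ 0 := by positivity
      have e1 : z + ε • K z = b₀ + ε • b₁ ↔
          B z + ε • (γ⁻¹ • A + N₂) z = (F + g₀) + ε • (γ⁻¹ • F + g₁) := by
        rw [← B.injective.eq_iff]
        simp [hK, hb₀, hb₁]
      rw [e1, SolvesRobin, LinearMap.ext_iff]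
      have e2 : ∀ v : V, (formI 𝓣.domain d.α z v - domPair 𝓣.domain d.f v
          - bdryPair 𝓣.domain (normalDeriv 𝓣.domain z) v
          + γ / (γ + ε) * formN 𝓣.domain γ (fun x => (z : Plane → ℝ) x - d.uRD x) v
          + ε * γ / (γ + ε) * formN 𝓣.domain γ
            (fun x => normalDeriv 𝓣.domain z x - d.qRN x) v = 0 ↔
          (B z + ε • (γ⁻¹ • A + N₂) z) v = ((F + g₀) + ε • (γ⁻¹ • F + g₁)) v) := by
        intro v
        rw [𝓣.formN_sub (𝓣.memLp_trace z.2) hd.2.1, 𝓣.formN_sub (𝓣.memLp_normalDeriv z.2) hd.2.2,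
          ← 𝓣.formNT_apply, ← 𝓣.formND_apply, ← 𝓣.formNL_apply hd.2.1, ← 𝓣.formNL_apply hd.2.2,
          ← 𝓣.load_apply hd.1, sub_right_comm, ← 𝓣.formA_apply]
        simp only [LinearMap.add_apply, LinearMap.smul_apply, hBapp, smul_eq_mul]
        rw [← sub_eq_zero (b := _ + ε * _)]
        have e3 : A z v + N₁ z v + ε * (γ⁻¹ * A z v + N₂ z v) -
            (F v + g₀ v + ε * (γ⁻¹ * F v + g₁ v)) = (γ + ε) / γ *
            (A z v - F v + γ / (γ + ε) * (N₁ z v - g₀ v)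
              + ε * γ / (γ + ε) * (N₂ z v - g₁ v)) := by
          field_simp
          ring
        rw [e3, mul_eq_zero, or_iff_right (by positivity)]
      exact ⟨fun h v => (e2 v).1 (h.2 v v.2), fun h => ⟨z.2, fun v hv => (e2 ⟨v, hv⟩).2 (h ⟨v, hv⟩)⟩⟩
    refine ⟨?_, fun m => ((modes K b₀ b₁ m : V) : Plane → ℝ), fun m => (modes K b₀ b₁ m).2, fun U hU M x hx => ?_⟩
    · filter_upwards [eventually_bijective_one_add_smul K, self_mem_nhdsWithin] with ε hε hpos
      obtain ⟨z, hz⟩ := hε.2 (b₀ + ε • b₁)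
      refine ⟨z, (hrob ε hpos z).2 hz, fun y hy => ?_⟩
      have hy' := (hrob ε hpos ⟨y, hy.1⟩).1 hy
      exact congrArg Subtype.val (hε.1 (hy'.trans hz.symm))
    · set U' : ℝ → V := fun ε => if h : U ε ∈ V then ⟨U ε, h⟩ else 0 with hU'
      have hUe : ∀ ε, U ε ∈ V → (U' ε : Plane → ℝ) = U ε := fun ε h => by simp [hU', h]
      have hsol : ∀ᶠ ε in 𝓝[>] (0 : ℝ), U' ε + ε • K (U' ε) = b₀ + ε • b₁ := by
        filter_upwards [hU, self_mem_nhdsWithin] with ε hε hpos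
        refine (hrob ε hpos _).1 ?_
        rwa [hUe ε hε.1]
      refine (expansion_of_modes K b₀ b₁ hsol ((LinearMap.proj x).comp V.subtype) M).congr' ?_
        EventuallyEq.rfl
      filter_upwards [hU] with ε hε
      simp only [LinearMap.comp_apply, map_sub, map_sum, map_smul, LinearMap.proj_apply,
        Submodule.subtype_apply, hUe ε hε.1, smul_eq_mul]
end

theorem proposition4p1 (P : ℕ) (σ : ℝ) :
    -- the modes of an expansion of discrete solutions, and the exact modes, solve the cascade
    (∀ (𝓣 : TriMesh) (d : RobinData) (γ : ℝ), 0 < γ → d.SquareIntegrable 𝓣.domain →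
      (∀ (U : ℝ → Plane → ℝ) (u : ℕ → Plane → ℝ) (M : ℕ),
        (∀ᶠ ε in 𝓝[>] (0 : ℝ), SolvesRobin 𝓣 P d γ ε (U ε)) →
        (∀ m ≤ M, u m ∈ 𝓣.feSpace P) →
        HasExpansion 𝓣.domain U u M →
        ∀ m ≤ M, ∀ v ∈ 𝓣.feSpace P, ModeEq 𝓣.domain d γ u m (u m) v) ∧
      (∀ (w : ℕ → Plane → ℝ) (M : ℕ),
        (∀ m ≤ M, IsExactMode 𝓣.domain d w m (w m)) →
        ∀ m ≤ M, ∀ v ∈ 𝓣.feSpace P,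
          ModeEq 𝓣.domain d γ w m (w m) v ∧ errorTerm 𝓣.domain d γ w m v = 0)) ∧
    -- coercivity, uniform in the mesh size, and solvability of the cascade
    (∃ Cγ > 0, ∀ D : ℝ, ∃ c > 0, ∀ 𝓣 : TriMesh,
      𝓣.ShapeRegular σ → Metric.diam 𝓣.domain ≤ D →
      ∀ α γ : ℝ, 0 ≤ α → 0 < γ →
      (∀ T ∈ 𝓣.elems, (element T ∩ frontier 𝓣.domain).Nonempty →
        γ ≤ Cγ * Metric.diam (element T)) →
      (∀ v ∈ 𝓣.feSpace P,
        c * (gradPair 𝓣.domain v v + domPair 𝓣.domain v v + γ⁻¹ * bdryPair 𝓣.domain v v)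
          ≤ nitscheForm 𝓣.domain α γ v v) ∧
      ∀ d : RobinData, d.α = α → d.SquareIntegrable 𝓣.domain →
        (∀ (u : ℕ → Plane → ℝ) (m : ℕ), (∀ l < m, u l ∈ 𝓣.feSpace P) →
          ∃! w, w ∈ 𝓣.feSpace P ∧ ∀ v ∈ 𝓣.feSpace P, ModeEq 𝓣.domain d γ u m w v) ∧
        (∀ᶠ ε in 𝓝[>] (0 : ℝ), ∃! z, SolvesRobin 𝓣 P d γ ε z) ∧
        ∃ u : ℕ → Plane → ℝ, (∀ m, u m ∈ 𝓣.feSpace P) ∧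
          ∀ U : ℝ → Plane → ℝ,
            (∀ᶠ ε in 𝓝[>] (0 : ℝ), SolvesRobin 𝓣 P d γ ε (U ε)) →
            ∀ M, HasExpansion 𝓣.domain U u M) := by
  refine ⟨fun 𝓣 d γ hγ hd => ⟨fun U u M hU hu hexp m hm v hv =>
    modeEq_of_expansion hγ hd hU hu hexp hm hv,
    fun w M hw m hm v hv => modeEq_of_isExactMode hd hw hm hv⟩, ?_⟩
  obtain ⟨Cγ, hCγ, H⟩ := exists_coercive P σ
  refine ⟨Cγ, hCγ, fun D => ?_⟩
  obtain ⟨c, hc, Hc⟩ := H D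
  refine ⟨c, hc, fun 𝓣 hσ hD α γ hα hγ hγT => ?_⟩
  have hcoer := Hc 𝓣 hσ hD α γ hα hγ hγT
  refine ⟨hcoer, ?_⟩
  rintro d rfl hd
  refine solvability_of_definite hγ hd fun v hv h0 => ?_
  have h := hcoer v hv
  rw [h0] at h
  have h1 := gradPair_self_nonneg 𝓣.domain v
  have h2 := domPair_self_nonneg 𝓣.domain v
  have h3 : 0 ≤ γ⁻¹ * bdryPair 𝓣.domain v v :=
    mul_nonneg (inv_nonneg.2 hγ.le) (bdryPair_self_nonneg 𝓣.domain v)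
  -- The L² term in the coercivity bound yields definiteness, and continuity then gives `v = 0`
  -- pointwise.
  refine 𝓣.eq_zero_of_domPair hv (le_antisymm ?_ h2)
  have h4 := nonpos_of_mul_nonpos_right h hc
  linarith
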